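/- **Conventions.** Let $\Bbbk$ be a commutative ring. A graded $\Bbbk$-superalgebra is a $\Bbbk$-algebra $A=\bigoplus_{n\in\mathbb Z,\,\varepsilon\in\mathbb Z/2}A^n_\varepsilon$ with $A^n_\varepsilon A^m_\delta\subseteq A^{n+m}_{\varepsilon+\delta}$; put $A_\varepsilon=\bigoplus_nA^n_\varepsilon$. All algebras below are unital; subalgebras, submodules and idempotents called homogeneous are so for this bigrading. $\operatorname{mod}A$ is the category of finitely generated graded $A$-supermodules and degree- and parity-preserving $A$-homomorphisms, and $J(A)$ is the intersection of the annihilators of all simple graded $A$-supermodules. *Heredity data* on $A$ consist of a finite poset $I$, finite sets $X(i),Y(i)$ $(i\in I)$ of non-zero homogeneous elements of $A$ and initial elements $e_i\in X(i)\cap Y(i)$ such that, with $A(\Omega):=\operatorname{span}_\Bbbk\{xy\mid i\in\Omega,\ x\in X(i),\ y\in Y(i)\}$ for $\Omega\subseteq I$ and $A^{>i}:=A(\{j\mid j>i\})$: (a) the products $xy$, for $i\in I$ and $(x,y)\in X(i)\times Y(i)$, form a $\Bbbk$-basis of $A$; (b) for $x\in X(i)$, $y\in Y(i)$, $a\in A$,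 one has $ax\in\operatorname{span}X(i)+A^{>i}$ and $ya\in\operatorname{span}Y(i)+A^{>i}$; (c) for $x\in X(i)$, $y\in Y(i)$: $xe_i=x$, $e_ix=\delta_{x,e_i}x$, $e_iy=y$, $ye_i=\delta_{y,e_i}y$, and for every $j\in I$, $e_jx\in\{x,0\}$ and $ye_j\in\{y,0\}$. Then $A$ is called *based quasi-hereditary*. For an upper set $\Omega$, $A(\Omega)$ is an ideal. If $\mathfrak a\subseteq A_{\bar0}$ is a homogeneous unital subalgebra, the data are *$\mathfrak a$-conforming* if the sets $X(i)\cap A_{\bar0}$, $Y(i)\cap A_{\bar0}$ with the same $e_i$ are heredity data on $\mathfrak a$; $\mathfrak a(\Omega)$ and $\mathfrak a^{>i}$ are formed from these. With $\tilde A=A/A^{>i}$, the *standard module* is $\Delta_A(i)=\tilde A\tilde e_i$. It is paired with $\Delta_A^{\rm op}(i)=\tilde e_i\tilde A$ by $wv=(v,w)_i\,\tilde e_i$. For $\Bbbk$ local with maximal ideal $\mathfrak m$ and residue field $F$, $L_A(i)$ is the inflation to $A$ of the simple $A/\mathfrak mA$-module $\Delta_{A/\mathfrak mA}(i)/\operatorname{rad}$,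 i.e. $L_A(i)=\Delta_A(i)/\{v\mid (v,w)_i\in\mathfrak m\text{ for all }w\}$. $A$ is *basic* if $\dim_FL_A(i)=1$ for all $i$. A homogeneous idempotent $f\in A$ is *adapted* if for all $i$ there are subsets $\bar X(i)\subseteq X(i)$, $\bar Y(i)\subseteq Y(i)$ with $fx=x$ for $x\in\bar X(i)$, $fx=0$ for $x\in X(i)\setminus\bar X(i)$, $yf=y$ for $y\in\bar Y(i)$, $yf=0$ for $y\in Y(i)\setminus\bar Y(i)$. It is *strongly adapted* if moreover $fe_i=e_if=e_i$ for all $i\in\bar I:=\{i\mid\bar X(i)\ne\varnothing\ne\bar Y(i)\}$. **Theorem.** Let $\Bbbk$ be a commutative local ring and $A$ a unital based quasi-hereditary graded $\Bbbk$-superalgebra with $\mathfrak a$-conforming heredity data $(I,X,Y)$ and initial elements $e_i$, where $\mathfrak a\subseteq A_{\bar 0}$ is a homogeneous subalgebra with $1_{\mathfrak a}=1_A$. Then there are $\mathfrak a$-conforming heredity data $(I,X',Y')$ on $A$ with the same ideals $A(\Omega)$ and $\mathfrak a(\Omega)$ for all upper sets $\Omega\subseteq I$, whose initial elements $e_i'$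 are primitive idempotents of $\mathfrak a$ satisfying $e_ie_i'=e_i'=e_i'e_i$ and $e_i'\equiv e_i\pmod{\mathfrak a^{>i}}$ for all $i\in I$, such that, setting $f:=\sum_{i\in I}e_i'$, $\bar A:=fAf$ and $\bar{\mathfrak a}:=f\mathfrak af$, the following hold: (i) $f$ is a homogeneous idempotent, strongly adapted with respect to $(I,X',Y')$, with $\bar I=I$, and $\bar A$ is based quasi-hereditary with heredity data $(I,\bar X',\bar Y')$ and initial elements $e_i'$; (ii) $(I,\bar X',\bar Y')$ is $\bar{\mathfrak a}$-conforming; (iii) $\bar{\mathfrak a}$ is basic, and if $A_{\bar1}\subseteq J(A)$ then $\bar A$ is basic as well; (iv) the functors $\mathcal F_A:\operatorname{mod}A\to\operatorname{mod}\bar A$ and $\mathcal F_{\mathfrak a}:\operatorname{mod}\mathfrak a\to\operatorname{mod}\bar{\mathfrak a}$, $V\mapsto fV$, are equivalences of categories, and for all $i\in I$ $$\mathcal F_A(L_A(i))\cong L_{\bar A}(i),\quad \mathcal F_A(\Delta_A(i))\cong\Delta_{\bar A}(i),\quad \mathcal F_{\mathfrak a}(L_{\mathfrak a}(i))\cong L_{\bar{\mathfrak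 a}}(i),\quad \mathcal F_{\mathfrak a}(\Delta_{\mathfrak a}(i))\cong\Delta_{\bar{\mathfrak a}}(i).$$ Here $\Delta_A,L_A,\Delta_{\mathfrak a},L_{\mathfrak a}$ are formed from the original data, and the modules over $\bar A$, $\bar{\mathfrak a}$ from the truncated data. -/

import Mathlib

open CategoryTheory

universe u v

/-! ## Gradings by `ℤ × ℤ/2` -/

/-- Bidegrees: a pair (degree in `ℤ`, parity in `ℤ/2`). -/
abbrev Bideg : Type := ℤ × ZMod 2

section Gradings

variable {𝕜 : Type u} [CommRing 𝕜] {V : Type*} [AddCommGroup V] [Module 𝕜 V]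
  {U : Type*} [AddCommGroup U] [Module 𝕜 U]

/-- A submodule `W` of a graded supermodule `V = ⨁ V_d` is homogeneous if `W = ⨁ (W ∩ V_d)`. -/
def IsHomogSub (p : Bideg → Submodule 𝕜 V) (W : Submodule 𝕜 V) : Prop :=
  W ≤ ⨆ d, W ⊓ p d

open Classical in
/-- The homogeneous component of bidegree `d`. -/
noncomputable def homogComp {p : Bideg → Submodule 𝕜 V} (hp : DirectSum.IsInternal p)
    (d : Bideg) : V →ₗ[𝕜] V :=
  (p d).subtype ∘ₗ DirectSum.component 𝕜 Bideg (fun d => p d) d ∘ₗ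
    (LinearEquiv.ofBijective (DirectSum.coeLinearMap p) hp).symm.toLinearMap

theorem homogComp_mem {p : Bideg → Submodule 𝕜 V} (hp : DirectSum.IsInternal p)
    (d : Bideg) (v : V) : homogComp hp d v ∈ p d :=
  Subtype.prop _

theorem homogComp_of_mem {p : Bideg → Submodule 𝕜 V} (hp : DirectSum.IsInternal p)
    {d : Bideg} {v : V} (hv : v ∈ p d) (d' : Bideg) :
    homogComp hp d' v = if d = d' then v else 0 := by
  have : (LinearEquiv.ofBijective (DirectSum.coeLinearMap p) hp).symm v =
      DirectSum.lof 𝕜 Bideg (fun d => p d) d ⟨v, hv⟩ := by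
    rw [LinearEquiv.symm_apply_eq]
    exact (DirectSum.coeLinearMap_lof p d ⟨v, hv⟩).symm
  simp only [homogComp, LinearMap.comp_apply, LinearEquiv.coe_coe, this]
  split_ifs with h
  · subst h
    simp [DirectSum.component.lof_self]
  · rw [DirectSum.component.of]
    simp [h]

theorem mem_of_homogComp {p : Bideg → Submodule 𝕜 V} (hp : DirectSum.IsInternal p)
    (W : Submodule 𝕜 V) {v : V} (h : ∀ d, homogComp hp d v ∈ W) : v ∈ W := by
  classical
  set x := (LinearEquiv.ofBijective (DirectSum.coeLinearMap p) hp).symm v with hx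
  have hv : v = DirectSum.coeLinearMap p x := by
    have := (LinearEquiv.ofBijective (DirectSum.coeLinearMap p) hp).apply_symm_apply v
    rw [← hx] at this
    exact this.symm
  rw [hv, ← DirectSum.sum_support_of x, map_sum]
  refine Submodule.sum_mem _ fun d _ => ?_
  have := h d
  simp only [DirectSum.coeLinearMap_of]
  exact this

theorem isHomogSub_iff {p : Bideg → Submodule 𝕜 V} (hp : DirectSum.IsInternal p)
    (W : Submodule 𝕜 V) : IsHomogSub p W ↔ ∀ v ∈ W, ∀ d, homogComp hp d v ∈ W := by
  constructor
  · intro h v hv d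
    refine Submodule.iSup_induction (fun d => W ⊓ p d)
      (motive := fun v => homogComp hp d v ∈ W) (h hv) ?_ (by simp) ?_
    · intro d' x hx
      rw [homogComp_of_mem hp hx.2]
      split_ifs
      exacts [hx.1, W.zero_mem]
    · intro x y hx hy
      rw [map_add]
      exact W.add_mem hx hy
  · intro h v hv
    exact mem_of_homogComp hp _ fun d =>
      Submodule.mem_iSup_of_mem d ⟨h v hv d, homogComp_mem hp d v⟩

theorem isInternal_comap {p : Bideg → Submodule 𝕜 V} (hp : DirectSum.IsInternal p)
    (φ : U →ₗ[𝕜] V) (hφ : Function.Injective φ) (h : IsHomogSub p (LinearMap.range φ)) :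
    DirectSum.IsInternal fun d => (p d).comap φ := by
  rw [DirectSum.isInternal_submodule_iff_iSupIndep_and_iSup_eq_top]
  constructor
  · rw [iSupIndep_iff_finsetSum_eq_zero_imp_eq_zero]
    have := (iSupIndep_iff_finsetSum_eq_zero_imp_eq_zero _).1 hp.submodule_iSupIndep
    intro s x hx h0 i hi
    apply hφ
    rw [map_zero]
    exact this s (fun i => φ (x i)) (fun i hi => hx i hi) (by rw [← map_sum, h0, map_zero]) i hi
  · rw [eq_top_iff]
    intro u _
    have := h (LinearMap.mem_range_self φ u)
    have h2 : (⨆ d, LinearMap.range φ ⊓ p d) = (⨆ d, (p d).comap φ).map φ := by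
      rw [Submodule.map_iSup]
      congr 1
      ext1 d
      rw [Submodule.map_comap_eq]
    rw [h2] at this
    obtain ⟨u', hu', e⟩ := this
    rwa [← hφ e]

theorem isInternal_map {p : Bideg → Submodule 𝕜 V} (hp : DirectSum.IsInternal p)
    (φ : V →ₗ[𝕜] U) (hφ : Function.Surjective φ) (h : IsHomogSub p (LinearMap.ker φ)) :
    DirectSum.IsInternal fun d => (p d).map φ := by
  rw [DirectSum.isInternal_submodule_iff_iSupIndep_and_iSup_eq_top]
  constructor
  · rw [iSupIndep_iff_finsetSum_eq_zero_imp_eq_zero]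
    rw [isHomogSub_iff hp] at h
    intro s x hx h0 i hi
    choose! y hy hyx using hx
    have hk : ∑ i ∈ s, y i ∈ LinearMap.ker φ := by
      rw [LinearMap.mem_ker, map_sum, ← h0]
      exact Finset.sum_congr rfl fun i hi => hyx i hi
    have := h _ hk i
    rw [map_sum, Finset.sum_congr rfl fun j hj => homogComp_of_mem hp (hy j hj) i,
      Finset.sum_ite_eq' s i, if_pos hi, LinearMap.mem_ker, hyx i hi] at this
    exact this
  · rw [← Submodule.map_iSup, hp.submodule_iSup_eq_top, Submodule.map_top,
      LinearMap.range_eq_top.2 hφ]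

end Gradings

/-! ## Graded superalgebras -/

/-- A unital graded `𝕜`-superalgebra: a `𝕜`-algebra `A = ⨁ A^n_ε` with
`A^n_ε A^m_δ ⊆ A^{n+m}_{ε+δ}`. -/
structure GrSAlg (𝕜 : Type u) [CommRing 𝕜] where
  carrier : Type v
  [ring : Ring carrier]
  [algebra : Algebra 𝕜 carrier]
  gr : Bideg → Submodule 𝕜 carrier
  internal : DirectSum.IsInternal gr
  one_mem : (1 : carrier) ∈ gr 0
  mul_mem : ∀ {c d : Bideg} {a b : carrier}, a ∈ gr c → b ∈ gr d → a * b ∈ gr (c + d)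

namespace GrSAlg

variable {𝕜 : Type u} [CommRing 𝕜]

instance : CoeSort (GrSAlg.{u, v} 𝕜) (Type v) := ⟨GrSAlg.carrier⟩

instance (A : GrSAlg.{u, v} 𝕜) : Ring A := A.ring

instance (A : GrSAlg.{u, v} 𝕜) : Algebra 𝕜 A := A.algebra

/-- The part `A_ε = ⨁_n A^n_ε` of parity `ε`. -/
def parity (A : GrSAlg.{u, v} 𝕜) (ε : ZMod 2) : Submodule 𝕜 A := ⨆ n : ℤ, A.gr (n, ε)

/-- A homogeneous unital subalgebra, as a graded superalgebra. -/
def sub (A : GrSAlg.{u, v} 𝕜) (𝔞 : Subalgebra 𝕜 A)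
    (h : IsHomogSub A.gr (Subalgebra.toSubmodule 𝔞)) : GrSAlg.{u, v} 𝕜 where
  carrier := 𝔞
  gr d := (A.gr d).comap 𝔞.val.toLinearMap
  internal := isInternal_comap A.internal _ Subtype.val_injective (by
    have : LinearMap.range 𝔞.val.toLinearMap = Subalgebra.toSubmodule 𝔞 := by
      ext x; simp
    rw [this]; exact h)
  one_mem := A.one_mem
  mul_mem ha hb := A.mul_mem ha hb

/-- A homogeneous idempotent. (A non-zero homogeneous idempotent has bidegree `0`.) -/
structure HomIdem (A : GrSAlg.{u, v} 𝕜) where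
  val : A
  idem : IsIdempotentElem val
  mem : val ∈ A.gr 0

section Corner

variable {R : Type v} [Ring R] [Algebra 𝕜 R] {e : R}

instance (he : IsIdempotentElem e) : SMul 𝕜 he.Corner :=
  ⟨fun c x => ⟨c • x.1, by obtain ⟨r, hr⟩ := x.2; exact ⟨c • r, by simp [← hr]⟩⟩⟩

/-- The inclusion `eRe → R`. -/
def cornerIncl (he : IsIdempotentElem e) : he.Corner →+ R where
  toFun x := x.1
  map_zero' := rfl
  map_add' _ _ := rfl

instance (he : IsIdempotentElem e) : Module 𝕜 he.Corner :=
  Function.Injective.module 𝕜 (cornerIncl he) Subtype.val_injective fun _ _ => rfl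

instance (he : IsIdempotentElem e) : Algebra 𝕜 he.Corner :=
  Algebra.ofModule (fun c x y => Subtype.ext (smul_mul_assoc c x.1 y.1))
    (fun c x y => Subtype.ext (mul_smul_comm c x.1 y.1))

/-- The `𝕜`-linear inclusion `eRe → R`. -/
def cornerLin (he : IsIdempotentElem e) : he.Corner →ₗ[𝕜] R where
  toFun x := x.1
  map_add' _ _ := rfl
  map_smul' _ _ := rfl

theorem corner_left (he : IsIdempotentElem e) (x : he.Corner) : e * x.1 = x.1 :=
  ((Subsemigroup.mem_corner_iff he).1 x.2).1

theorem corner_right (he : IsIdempotentElem e) (x : he.Corner) : x.1 * e = x.1 :=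
  ((Subsemigroup.mem_corner_iff he).1 x.2).2

end Corner

theorem homogComp_mul (A : GrSAlg.{u, v} 𝕜) {c : Bideg} {a : A} (ha : a ∈ A.gr c) (b : A)
    (d : Bideg) : homogComp A.internal (c + d) (a * b) = a * homogComp A.internal d b := by
  have hb : b ∈ ⨆ d, A.gr d := by simp [A.internal.submodule_iSup_eq_top]
  refine Submodule.iSup_induction A.gr
    (motive := fun b => homogComp A.internal (c + d) (a * b) = a * homogComp A.internal d b)
    hb ?_ (by simp) ?_
  · intro d' x hx
    rw [homogComp_of_mem _ hx, homogComp_of_mem _ (A.mul_mem ha hx)]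
    simp
  · intro x y hx hy
    rw [mul_add, map_add, map_add, mul_add, hx, hy]

theorem homogComp_mul_right (A : GrSAlg.{u, v} 𝕜) {c : Bideg} {a : A} (ha : a ∈ A.gr c) (b : A)
    (d : Bideg) : homogComp A.internal (d + c) (b * a) = homogComp A.internal d b * a := by
  have hb : b ∈ ⨆ d, A.gr d := by simp [A.internal.submodule_iSup_eq_top]
  refine Submodule.iSup_induction A.gr
    (motive := fun b => homogComp A.internal (d + c) (b * a) = homogComp A.internal d b * a)
    hb ?_ (by simp) ?_
  · intro d' x hx
    rw [homogComp_of_mem _ hx, homogComp_of_mem _ (A.mul_mem hx ha)]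
    simp
  · intro x y hx hy
    rw [add_mul, map_add, map_add, add_mul, hx, hy]

/-- The idempotent truncation `fAf`, a graded superalgebra with identity `f`. -/
def corner (A : GrSAlg.{u, v} 𝕜) (f : HomIdem A) : GrSAlg.{u, v} 𝕜 where
  carrier := f.idem.Corner
  gr d := (A.gr d).comap (cornerLin f.idem)
  internal := isInternal_comap A.internal _ Subtype.val_injective (by
    rw [isHomogSub_iff A.internal]
    rintro _ ⟨x, rfl⟩ d
    refine ⟨⟨homogComp A.internal d x.1, (Subsemigroup.mem_corner_iff f.idem).2 ⟨?_, ?_⟩⟩, rfl⟩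
    · rw [← A.homogComp_mul f.mem, zero_add, corner_left]
    · rw [← A.homogComp_mul_right f.mem, add_zero, corner_right])
  one_mem := f.mem
  mul_mem ha hb := A.mul_mem ha hb

/-- The inclusion `fAf → A` on elements. -/
def cornerVal (A : GrSAlg.{u, v} 𝕜) (f : HomIdem A) (x : A.corner f) : A := cornerLin (𝕜 := 𝕜) f.idem x

variable (A : GrSAlg.{u, v} 𝕜) (𝔞 : Subalgebra 𝕜 A)
  (h𝔞 : IsHomogSub A.gr (Subalgebra.toSubmodule 𝔞))

/-- The inclusion of a homogeneous unital subalgebra. -/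
def subIncl : A.sub 𝔞 h𝔞 →ₐ[𝕜] A := 𝔞.val

/-- A homogeneous idempotent of the subalgebra `𝔞`, considered as an idempotent of `A`. -/
def HomIdem.ofSub (f : HomIdem (A.sub 𝔞 h𝔞)) : HomIdem A where
  val := A.subIncl 𝔞 h𝔞 f.val
  idem := f.idem.map _
  mem := f.mem

/-- For an idempotent `f ∈ 𝔞`, the inclusion `f𝔞f → fAf`. -/
def cornerSubIncl (f : HomIdem (A.sub 𝔞 h𝔞)) :
    (A.sub 𝔞 h𝔞).corner f →ₐ[𝕜] A.corner (f.ofSub A 𝔞 h𝔞) :=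
  AlgHom.ofLinearMap
    { toFun := fun x => ⟨A.subIncl 𝔞 h𝔞 x.1, by
        obtain ⟨r, hr⟩ := x.2
        exact ⟨A.subIncl 𝔞 h𝔞 r, by
          simp only [HomIdem.ofSub, ← map_mul]
          exact congrArg _ hr⟩⟩
      map_add' := fun _ _ => rfl
      map_smul' := fun _ _ => rfl }
    rfl (fun _ _ => rfl)

end GrSAlg

/-- A primitive idempotent: a non-zero idempotent which is not the sum of two non-zero
orthogonal idempotents. -/
def IsPrimitiveIdem {R : Type*} [Ring R] (e : R) : Prop :=
  IsIdempotentElem e ∧ e ≠ 0 ∧ ∀ u w : R, IsIdempotentElem u → IsIdempotentElem w →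
    u * w = 0 → w * u = 0 → u + w = e → u = 0 ∨ w = 0

/-! ## Graded supermodules -/

/-- An object of `mod A`: a finitely generated graded `A`-supermodule. -/
structure GrMod {𝕜 : Type u} [CommRing 𝕜] (A : GrSAlg.{u, v} 𝕜) where
  carrier : Type v
  [addCommGroup : AddCommGroup carrier]
  [moduleBase : Module 𝕜 carrier]
  [module : Module A carrier]
  [tower : IsScalarTower 𝕜 A carrier]
  gr : Bideg → Submodule 𝕜 carrier
  internal : DirectSum.IsInternal gr
  smul_mem : ∀ {c d : Bideg} {a : A} {v : carrier}, a ∈ A.gr c → v ∈ gr d → a • v ∈ gr (c + d)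
  finite : Module.Finite A carrier

namespace GrMod

variable {𝕜 : Type u} [CommRing 𝕜] {A : GrSAlg.{u, v} 𝕜}

instance : CoeSort (GrMod A) (Type v) := ⟨GrMod.carrier⟩

instance (V : GrMod A) : AddCommGroup V := V.addCommGroup

instance (V : GrMod A) : Module 𝕜 V := V.moduleBase

instance (V : GrMod A) : Module A V := V.module

instance (V : GrMod A) : IsScalarTower 𝕜 A V := V.tower

/-- Morphisms of `mod A`: homogeneous `A`-homomorphisms. -/
@[ext]
structure Hom (V W : GrMod A) where
  toLin : V →ₗ[A] W
  map_mem : ∀ (d : Bideg) (v : V), v ∈ V.gr d → toLin v ∈ W.gr d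

/-- The category `mod A`. -/
instance : Category (GrMod A) where
  Hom V W := Hom V W
  id V := ⟨LinearMap.id, fun _ _ h => h⟩
  comp f g := ⟨g.toLin ∘ₗ f.toLin, fun d v h => g.map_mem d _ (f.map_mem d v h)⟩

theorem homogComp_smul (V : GrMod A) {c : Bideg} {a : A} (ha : a ∈ A.gr c) (v : V)
    (d : Bideg) : homogComp V.internal (c + d) (a • v) = a • homogComp V.internal d v := by
  have hb : v ∈ ⨆ d, V.gr d := by simp [V.internal.submodule_iSup_eq_top]
  refine Submodule.iSup_induction V.gr
    (motive := fun v => homogComp V.internal (c + d) (a • v) = a • homogComp V.internal d v)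
    hb ?_ (by simp) ?_
  · intro d' x hx
    rw [homogComp_of_mem _ hx, homogComp_of_mem _ (V.smul_mem ha hx)]
    simp
  · intro x y hx hy
    rw [smul_add, map_add, map_add, smul_add, hx, hy]

/-- Homogeneous `A`-submodules. -/
def IsHomog (V : GrMod A) (W : Submodule A V) : Prop :=
  IsHomogSub V.gr (W.restrictScalars 𝕜)

/-- Simple graded supermodules: non-zero, without proper non-zero homogeneous submodules. -/
def IsGrSimple (V : GrMod A) : Prop :=
  Nontrivial V ∧ ∀ W : Submodule A V, V.IsHomog W → W = ⊥ ∨ W = ⊤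

/-- The regular module. -/
def regular (A : GrSAlg.{u, v} 𝕜) : GrMod A where
  carrier := A
  gr := A.gr
  internal := A.internal
  smul_mem := A.mul_mem
  finite := inferInstance

/-- The quotient by a homogeneous submodule. -/
def quot (V : GrMod A) (W : Submodule A V) (hW : V.IsHomog W) : GrMod A where
  carrier := V ⧸ W
  gr d := (V.gr d).map (W.mkQ.restrictScalars 𝕜)
  internal := isInternal_map V.internal _ W.mkQ_surjective (by
    have : LinearMap.ker (W.mkQ.restrictScalars 𝕜) = W.restrictScalars 𝕜 := by
      ext x; simp
    rw [this]; exact hW)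
  smul_mem := by
    rintro c d a _ ha ⟨v, hv, rfl⟩
    exact ⟨a • v, V.smul_mem ha hv, rfl⟩
  finite := by
    have := V.finite
    infer_instance

/-- The submodule `A v` generated by a homogeneous element `v`. -/
def cyclic (V : GrMod A) (v : V) {c : Bideg} (hv : v ∈ V.gr c) : GrMod A where
  carrier := Submodule.span A {v}
  gr d := (V.gr d).comap ((Submodule.span A {v}).subtype.restrictScalars 𝕜)
  internal := isInternal_comap V.internal _ Subtype.val_injective (by
    rintro _ ⟨⟨w, hw⟩, rfl⟩
    obtain ⟨a, rfl⟩ := Submodule.mem_span_singleton.1 hw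
    have ha : a ∈ ⨆ d, A.gr d := by simp [A.internal.submodule_iSup_eq_top]
    change a • v ∈ _
    refine Submodule.iSup_induction A.gr (motive := fun a => a • v ∈ _) ha ?_ (by simp) ?_
    · intro d x hx
      refine Submodule.mem_iSup_of_mem (d + c) ⟨?_, V.smul_mem hx hv⟩
      exact ⟨⟨x • v, Submodule.smul_mem _ _ (Submodule.mem_span_singleton_self v)⟩, rfl⟩
    · intro x y hx hy
      rw [add_smul]
      exact Submodule.add_mem _ hx hy)
  smul_mem ha hv := V.smul_mem ha hv
  finite := Module.Finite.span_singleton A v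

end GrMod

/-- The (graded) Jacobson ideal `J(A)`: the intersection of the annihilators of all simple graded
`A`-supermodules. -/
def GrSAlg.jacobson {𝕜 : Type u} [CommRing 𝕜] (A : GrSAlg.{u, v} 𝕜) : Set A :=
  {a | ∀ V : GrMod A, V.IsGrSimple → ∀ x : V, a • x = 0}

/-! ## The truncation functor `V ↦ fV` -/

namespace GrMod

variable {𝕜 : Type u} [CommRing 𝕜] {A : GrSAlg.{u, v} 𝕜}

/-- The `𝕜`-submodule `fV` of `V`. -/
def truncSub (f : A.HomIdem) (V : GrMod A) : Submodule 𝕜 V where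
  carrier := {v | ∃ w : V, v = f.val • w}
  zero_mem' := ⟨0, by simp⟩
  add_mem' := by
    rintro _ _ ⟨v, rfl⟩ ⟨w, rfl⟩
    exact ⟨v + w, by simp⟩
  smul_mem' := by
    rintro c _ ⟨v, rfl⟩
    exact ⟨c • v, by rw [← algebraMap_smul A c v, ← algebraMap_smul A c, smul_smul, smul_smul,
      Algebra.commutes]⟩

theorem truncSub_smul (f : A.HomIdem) (V : GrMod A) {v : V} (hv : v ∈ truncSub f V) :
    f.val • v = v := by
  obtain ⟨w, rfl⟩ := hv
  rw [smul_smul, f.idem.eq]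

instance (f : A.HomIdem) (V : GrMod A) : Module (A.corner f) (truncSub f V) where
  smul c v := ⟨A.cornerVal f c • v.1, A.cornerVal f c • v.1, by
    rw [smul_smul]
    exact congrArg (· • v.1) (GrSAlg.corner_left f.idem c).symm⟩
  one_smul v := Subtype.ext (truncSub_smul f V v.2)
  mul_smul a b v := Subtype.ext (mul_smul (A.cornerVal f a) (A.cornerVal f b) v.1)
  smul_zero a := Subtype.ext (smul_zero _)
  smul_add a v w := Subtype.ext (smul_add _ _ _)
  add_smul a b v := Subtype.ext (add_smul (A.cornerVal f a) (A.cornerVal f b) v.1)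
  zero_smul v := Subtype.ext (zero_smul A v.1)

instance (f : A.HomIdem) (V : GrMod A) : IsScalarTower 𝕜 (A.corner f) (truncSub f V) where
  smul_assoc c a v := Subtype.ext (smul_assoc c (A.cornerVal f a) v.1)

/-- The graded `fAf`-supermodule `fV`, with `(fV)_d = fV ∩ V_d`. It is finitely generated, as `A`
is assumed to be a finitely generated `𝕜`-module. -/
def truncObj (hA : Module.Finite 𝕜 A) (f : A.HomIdem) (V : GrMod A) : GrMod (A.corner f) where
  carrier := truncSub f V
  gr d := (V.gr d).comap (truncSub f V).subtype
  internal := isInternal_comap V.internal _ Subtype.val_injective (by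
    rw [Submodule.range_subtype, isHomogSub_iff V.internal]
    intro v hv d
    refine ⟨homogComp V.internal d v, ?_⟩
    rw [← V.homogComp_smul f.mem, zero_add, truncSub_smul f V hv])
  smul_mem ha hv := V.smul_mem ha hv
  finite := by
    have := V.finite
    have : Module.Finite 𝕜 V := Module.Finite.trans A V
    have : Module.Finite 𝕜 (truncSub f V) := by
      let φ : V →ₗ[𝕜] truncSub f V :=
        { toFun := fun v => ⟨f.val • v, v, rfl⟩
          map_add' := fun v w => Subtype.ext (smul_add _ _ _)
          map_smul' := fun c v => Subtype.ext (by
            change f.val • c • v = c • f.val • v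
            rw [← algebraMap_smul A c v, ← algebraMap_smul A c, smul_smul, smul_smul,
              Algebra.commutes]) }
      exact Module.Finite.of_surjective φ fun ⟨v, w, h⟩ => ⟨w, Subtype.ext h.symm⟩
    exact Module.Finite.of_restrictScalars_finite 𝕜 (A.corner f) (truncSub f V)

/-- The functor `mod A → mod fAf`, `V ↦ fV`. -/
def truncFunctor (hA : Module.Finite 𝕜 A) (f : A.HomIdem) : GrMod A ⥤ GrMod (A.corner f) where
  obj V := truncObj hA f V
  map {V W} g :=
    { toLin :=
        { toFun := fun v => ⟨g.toLin v.1, g.toLin v.1, by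
            rw [← map_smul, truncSub_smul f V v.2]⟩
          map_add' := fun v w => Subtype.ext (map_add g.toLin v.1 w.1)
          map_smul' := fun c v => Subtype.ext (map_smul g.toLin (A.cornerVal f c) v.1) }
      map_mem := fun d v h => g.map_mem d v.1 h }

end GrMod

/-! ## Heredity data -/

section Heredity

variable {𝕜 : Type u} [CommRing 𝕜]

/-- `A(Ω) = span {x y | i ∈ Ω, x ∈ X(i), y ∈ Y(i)}`. -/
def prodSpan (A : GrSAlg.{u, v} 𝕜) {I : Type*} (X Y : I → Set A) (Ω : Set I) : Submodule 𝕜 A :=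
  Submodule.span 𝕜 {a | ∃ i ∈ Ω, ∃ x ∈ X i, ∃ y ∈ Y i, a = x * y}

/-- Heredity data on `A` with respect to the (finite) poset `I`: finite sets `X(i)`, `Y(i)` of
non-zero homogeneous elements with initial elements `e i ∈ X(i) ∩ Y(i)` satisfying axioms
(a), (b), (c) of a based quasi-hereditary algebra. Here `A^{>i} = prodSpan A X Y (Set.Ioi i)`.
(Over a non-zero ring, the axioms imply that the `X(i)` are pairwise disjoint, and the
`Y(i)` too.) -/
structure HeredityData (A : GrSAlg.{u, v} 𝕜) (I : Type*) [PartialOrder I] where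
  X : I → Set A
  Y : I → Set A
  e : I → A
  X_finite : ∀ i, (X i).Finite
  Y_finite : ∀ i, (Y i).Finite
  X_homog : ∀ i, ∀ x ∈ X i, x ≠ 0 ∧ ∃ d, x ∈ A.gr d
  Y_homog : ∀ i, ∀ y ∈ Y i, y ≠ 0 ∧ ∃ d, y ∈ A.gr d
  e_mem_X : ∀ i, e i ∈ X i
  e_mem_Y : ∀ i, e i ∈ Y i
  -- (a) the products `x y`, for `(x, y) ∈ ⨆ X(i) × Y(i)`, form a basis of `A`
  linearIndependent :
    LinearIndependent 𝕜 fun z : (Σ i, X i × Y i) => ((z.2.1 : A) * (z.2.2 : A))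
  span_eq_top : prodSpan A X Y Set.univ = ⊤
  -- (b) `a x` is a linear combination of `X(i)` modulo `A^{>i}`, with coefficients depending only
  -- on `a` and `x`; similarly for `y a`
  mul_X : ∀ i, ∀ x ∈ X i, ∀ a : A, a * x ∈ Submodule.span 𝕜 (X i) ⊔ prodSpan A X Y (Set.Ioi i)
  Y_mul : ∀ i, ∀ y ∈ Y i, ∀ a : A, y * a ∈ Submodule.span 𝕜 (Y i) ⊔ prodSpan A X Y (Set.Ioi i)
  -- (c)
  X_mul_e : ∀ i, ∀ x ∈ X i, x * e i = x
  e_mul_X : ∀ i, ∀ x ∈ X i, x ≠ e i → e i * x = 0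
  e_mul_Y : ∀ i, ∀ y ∈ Y i, e i * y = y
  Y_mul_e : ∀ i, ∀ y ∈ Y i, y ≠ e i → y * e i = 0
  e_mul_X' : ∀ i, ∀ x ∈ X i, ∀ j, e j * x = x ∨ e j * x = 0
  Y_mul_e' : ∀ i, ∀ y ∈ Y i, ∀ j, y * e j = y ∨ y * e j = 0

namespace HeredityData

variable {A : GrSAlg.{u, v} 𝕜} {I : Type*} [PartialOrder I] (H : HeredityData A I)

/-- `A(Ω)`, a two-sided ideal if `Ω` is an upper set. -/
def ideal (Ω : Set I) : Submodule 𝕜 A := prodSpan A H.X H.Y Ω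

theorem e_idem (i : I) : H.e i * H.e i = H.e i := H.X_mul_e i _ (H.e_mem_X i)

theorem e_gr (i : I) : H.e i ∈ A.gr 0 := by
  obtain ⟨h0, d, hd⟩ := H.X_homog i _ (H.e_mem_X i)
  have h2 : H.e i ∈ A.gr (d + d) := by
    have := A.mul_mem hd hd
    rwa [H.e_idem] at this
  have h3 := homogComp_of_mem A.internal hd d
  rw [homogComp_of_mem A.internal h2 d] at h3
  by_cases h : d + d = d
  · rw [add_eq_left] at h
    rwa [h] at hd
  · simp [h] at h3
    exact absurd h3.symm h0

theorem finite (H : HeredityData A I) [Finite I] : Module.Finite 𝕜 A := by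
  refine ⟨?_⟩
  rw [← H.span_eq_top]
  refine Submodule.fg_span ?_
  have : {a | ∃ i ∈ (Set.univ : Set I), ∃ x ∈ H.X i, ∃ y ∈ H.Y i, a = x * y} =
      ⋃ i, Set.image2 (· * ·) (H.X i) (H.Y i) := by
    ext a
    simp only [Set.mem_univ, true_and, Set.mem_ofPred_eq, Set.mem_iUnion, Set.mem_image2, eq_comm]
  rw [this]
  exact Set.finite_iUnion fun i => (H.X_finite i).image2 _ (H.Y_finite i)

theorem ideal_mono {Ω Ω' : Set I} (h : Ω ⊆ Ω') : H.ideal Ω ≤ H.ideal Ω' :=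
  Submodule.span_mono fun _ ⟨i, hi, r⟩ => ⟨i, h hi, r⟩

theorem mul_gen (i : I)
    (hr : ∀ u ∈ H.ideal (Set.Ioi i), ∀ a : A, u * a ∈ H.ideal (Set.Ioi i)) {Ω : Set I}
    (hΩ : Set.Ici i ⊆ Ω) {x y : A} (hx : x ∈ H.X i) (hy : y ∈ H.Y i) (a : A) :
    a * (x * y) ∈ H.ideal Ω := by
  obtain ⟨s, hs, t, ht, hst⟩ := Submodule.mem_sup.1 (H.mul_X i x hx a)
  rw [← mul_assoc, ← hst, add_mul]
  refine Submodule.add_mem _ ?_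
    (H.ideal_mono (fun j hj => hΩ (le_of_lt (Set.mem_Ioi.1 hj))) (hr t ht y))
  refine Submodule.span_induction (p := fun s _ => s * y ∈ H.ideal Ω) ?_ (by simp) ?_ ?_ hs
  · intro x' hx'
    exact Submodule.subset_span ⟨i, hΩ Set.self_mem_Ici, x', hx', y, hy, rfl⟩
  · intro u w _ _ hu hw
    rw [add_mul]
    exact Submodule.add_mem _ hu hw
  · intro c u _ hu
    rw [smul_mul_assoc]
    exact Submodule.smul_mem _ _ hu

theorem gen_mul (i : I)
    (hl : ∀ u ∈ H.ideal (Set.Ioi i), ∀ a : A, a * u ∈ H.ideal (Set.Ioi i)) {Ω : Set I}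
    (hΩ : Set.Ici i ⊆ Ω) {x y : A} (hx : x ∈ H.X i) (hy : y ∈ H.Y i) (a : A) :
    x * y * a ∈ H.ideal Ω := by
  obtain ⟨s, hs, t, ht, hst⟩ := Submodule.mem_sup.1 (H.Y_mul i y hy a)
  rw [mul_assoc, ← hst, mul_add]
  refine Submodule.add_mem _ ?_
    (H.ideal_mono (fun j hj => hΩ (le_of_lt (Set.mem_Ioi.1 hj))) (hl t ht x))
  refine Submodule.span_induction (p := fun s _ => x * s ∈ H.ideal Ω) ?_ (by simp) ?_ ?_ hs
  · intro y' hy'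
    exact Submodule.subset_span ⟨i, hΩ Set.self_mem_Ici, x, hx, y', hy', rfl⟩
  · intro u w _ _ hu hw
    rw [mul_add]
    exact Submodule.add_mem _ hu hw
  · intro c u _ hu
    rw [mul_smul_comm]
    exact Submodule.smul_mem _ _ hu

theorem ideal_of_gen {Ω : Set I}
    (h : ∀ i ∈ Ω, ∀ x ∈ H.X i, ∀ y ∈ H.Y i, ∀ a : A,
      a * (x * y) ∈ H.ideal Ω ∧ x * y * a ∈ H.ideal Ω) :
    ∀ u ∈ H.ideal Ω, ∀ a : A, a * u ∈ H.ideal Ω ∧ u * a ∈ H.ideal Ω := by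
  intro u hu a
  refine Submodule.span_induction
    (p := fun u _ => a * u ∈ H.ideal Ω ∧ u * a ∈ H.ideal Ω) ?_ (by simp) ?_ ?_ hu
  · rintro _ ⟨i, hi, x, hx, y, hy, rfl⟩
    exact h i hi x hx y hy a
  · intro u w _ _ hu hw
    rw [mul_add, add_mul]
    exact ⟨Submodule.add_mem _ hu.1 hw.1, Submodule.add_mem _ hu.2 hw.2⟩
  · intro c u _ hu
    rw [smul_mul_assoc, mul_smul_comm]
    exact ⟨Submodule.smul_mem _ _ hu.1, Submodule.smul_mem _ _ hu.2⟩

/-- `A^{>i}` is a two-sided ideal. -/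
theorem ideal_Ioi [Finite I] (i : I) :
    ∀ u ∈ H.ideal (Set.Ioi i), ∀ a : A,
      a * u ∈ H.ideal (Set.Ioi i) ∧ u * a ∈ H.ideal (Set.Ioi i) := by
  induction i using WellFoundedGT.induction with
  | ind i ih =>
    refine H.ideal_of_gen fun j hj x hx y hy a => ?_
    have hj' : Set.Ici j ⊆ Set.Ioi i := fun k hk => lt_of_lt_of_le hj hk
    exact ⟨H.mul_gen j (fun u hu a => (ih j hj u hu a).2) hj' hx hy a,
      H.gen_mul j (fun u hu a => (ih j hj u hu a).1) hj' hx hy a⟩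

/-- `A^{>i}` as a left ideal. -/
def leftIdeal [Finite I] (i : I) : Submodule A (GrMod.regular A) where
  carrier := (H.ideal (Set.Ioi i) : Set A)
  zero_mem' := Submodule.zero_mem _
  add_mem' := Submodule.add_mem _
  smul_mem' a u hu := (H.ideal_Ioi i u hu a).1

theorem leftIdeal_homog [Finite I] (i : I) : (GrMod.regular A).IsHomog (H.leftIdeal i) := by
  intro u hu
  refine Submodule.span_induction
    (p := fun u _ => u ∈ ⨆ d, (H.leftIdeal i).restrictScalars 𝕜 ⊓ (GrMod.regular A).gr d)
    ?_ (Submodule.zero_mem _) (fun _ _ _ _ => Submodule.add_mem _)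
    (fun c _ _ => Submodule.smul_mem _ c) hu
  rintro _ ⟨j, hj, x, hx, y, hy, rfl⟩
  obtain ⟨_, d, hd⟩ := H.X_homog j x hx
  obtain ⟨_, d', hd'⟩ := H.Y_homog j y hy
  exact Submodule.mem_iSup_of_mem (d + d')
    ⟨Submodule.subset_span ⟨j, hj, x, hx, y, hy, rfl⟩, A.mul_mem hd hd'⟩

/-- The left module `Ã = A / A^{>i}`. -/
def quotAlg [Finite I] (i : I) : GrMod A :=
  (GrMod.regular A).quot (H.leftIdeal i) (H.leftIdeal_homog i)

/-- The class of `a ∈ A` in `Ã = A / A^{>i}`. -/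
def cls [Finite I] (i : I) (a : A) : H.quotAlg i := (H.leftIdeal i).mkQ a

theorem cls_e_mem [Finite I] (i : I) : H.cls i (H.e i) ∈ (H.quotAlg i).gr 0 :=
  ⟨H.e i, H.e_gr i, rfl⟩

/-- The standard module `Δ(i) = Ã ẽ_i`, where `Ã = A / A^{>i}`. -/
def standard [Finite I] (i : I) : GrMod A :=
  (H.quotAlg i).cyclic (H.cls i (H.e i)) (H.cls_e_mem i)

/-- The inclusion `Δ(i) → Ã`. -/
def standardIncl [Finite I] (i : I) : H.standard i →ₗ[A] H.quotAlg i :=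
  (Submodule.span A {H.cls i (H.e i)}).subtype

/-- The canonical pairing `Δ(i) × Δᵒᵖ(i) → 𝕜`, `Δᵒᵖ(i) = ẽ_i Ã`, given by `w v = (v, w)_i ẽ_i`
in `Ã = A / A^{>i}`. `H.Pairs i v b c` says that `(v, w)_i = c` for `w = ẽ_i b̃ ∈ Δᵒᵖ(i)`. On basis
elements this is `(v_x, w_y)_i = f_i(y, x)`, where `y x ≡ f_i(y, x) e_i` modulo `A^{>i}`. -/
def Pairs [Finite I] (i : I) (v : H.standard i) (b : A) (c : 𝕜) : Prop :=
  (H.e i * b) • H.standardIncl i v = c • H.cls i (H.e i)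

theorem pairs_comp [Finite I] (J : Ideal 𝕜) (i : I) (v : H.standard i) (d : Bideg)
    (hv : ∀ b : A, ∃ c ∈ J, H.Pairs i v b c) (b : A) :
    ∃ c ∈ J, H.Pairs i (homogComp (H.standard i).internal d v) b c := by
  have hb : b ∈ ⨆ d, A.gr d := by simp [A.internal.submodule_iSup_eq_top]
  refine Submodule.iSup_induction A.gr
    (motive := fun b => ∃ c ∈ J, H.Pairs i (homogComp (H.standard i).internal d v) b c)
    hb ?_ ⟨0, J.zero_mem, by simp [Pairs]⟩ ?_
  · intro k b hb
    obtain ⟨c, hc, hp⟩ := hv b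
    have heb : H.e i * b ∈ A.gr k := by simpa using A.mul_mem (H.e_gr i) hb
    have hcyc : (H.e i * b) • v = c • (⟨H.cls i (H.e i), Submodule.mem_span_singleton_self _⟩ :
        Submodule.span A {H.cls i (H.e i)}) := Subtype.ext hp
    have h1 := (H.standard i).homogComp_smul heb v d
    have hmem : (⟨H.cls i (H.e i), Submodule.mem_span_singleton_self _⟩ :
        Submodule.span A {H.cls i (H.e i)}) ∈ (H.standard i).gr 0 := H.cls_e_mem i
    have h2 : homogComp (H.standard i).internal (k + d) ((H.e i * b) • v) =
        if (0 : Bideg) = k + d then (H.e i * b) • v else 0 :=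
      homogComp_of_mem _ (by
        have := Submodule.smul_mem ((H.standard i).gr 0) c hmem
        exact hcyc ▸ this) _
    rw [h2] at h1
    have h3 : (H.e i * b) • H.standardIncl i (homogComp (H.standard i).internal d v) =
        H.standardIncl i (if (0 : Bideg) = k + d then (H.e i * b) • v else 0) := by
      rw [h1, map_smul]
    split_ifs at h3 with h
    · exact ⟨c, hc, by rw [Pairs, h3, map_smul]; exact hp⟩
    · exact ⟨0, J.zero_mem, by rw [Pairs, h3]; simp⟩
  · rintro x y ⟨c, hc, hp⟩ ⟨c', hc', hp'⟩
    exact ⟨c + c', J.add_mem hc hc', by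
      rw [Pairs] at *
      rw [mul_add, add_smul, add_smul, hp, hp']⟩

/-- The submodule `{v ∈ Δ(i) | (v, w)_i ∈ J for all w ∈ Δᵒᵖ(i)}`, for an ideal `J` of `𝕜`.
For `J = 0` this is `rad Δ(i)`. -/
def radMod [Finite I] (J : Ideal 𝕜) (i : I) : Submodule A (H.standard i) where
  carrier := {v | ∀ b : A, ∃ c ∈ J, H.Pairs i v b c}
  zero_mem' b := ⟨0, J.zero_mem, by simp [Pairs]⟩
  add_mem' {v w} hv hw b := by
    obtain ⟨c, hc, hp⟩ := hv b
    obtain ⟨c', hc', hp'⟩ := hw b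
    exact ⟨c + c', J.add_mem hc hc', by
      rw [Pairs] at *
      rw [map_add, smul_add, add_smul, hp, hp']⟩
  smul_mem' a v hv b := by
    obtain ⟨c, hc, hp⟩ := hv (b * a)
    exact ⟨c, hc, by
      rw [Pairs] at *
      rw [map_smul, smul_smul, mul_assoc, hp]⟩

theorem radMod_homog [Finite I] (J : Ideal 𝕜) (i : I) :
    (H.standard i).IsHomog (H.radMod J i) := by
  rw [GrMod.IsHomog, isHomogSub_iff (H.standard i).internal]
  exact fun v hv d b => H.pairs_comp J i v d hv b

/-- For local `𝕜` with maximal ideal `𝔪` and residue field `F`: the simple graded `A`-supermodule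
`L_A(i)`, the inflation to `A` of the canonical simple `A/𝔪A`-module
`L_{A/𝔪A}(i) = Δ_{A/𝔪A}(i) / rad Δ_{A/𝔪A}(i)`. Since `Δ_{A/𝔪A}(i) = Δ(i)/𝔪Δ(i)` carries the
reduction modulo `𝔪` of the pairing `(·,·)_i`, this is `Δ(i)` modulo all `v` with
`(v, w)_i ∈ 𝔪` for all `w`. If `𝕜` is a field, it is `Δ(i) / rad Δ(i)`. -/
def simple [Finite I] [IsLocalRing 𝕜] (i : I) : GrMod A :=
  (H.standard i).quot (H.radMod (IsLocalRing.maximalIdeal 𝕜) i) (H.radMod_homog _ i)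

/-- `A` is basic: each `L_{A/𝔪A}(i)` is one-dimensional over the residue field. -/
def IsBasic [Finite I] [IsLocalRing 𝕜] : Prop :=
  ∀ i, Nonempty (H.simple i ≃ₗ[𝕜] IsLocalRing.ResidueField 𝕜)

/-- For a graded superalgebra `B` regarded as a subalgebra of `A` through `ι`: `B` is a homogeneous
subalgebra of `A_0̄`, and the data `(I, X, Y)` of `A` is `B`-conforming, that is,
`(I, X_0̄, Y_0̄)` (with the same initial elements) is heredity data of `B`, namely `h`. -/
structure IsConforming {B : GrSAlg.{u, v} 𝕜} (ι : B →ₐ[𝕜] A) (H : HeredityData A I)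
    (h : HeredityData B I) : Prop where
  injective : Function.Injective ι
  gr_iff : ∀ d b, b ∈ B.gr d ↔ ι b ∈ A.gr d
  even : ∀ b, ι b ∈ A.parity 0
  X_eq : ∀ i, ι '' h.X i = H.X i ∩ A.parity 0
  Y_eq : ∀ i, ι '' h.Y i = H.Y i ∩ A.parity 0
  e_eq : ∀ i, ι (h.e i) = H.e i

/-- `X̄(i) = {x ∈ X(i) | f x = x}`. -/
def XBar (f : A.HomIdem) (i : I) : Set A := {x ∈ H.X i | f.val * x = x}

/-- `Ȳ(i) = {y ∈ Y(i) | y f = y}`. -/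
def YBar (f : A.HomIdem) (i : I) : Set A := {y ∈ H.Y i | y * f.val = y}

/-- `Ī = {i | X̄(i) ≠ ∅ ≠ Ȳ(i)}`. -/
def IBar (f : A.HomIdem) : Set I := {i | (H.XBar f i).Nonempty ∧ (H.YBar f i).Nonempty}

/-- The homogeneous idempotent `f` is adapted: there are subsets `X̄(i) ⊆ X(i)`, `Ȳ(i) ⊆ Y(i)`
with `f x = x` or `0` according to whether `x ∈ X̄(i)` or not, and similarly for `y f`. -/
def IsAdapted (f : A.HomIdem) : Prop :=
  ∀ i, (∀ x ∈ H.X i, f.val * x = x ∨ f.val * x = 0) ∧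
    (∀ y ∈ H.Y i, y * f.val = y ∨ y * f.val = 0)

/-- `f` is strongly adapted: adapted, and `f e_i = e_i f = e_i` for all `i ∈ Ī`. -/
def IsStronglyAdapted (f : A.HomIdem) : Prop :=
  H.IsAdapted f ∧ ∀ i ∈ H.IBar f, f.val * H.e i = H.e i ∧ H.e i * f.val = H.e i

/-- The sets `X̄(i)`, `Ȳ(i)` and the elements `e_i` (for all `i ∈ I`) form heredity data of `fAf`,
namely `K`. -/
structure IsTruncation (f : A.HomIdem) (K : HeredityData (A.corner f) I) : Prop where
  X_eq : ∀ i, A.cornerVal f '' K.X i = H.XBar f i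
  Y_eq : ∀ i, A.cornerVal f '' K.Y i = H.YBar f i
  e_eq : ∀ i, A.cornerVal f (K.e i) = H.e i

end HeredityData

end Heredity

/-!
The initial elements `e_i` of heredity data need not be primitive, because `e_i` may act
non-trivially on simple modules `L(j)` with `j > i`. The idea is to split off from `e_i` all
summands coming from such `j` and to truncate by the sum of what remains.

*Primitive summands.* Say that `u ∈ 𝔞` kills the head `L(j)` if for all `a`, `b` the coefficient
of `e_j` in `e_j b u a e_j` modulo `𝔞^{>j}` lies in the maximal ideal `𝔪` of `𝕜`
(`HeredityData.KillsHead`). If an idempotent `e ≤ e_i` kills all `L(j)`, `j > i`, then every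
element of `e 𝔞^{>i} e` is nilpotent modulo `𝔪`: squaring moves it one layer up in the filtration
by the ideals `𝔞(Ω)` (`HeredityData.exists_pow_mem_of_killsHead`). By Nakayama's lemma, an element
of `e 𝔞 e` congruent to a unit multiple of `e` modulo `𝔞^{>i}` is then invertible in `e 𝔞 e`
(`HeredityData.exists_corner_inv`); in particular `e` is primitive. If `e` does not kill `L(j)`,
and `e_j'` has already been found, then some `e_j' b e a e_j'` is invertible in `e_j' 𝔞 e_j'`, with
inverse `w`, and `e a w b e` is a summand of `e` that can be split off
(`HeredityData.exists_summand_of_not_killsHead`). No completeness of `𝕜` is needed, since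
idempotents are never lifted. As `𝔞 / 𝔪𝔞` is Artinian, a minimal idempotent congruent to `e_i`
exists (`HeredityData.exists_killsHead`), and this is `e_i'`.

*New heredity data.* The elements `g x e_i'`, where `x ∈ X(i)` and `g` is one of the `e_j'` or
`1 - ∑ e_j'`, span the same module as `X(i)` modulo `A^{>i}`. Over a local ring a generating set
of a free module contains a basis (`exists_subset_span_sup`), which gives `X'(i)`; for conforming
data the even elements are chosen inside `𝔞`. The products `x' y'` then span `A`, and there are at
most `rank A` of them, so they form a basis (`HeredityData.IsRefinement.exists_heredityData`,
`HeredityData.IsConforming.exists_refinement`).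

*Truncation.* Every `x ∈ X̄(i)` other than `e_i'` satisfies `x = e_j' x` for some `j ≠ i`. As
`e_j'` kills `L(i)`, such an `x` lies in the radical of the pairing modulo `𝔪`, so `𝔞̄` is basic.
If `A_1̄ ⊆ J(A)`, the condition to kill `L(i)` passes from `𝔞` to `A`: an odd factor annihilates the
simple graded module `L(i)`, and modulo `A^{>i}` the even elements `a e_i` and `e_i b` come from
`𝔞` (`HeredityData.IsConforming.killsHead`). Finally `x' y' = x' f y'` shows that `A f A = A`, so
that `V ↦ fV` is an equivalence with quasi-inverse `N ↦ Af ⊗ N`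
(`FullDecomposition.isEquivalence_truncFunctor`); the images of `Δ(i)` and `L(i)` are identified
by comparing annihilators of generators of degree zero (`GrMod.nonempty_iso_of_cyclic`).
-/

/-! ### Ideals, coordinates and initial elements of heredity data -/

namespace HeredityData

variable {𝕜 : Type u} [CommRing 𝕜] {A : GrSAlg.{u, v} 𝕜} {I : Type*} [PartialOrder I]
  (H : HeredityData A I)

theorem ideal_mul_left [Finite I] {Ω : Set I} (hΩ : IsUpperSet Ω) {u : A} (hu : u ∈ H.ideal Ω)
    (a : A) : a * u ∈ H.ideal Ω :=
  (H.ideal_of_gen (fun i hi _ hx _ hy a =>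
    ⟨H.mul_gen i (fun u hu a => (H.ideal_Ioi i u hu a).2) (hΩ.Ici_subset hi) hx hy a,
      H.gen_mul i (fun u hu a => (H.ideal_Ioi i u hu a).1) (hΩ.Ici_subset hi) hx hy a⟩) u hu a).1

theorem ideal_mul_right [Finite I] {Ω : Set I} (hΩ : IsUpperSet Ω) {u : A} (hu : u ∈ H.ideal Ω)
    (a : A) : u * a ∈ H.ideal Ω :=
  (H.ideal_of_gen (fun i hi _ hx _ hy a =>
    ⟨H.mul_gen i (fun u hu a => (H.ideal_Ioi i u hu a).2) (hΩ.Ici_subset hi) hx hy a,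
      H.gen_mul i (fun u hu a => (H.ideal_Ioi i u hu a).1) (hΩ.Ici_subset hi) hx hy a⟩) u hu a).2

theorem ideal_union (Ω Ω' : Set I) : H.ideal (Ω ∪ Ω') = H.ideal Ω ⊔ H.ideal Ω' := by
  rw [ideal, ideal, ideal, prodSpan, prodSpan, prodSpan, ← Submodule.span_union]
  congr 1
  ext a
  constructor
  · rintro ⟨i, hi | hi, r⟩
    exacts [Or.inl ⟨i, hi, r⟩, Or.inr ⟨i, hi, r⟩]
  · rintro (⟨i, hi, r⟩ | ⟨i, hi, r⟩)
    exacts [⟨i, Or.inl hi, r⟩, ⟨i, Or.inr hi, r⟩]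

theorem mul_mem_ideal {Ω : Set I} {i : I} (hi : i ∈ Ω) {x y : A} (hx : x ∈ H.X i)
    (hy : y ∈ H.Y i) : x * y ∈ H.ideal Ω :=
  Submodule.subset_span ⟨i, hi, x, hx, y, hy, rfl⟩

theorem e_mem_ideal {Ω : Set I} {i : I} (hi : i ∈ Ω) : H.e i ∈ H.ideal Ω := by
  rw [← H.e_idem i]
  exact H.mul_mem_ideal hi (H.e_mem_X i) (H.e_mem_Y i)

/-- The coordinate of the basis element `x₀ y₀` vanishes on all other basis elements. -/
theorem exists_coord {i : I} {x₀ y₀ : A} (hx₀ : x₀ ∈ H.X i) (hy₀ : y₀ ∈ H.Y i) :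
    ∃ l : A →ₗ[𝕜] 𝕜, l (x₀ * y₀) = 1 ∧
      (∀ x ∈ H.X i, ∀ y ∈ H.Y i, (x ≠ x₀ ∨ y ≠ y₀) → l (x * y) = 0) ∧
      ∀ Ω : Set I, i ∉ Ω → ∀ u ∈ H.ideal Ω, l u = 0 := by
  have hs : ⊤ ≤ Submodule.span 𝕜
      (Set.range fun z : (Σ i, H.X i × H.Y i) => ((z.2.1 : A) * (z.2.2 : A))) := by
    rw [← H.span_eq_top]
    refine Submodule.span_mono ?_
    rintro _ ⟨i, _, x, hx, y, hy, rfl⟩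
    exact ⟨⟨i, ⟨x, hx⟩, ⟨y, hy⟩⟩, rfl⟩
  let b := Module.Basis.mk H.linearIndependent hs
  let z₀ : (Σ i, H.X i × H.Y i) := ⟨i, ⟨x₀, hx₀⟩, ⟨y₀, hy₀⟩⟩
  have key : ∀ z, b.coord z₀ ((z.2.1 : A) * (z.2.2 : A)) = Finsupp.single z 1 z₀ := by
    intro z
    have : b z = (z.2.1 : A) * (z.2.2 : A) := Module.Basis.mk_apply _ _ _
    rw [← this, Module.Basis.coord_apply, Module.Basis.repr_self]
  refine ⟨b.coord z₀, ?_, ?_, ?_⟩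
  · exact (key z₀).trans (by simp)
  · intro x hx y hy hne
    refine (key ⟨i, ⟨x, hx⟩, ⟨y, hy⟩⟩).trans (Finsupp.single_eq_of_ne ?_)
    intro h
    simp only [z₀, Sigma.mk.injEq, heq_eq_eq, true_and, Prod.mk.injEq, Subtype.mk.injEq] at h
    rcases hne with h' | h'
    exacts [h' h.1.symm, h' h.2.symm]
  · intro Ω hi u hu
    refine Submodule.span_induction (p := fun u _ => b.coord z₀ u = 0) ?_ (map_zero _) ?_ ?_ hu
    · rintro _ ⟨j, hj, x, hx, y, hy, rfl⟩
      refine (key ⟨j, ⟨x, hx⟩, ⟨y, hy⟩⟩).trans (Finsupp.single_eq_of_ne ?_)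
      intro h
      have : i = j := congrArg Sigma.fst h
      exact hi (this ▸ hj)
    · intro u w _ _ hu hw
      rw [map_add, hu, hw, add_zero]
    · intro c u _ hu
      rw [map_smul, hu, smul_zero]

theorem exists_coord_e (i : I) : ∃ l : A →ₗ[𝕜] 𝕜, l (H.e i) = 1 ∧
    ∀ Ω : Set I, i ∉ Ω → ∀ u ∈ H.ideal Ω, l u = 0 := by
  obtain ⟨l, h1, -, h3⟩ := H.exists_coord (H.e_mem_X i) (H.e_mem_Y i)
  exact ⟨l, by rwa [H.e_idem] at h1, h3⟩

theorem eq_zero_of_smul_e_mem {i : I} {c : 𝕜} {Ω : Set I} (hi : i ∉ Ω)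
    (h : c • H.e i ∈ H.ideal Ω) : c = 0 := by
  obtain ⟨l, h1, h2⟩ := H.exists_coord_e i
  simpa [h1] using h2 Ω hi _ h

theorem e_notMem [Nontrivial 𝕜] {i : I} {Ω : Set I} (hi : i ∉ Ω) : H.e i ∉ H.ideal Ω := fun h =>
  one_ne_zero (H.eq_zero_of_smul_e_mem (c := 1) hi (by rwa [one_smul]))

theorem mem_of_smul_e_mem_sup {i : I} {c : 𝕜} {Ω : Set I} (hi : i ∉ Ω) (J : Ideal 𝕜)
    (h : c • H.e i ∈ H.ideal Ω ⊔ J • (⊤ : Submodule 𝕜 A)) : c ∈ J := by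
  obtain ⟨l, h1, h2⟩ := H.exists_coord_e i
  obtain ⟨s, hs, t, ht, hst⟩ := Submodule.mem_sup.1 h
  have h3 : l t ∈ J := by
    refine Submodule.smul_induction_on (p := fun t => l t ∈ J) ht ?_ ?_
    · intro r hr n _
      rw [map_smul]
      exact J.mul_mem_right _ hr
    · intro x y hx hy
      rw [map_add]
      exact J.add_mem hx hy
  have := congrArg l hst
  rw [map_add, h2 Ω hi s hs, zero_add, map_smul, h1, smul_eq_mul, mul_one] at this
  rwa [← this]

theorem e_mul_e_of_ne [Nontrivial 𝕜] {i j : I} (hij : i ≠ j) : H.e i * H.e j = 0 := by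
  rcases H.e_mul_X' j _ (H.e_mem_X j) i with h | h
  · rcases H.Y_mul_e' i _ (H.e_mem_Y i) j with h' | h'
    · have : H.e i ∈ H.ideal {j} := by
        rw [← h', h]
        exact H.e_mem_ideal rfl
      exact absurd this (H.e_notMem (by simpa using hij))
    · exact h'
  · exact h

/-- Modulo `A^{>i}`, the corner `e_i A e_i` is spanned by `e_i`. -/
theorem exists_coeff [Finite I] (i : I) (z : A) :
    ∃ c : 𝕜, H.e i * z * H.e i - c • H.e i ∈ H.ideal (Set.Ioi i) := by
  obtain ⟨s, hs, t, ht, hst⟩ := Submodule.mem_sup.1 (H.mul_X i _ (H.e_mem_X i) z)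
  rw [mul_assoc, ← hst]
  have h1 : ∃ c : 𝕜, H.e i * s = c • H.e i := by
    refine Submodule.span_induction (p := fun s _ => ∃ c : 𝕜, H.e i * s = c • H.e i)
      ?_ ⟨0, by simp⟩ ?_ ?_ hs
    · intro x hx
      by_cases hxe : x = H.e i
      · exact ⟨1, by rw [hxe, H.e_idem, one_smul]⟩
      · exact ⟨0, by rw [H.e_mul_X i x hx hxe, zero_smul]⟩
    · rintro x y _ _ ⟨c, hc⟩ ⟨c', hc'⟩
      exact ⟨c + c', by rw [mul_add, hc, hc', add_smul]⟩
    · rintro r x _ ⟨c, hc⟩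
      exact ⟨r * c, by rw [mul_smul_comm, hc, smul_smul]⟩
  obtain ⟨c, hc⟩ := h1
  refine ⟨c, ?_⟩
  rw [mul_add, hc, add_sub_cancel_left]
  exact (H.ideal_Ioi i t ht _).1

theorem homogComp_mem_ideal_Ioi [Finite I] (i : I) {u : A} (hu : u ∈ H.ideal (Set.Ioi i))
    (d : Bideg) : homogComp A.internal d u ∈ H.ideal (Set.Ioi i) :=
  (isHomogSub_iff A.internal _).1 (H.leftIdeal_homog i) u hu d

/-- `u` annihilates the simple module `L(j)`: for all `a`, `b`, the coefficient of `e_j` in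
`e_j b u a e_j` modulo `A^{>j}` lies in the maximal ideal. -/
def KillsHead [IsLocalRing 𝕜] (u : A) (j : I) : Prop :=
  ∀ a b : A, ∃ c ∈ IsLocalRing.maximalIdeal 𝕜,
    H.e j * (b * u * a) * H.e j - c • H.e j ∈ H.ideal (Set.Ioi j)

theorem killsHead_of_homog [IsLocalRing 𝕜] {u : A} {j : I}
    (h : ∀ d d' : Bideg, ∀ a ∈ A.gr d, ∀ b ∈ A.gr d', ∃ c ∈ IsLocalRing.maximalIdeal 𝕜,
      H.e j * (b * u * a) * H.e j - c • H.e j ∈ H.ideal (Set.Ioi j)) : H.KillsHead u j := by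
  intro a b
  have ha : a ∈ ⨆ d, A.gr d := by simp [A.internal.submodule_iSup_eq_top]
  have hb : b ∈ ⨆ d, A.gr d := by simp [A.internal.submodule_iSup_eq_top]
  refine Submodule.iSup_induction A.gr (motive := fun a => ∃ c ∈ IsLocalRing.maximalIdeal 𝕜,
      H.e j * (b * u * a) * H.e j - c • H.e j ∈ H.ideal (Set.Ioi j)) ha ?_
      ⟨0, Ideal.zero_mem _, by simp⟩ ?_
  · intro d a ha
    refine Submodule.iSup_induction A.gr (motive := fun b => ∃ c ∈ IsLocalRing.maximalIdeal 𝕜,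
      H.e j * (b * u * a) * H.e j - c • H.e j ∈ H.ideal (Set.Ioi j)) hb ?_
      ⟨0, Ideal.zero_mem _, by simp⟩ ?_
    · exact fun d' b hb => h d d' a ha b hb
    · rintro x y ⟨c, hc, h⟩ ⟨c', hc', h'⟩
      refine ⟨c + c', Ideal.add_mem _ hc hc', ?_⟩
      convert Submodule.add_mem _ h h' using 1
      simp only [add_mul, mul_add, add_smul]
      abel
  · rintro x y ⟨c, hc, h⟩ ⟨c', hc', h'⟩
    refine ⟨c + c', Ideal.add_mem _ hc hc', ?_⟩
    convert Submodule.add_mem _ h h' using 1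
    simp only [add_mul, mul_add, add_smul]
    abel

theorem killsHead_of_mem_ideal [IsLocalRing 𝕜] [Finite I] {Ω : Set I} (hΩ : IsUpperSet Ω) {u : A}
    (hu : u ∈ H.ideal Ω) {j : I} (hj : j ∉ Ω) : H.KillsHead u j := by
  intro a b
  obtain ⟨c, hc⟩ := H.exists_coeff j (b * u * a)
  obtain ⟨l, h1, h2⟩ := H.exists_coord_e j
  have h3 := h2 _ (by simp) _ hc
  have h4 : H.e j * (b * u * a) * H.e j ∈ H.ideal Ω :=
    H.ideal_mul_right hΩ (H.ideal_mul_left hΩ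
      (H.ideal_mul_right hΩ (H.ideal_mul_left hΩ hu _) _) _) _
  rw [map_sub, h2 Ω hj _ h4, map_smul, h1, smul_eq_mul, mul_one, zero_sub, neg_eq_zero] at h3
  exact ⟨c, h3 ▸ Ideal.zero_mem _, hc⟩

end HeredityData

/-! ### Units modulo the maximal ideal -/

section Units

variable {𝕜 : Type u} [CommRing 𝕜] {R : Type v} [Ring R] [Algebra 𝕜 R]

theorem mul_mem_smul_top (J : Ideal 𝕜) {p : R} (hp : p ∈ J • (⊤ : Submodule 𝕜 R)) (a : R) :
    a * p ∈ J • (⊤ : Submodule 𝕜 R) ∧ p * a ∈ J • (⊤ : Submodule 𝕜 R) := by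
  refine Submodule.smul_induction_on
    (p := fun p => a * p ∈ J • (⊤ : Submodule 𝕜 R) ∧ p * a ∈ J • (⊤ : Submodule 𝕜 R)) hp ?_ ?_
  · intro r hr n _
    rw [mul_smul_comm, smul_mul_assoc]
    exact ⟨Submodule.smul_mem_smul hr trivial, Submodule.smul_mem_smul hr trivial⟩
  · intro x y hx hy
    rw [mul_add, add_mul]
    exact ⟨Submodule.add_mem _ hx.1 hy.1, Submodule.add_mem _ hx.2 hy.2⟩

variable [IsLocalRing 𝕜] [Module.Finite 𝕜 R]

theorem surjective_of_sub_mem_smul_top (φ : R →ₗ[𝕜] R)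
    (h : ∀ a, a - φ a ∈ IsLocalRing.maximalIdeal 𝕜 • (⊤ : Submodule 𝕜 R)) :
    Function.Surjective φ := by
  rw [← LinearMap.range_eq_top, eq_top_iff]
  refine Submodule.le_of_le_smul_of_le_jacobson_bot Module.Finite.fg_top
    (IsLocalRing.maximalIdeal_le_jacobson ⊥) fun a _ => ?_
  rw [← add_sub_cancel (φ a) a]
  exact Submodule.add_mem_sup ⟨a, rfl⟩ (h a)

theorem isUnit_one_sub_of_mem_smul_top {p : R}
    (hp : p ∈ IsLocalRing.maximalIdeal 𝕜 • (⊤ : Submodule 𝕜 R)) : IsUnit (1 - p) := by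
  obtain ⟨b, hb⟩ := surjective_of_sub_mem_smul_top (𝕜 := 𝕜) (LinearMap.mulLeft 𝕜 (1 - p))
    (fun a => by simpa [sub_mul] using (mul_mem_smul_top _ hp a).2) 1
  obtain ⟨b', hb'⟩ := surjective_of_sub_mem_smul_top (𝕜 := 𝕜) (LinearMap.mulRight 𝕜 (1 - p))
    (fun a => by simpa [mul_sub] using (mul_mem_smul_top _ hp a).1) 1
  rw [LinearMap.mulLeft_apply] at hb
  rw [LinearMap.mulRight_apply] at hb'
  exact isUnit_iff_exists.2 ⟨b, hb, left_inv_eq_right_inv hb' hb ▸ hb'⟩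

/-- In a module-finite algebra over a local ring, a unit scalar plus an element that is nilpotent
modulo the maximal ideal is a unit. -/
theorem isUnit_smul_one_add {c : 𝕜} (hc : IsUnit c) {n : R} {m : ℕ}
    (hn : n ^ m ∈ IsLocalRing.maximalIdeal 𝕜 • (⊤ : Submodule 𝕜 R)) :
    IsUnit (c • (1 : R) + n) := by
  obtain ⟨c, rfl⟩ := hc
  have h1 : IsUnit (1 - (-((↑c⁻¹ : 𝕜) • n))) := by
    have h2 : IsUnit (1 - (-((↑c⁻¹ : 𝕜) • n)) ^ m) := by
      refine isUnit_one_sub_of_mem_smul_top (𝕜 := 𝕜) ?_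
      rw [neg_pow, smul_pow]
      exact (mul_mem_smul_top _ (Submodule.smul_mem _ _ hn) _).1
    rw [← mul_neg_geom_sum] at h2
    refine ((Commute.isUnit_mul_iff ?_).1 h2).1
    rw [commute_iff_eq, mul_neg_geom_sum, geom_sum_mul_neg]
  have h3 : (c : 𝕜) • (1 : R) + n = algebraMap 𝕜 R c * (1 - (-((↑c⁻¹ : 𝕜) • n))) := by
    rw [sub_neg_eq_add, ← Algebra.smul_def, smul_add, smul_smul, Units.mul_inv, one_smul]
  rw [h3]
  exact (c.isUnit.map _).mul h1

theorem isArtinian_quotient_maximalIdeal :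
    IsArtinian 𝕜 (R ⧸ (IsLocalRing.maximalIdeal 𝕜 • (⊤ : Submodule 𝕜 R))) := by
  have : IsArtinianRing (𝕜 ⧸ IsLocalRing.maximalIdeal 𝕜) :=
    inferInstanceAs (IsArtinianRing (IsLocalRing.ResidueField 𝕜))
  have : Module.Finite (𝕜 ⧸ IsLocalRing.maximalIdeal 𝕜)
      (R ⧸ (IsLocalRing.maximalIdeal 𝕜 • (⊤ : Submodule 𝕜 R))) :=
    Module.Finite.of_restrictScalars_finite 𝕜 _ _
  exact isArtinian_of_surjective_algebraMap (R := 𝕜 ⧸ IsLocalRing.maximalIdeal 𝕜)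
    Ideal.Quotient.mk_surjective

end Units

/-! ### Primitive idempotents refining the initial elements -/

namespace HeredityData

variable {𝕜 : Type u} [CommRing 𝕜] [IsLocalRing 𝕜] {A : GrSAlg.{u, v} 𝕜} {I : Type*}
  [PartialOrder I] (H : HeredityData A I)

/-- If `e` kills all heads `L(j)` with `j ∈ Ω`, then squaring an element of `e A(Ω) e` moves it one
layer up, modulo the maximal ideal. -/
theorem exists_pow_mem_of_killsHead [Finite I] {e : A} {Ω : Set I} (hΩ : IsUpperSet Ω)
    (hk : ∀ j ∈ Ω, H.KillsHead e j) {n : A} (hen : e * n = n)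
    (hn : n ∈ H.ideal Ω ⊔ IsLocalRing.maximalIdeal 𝕜 • (⊤ : Submodule 𝕜 A)) :
    ∃ m : ℕ, n ^ m ∈ IsLocalRing.maximalIdeal 𝕜 • (⊤ : Submodule 𝕜 A) := by
  induction hN : Ω.ncard using Nat.strong_induction_on generalizing Ω n with
  | _ N ih =>
  rcases Ω.eq_empty_or_nonempty with rfl | hne
  · have h0 : H.ideal ∅ = ⊥ := by simp [ideal, prodSpan]
    rw [h0, bot_sup_eq] at hn
    exact ⟨1, by rwa [pow_one]⟩
  obtain ⟨j, hj⟩ := Set.Finite.exists_minimal (Set.toFinite Ω) hne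
  set Ω' : Set I := Ω \ {j} with hΩ'
  have hup : IsUpperSet Ω' := by
    rintro a b hab ⟨ha, haj⟩
    refine ⟨hΩ hab ha, ?_⟩
    rintro rfl
    exact haj (le_antisymm hab (hj.2 ha hab))
  have hun : Ω = {j} ∪ Ω' := by simp [hΩ', Set.insert_eq_of_mem hj.1]
  have hIoi : Set.Ioi j ⊆ Ω' := fun k hk => ⟨hΩ (le_of_lt hk) hj.1, ne_of_gt hk⟩
  set P := H.ideal Ω' ⊔ IsLocalRing.maximalIdeal 𝕜 • (⊤ : Submodule 𝕜 A) with hP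
  have hPl : ∀ u ∈ P, ∀ a : A, a * u ∈ P := by
    intro u hu a
    obtain ⟨s, hs, t, ht, rfl⟩ := Submodule.mem_sup.1 hu
    rw [mul_add]
    exact Submodule.add_mem_sup (H.ideal_mul_left hup hs a) (mul_mem_smul_top _ ht a).1
  have hPr : ∀ u ∈ P, ∀ a : A, u * a ∈ P := by
    intro u hu a
    obtain ⟨s, hs, t, ht, rfl⟩ := Submodule.mem_sup.1 hu
    rw [add_mul]
    exact Submodule.add_mem_sup (H.ideal_mul_right hup hs a) (mul_mem_smul_top _ ht a).2
  -- `(x y) e (x' y') = x (y e x') y'`, and `y e x'` is a multiple of `e_j` by an element of `𝔪`,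
  -- up to higher layers
  have hgen : ∀ s ∈ H.ideal {j}, ∀ s' ∈ H.ideal {j}, s * e * s' ∈ P := by
    intro s hs s' hs'
    refine Submodule.span_induction₂ (p := fun s s' _ _ => s * e * s' ∈ P) ?_ (by simp) (by simp)
      (fun x y z _ _ _ hx hy => by rw [add_mul, add_mul]; exact Submodule.add_mem _ hx hy)
      (fun x y z _ _ _ hx hy => by rw [mul_add]; exact Submodule.add_mem _ hx hy)
      (fun r x y _ _ hx => by
        rw [smul_mul_assoc, smul_mul_assoc]; exact Submodule.smul_mem _ _ hx)
      (fun r x y _ _ hx => by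
        rw [mul_smul_comm]; exact Submodule.smul_mem _ _ hx) hs hs'
    rintro _ _ ⟨k, rfl, x, hx, y, hy, rfl⟩ ⟨k', hk', x', hx', y', hy', rfl⟩
    obtain rfl : k' = k := hk'
    obtain ⟨c, hc, h⟩ := hk k' hj.1 x' y
    have h1 : x * y * e * (x' * y') = x * (H.e k' * (y * e * x') * H.e k' - c • H.e k') * y'
        + c • (x * H.e k' * y') := by
      rw [mul_sub, sub_mul]
      have : x * (H.e k' * (y * e * x') * H.e k') * y' = x * y * e * (x' * y') := by
        calc _ = x * ((H.e k' * y) * e * (x' * H.e k')) * y' := by simp only [mul_assoc]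
          _ = _ := by rw [H.e_mul_Y k' y hy, H.X_mul_e k' x' hx']; simp only [mul_assoc]
      rw [this]
      simp
    rw [h1]
    refine Submodule.add_mem _ (hPr _ (hPl _ (Submodule.mem_sup_left ?_) _) _)
      (Submodule.mem_sup_right (Submodule.smul_mem_smul hc trivial))
    exact H.ideal_mono hIoi h
  have hsq : n * n ∈ P := by
    rw [hun, ideal_union, sup_assoc] at hn
    obtain ⟨s, hs, t, ht, hst⟩ := Submodule.mem_sup.1 hn
    have h1 : n * n = s * e * s + s * e * t + t * (e * n) := by
      calc n * n = n * (e * n) := by rw [hen]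
        _ = _ := by
          conv_lhs => rw [← hst]
          rw [← hst]
          simp only [add_mul, mul_add, mul_assoc]
          abel
    rw [h1]
    exact Submodule.add_mem _ (Submodule.add_mem _ (hgen s hs s hs) (hPl _ ht _)) (hPr _ ht _)
  obtain ⟨m, hm⟩ := ih Ω'.ncard (by
    rw [← hN]
    exact Set.ncard_lt_ncard ⟨Set.sdiff_subset, fun h => (h hj.1).2 rfl⟩ (Set.toFinite _))
    hup (fun k hk' => hk k hk'.1) (n := n * n) (by rw [← mul_assoc, hen]) hsq rfl
  exact ⟨2 * m, by rwa [pow_mul, pow_two]⟩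

/-- If `e` kills the heads `L(j)` with `j > i`, then `e A e` is local in the sense that
`c e + n` is invertible in it whenever `c` is a unit and `n ∈ A^{>i}`. -/
theorem exists_corner_inv [Finite I] {i : I} {e : A} (he : e * e = e)
    (hk : ∀ j, i < j → H.KillsHead e j) {c : 𝕜} (hc : IsUnit c) {n : A}
    (hn : n ∈ H.ideal (Set.Ioi i)) (h1 : e * n = n) (h2 : n * e = n) :
    ∃ w, e * w = w ∧ w * e = w ∧ (c • e + n) * w = e ∧ w * (c • e + n) = e := by
  have := H.finite
  obtain ⟨m, hm⟩ := H.exists_pow_mem_of_killsHead (isUpperSet_Ioi i) hk h1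
    (Submodule.mem_sup_left hn)
  obtain ⟨v, hv⟩ := isUnit_smul_one_add (𝕜 := 𝕜) hc hm
  have hve : c • e + n = e * v := by rw [hv, mul_add, mul_smul_comm, mul_one, h1]
  have hcomm : Commute e (v : A) := by
    rw [commute_iff_eq, ← hve, hv, add_mul, smul_mul_assoc, one_mul, h2]
  have hcomm' : e * ↑v⁻¹ = ↑v⁻¹ * e := (hcomm.units_inv_right).eq
  refine ⟨e * ↑v⁻¹, by rw [← mul_assoc, he], by rw [hcomm', mul_assoc, he], ?_, ?_⟩
  · rw [hve, hcomm', mul_assoc, ← mul_assoc (v : A), Units.mul_inv, one_mul, he]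
  · rw [hve, hcomm', mul_assoc, ← mul_assoc e e, he, hcomm.eq, ← mul_assoc, Units.inv_mul, one_mul]

/-- An idempotent of `e A e ∩ A^{>i}` vanishes, since its complement in `e A e` is invertible. -/
theorem isPrimitiveIdem_of_killsHead [Finite I] {i : I} {e : A} (he : e * e = e)
    (h1 : H.e i * e = e) (h2 : e * H.e i = e) (h3 : e - H.e i ∈ H.ideal (Set.Ioi i))
    (hk : ∀ j, i < j → H.KillsHead e j) : IsPrimitiveIdem e := by
  have hzero : ∀ u : A, u * u = u → e * u = u → u * e = u → u ∈ H.ideal (Set.Ioi i) → u = 0 := by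
    intro u hu heu hue hmem
    obtain ⟨w, hw1, -, -, hw⟩ := H.exists_corner_inv he hk isUnit_one
      (Submodule.neg_mem _ hmem) (by rw [mul_neg, heu]) (by rw [neg_mul, hue])
    rw [one_smul] at hw
    calc u = w * (e + -u) * u := by rw [hw, heu]
      _ = 0 := by rw [mul_assoc, add_mul, heu, neg_mul, hu, add_neg_cancel, mul_zero]
  refine ⟨he, ?_, ?_⟩
  · rintro rfl
    rw [zero_sub, Submodule.neg_mem_iff] at h3
    exact H.e_notMem (by simp) h3
  · intro u w hu hw huw hwu huwe
    have heu : e * u = u := by rw [← huwe, add_mul, hu.eq, hwu, add_zero]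
    have hue : u * e = u := by rw [← huwe, mul_add, hu.eq, huw, add_zero]
    have hew : e * w = w := by rw [← huwe, add_mul, hw.eq, huw, zero_add]
    have hwe : w * e = w := by rw [← huwe, mul_add, hw.eq, hwu, zero_add]
    obtain ⟨c, hc⟩ := H.exists_coeff i u
    have h4 : H.e i * u * H.e i = u := by
      rw [← heu, ← mul_assoc, h1, heu, ← hue, mul_assoc, h2]
    rw [h4] at hc
    -- the coefficient of an idempotent is an idempotent of the local ring `𝕜`
    have hcc : c * c - c = 0 := by
      refine H.eq_zero_of_smul_e_mem (i := i) (Ω := Set.Ioi i) (by simp) ?_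
      have h5 := H.ideal_mul_left (isUpperSet_Ioi i) hc u
      have h6 := H.ideal_mul_right (isUpperSet_Ioi i) hc (c • H.e i)
      have h7 := Submodule.sub_mem _ hc (Submodule.add_mem _ h5 h6)
      have hui : u * H.e i = u := by rw [← hue, mul_assoc, h2]
      convert h7 using 1
      simp only [mul_sub, sub_mul, hu.eq, mul_smul_comm, smul_mul_assoc, H.e_idem, smul_smul,
        sub_smul, smul_sub, hui]
      abel
    have hc01 : c = 0 ∨ c = 1 := by
      have hm : c * (c - 1) = 0 := by rw [mul_sub, mul_one, hcc]
      rcases IsLocalRing.isUnit_or_isUnit_one_sub_self c with h | h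
      · right
        rw [IsUnit.mul_right_eq_zero h, sub_eq_zero] at hm
        exact hm
      · left
        have h' : IsUnit (c - 1) := by rw [← neg_sub]; exact h.neg
        rwa [IsUnit.mul_left_eq_zero h'] at hm
    rcases hc01 with rfl | rfl
    · left
      exact hzero u hu heu hue (by simpa using hc)
    · right
      refine hzero w hw hew hwe ?_
      have := Submodule.sub_mem _ h3 hc
      rwa [one_smul, sub_sub_sub_cancel_right, ← huwe, add_sub_cancel_left] at this

/-- Splitting off: if `e ≤ e_i` does not kill the head `L(j)`, `j > i`, and `e_j'` is an idempotent
with local corner at `j`, then `e` has a non-trivial summand isomorphic to `e_j'`. -/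
theorem exists_summand_of_not_killsHead [Finite I] {j : I} {e e' : A} (he : e * e = e)
    (heg : e ∈ A.gr 0) (hk : ¬ H.KillsHead e j) (he' : e' * e' = e') (heg' : e' ∈ A.gr 0)
    (h1 : H.e j * e' = e') (h2 : e' * H.e j = e') (h3 : e' - H.e j ∈ H.ideal (Set.Ioi j))
    (hk' : ∀ k, j < k → H.KillsHead e' k) :
    ∃ ε ∈ A.gr 0, ε * ε = ε ∧ e * ε = ε ∧ ε * e = ε ∧ ε ∈ H.ideal (Set.Ici j) ∧
      ε ∉ IsLocalRing.maximalIdeal 𝕜 • (⊤ : Submodule 𝕜 A) := by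
  have hup := isUpperSet_Ioi j
  -- `a` and `b` can be taken homogeneous, so that `e a w b e` below has degree zero
  have hab : ∃ d d' : Bideg, ∃ a ∈ A.gr d, ∃ b ∈ A.gr d', ¬ ∃ c ∈ IsLocalRing.maximalIdeal 𝕜,
      H.e j * (b * e * a) * H.e j - c • H.e j ∈ H.ideal (Set.Ioi j) := by
    by_contra! h
    exact hk (H.killsHead_of_homog fun d d' a ha b hb => h d d' a ha b hb)
  obtain ⟨d, d', a, ha, b, hb, hne⟩ := hab
  obtain ⟨c, hc⟩ := H.exists_coeff j (b * e * a)
  have hcm : c ∉ IsLocalRing.maximalIdeal 𝕜 := fun h => hne ⟨c, h, hc⟩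
  have hcu : IsUnit c := by simpa using hcm
  set z := H.e j * (b * e * a) * H.e j with hz
  have hzg : z ∈ A.gr (d' + d) := by
    have := A.mul_mem (A.mul_mem (H.e_gr j) (A.mul_mem (A.mul_mem hb heg) ha)) (H.e_gr j)
    simpa using this
  -- otherwise the degree zero part of `z` would vanish
  have hdd : d' + d = 0 := by
    by_contra hd
    have h := H.homogComp_mem_ideal_Ioi j hc 0
    rw [map_sub, homogComp_of_mem _ hzg, if_neg hd, map_smul, homogComp_of_mem _ (H.e_gr j),
      if_pos rfl, zero_sub, ← neg_smul] at h
    have := H.eq_zero_of_smul_e_mem (by simp) h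
    rw [neg_eq_zero] at this
    exact hcm (this ▸ Ideal.zero_mem _)
  rw [hdd] at hzg
  set n := e' * (z - c • H.e j) * e' with hn
  have hnm : n ∈ H.ideal (Set.Ioi j) := H.ideal_mul_right hup (H.ideal_mul_left hup hc _) _
  obtain ⟨w', hw1', hw2', hw3', hw4'⟩ := H.exists_corner_inv he' hk' hcu hnm
    (by rw [hn, ← mul_assoc, ← mul_assoc, he']) (by rw [hn, mul_assoc, he'])
  set v := c • e' + n with hv
  have hvz : v = e' * z * e' := by
    rw [hv, hn, mul_sub, sub_mul, mul_smul_comm, smul_mul_assoc, h2, he']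
    abel
  have hvb : v = e' * b * e * a * e' := by
    calc v = e' * (H.e j * (b * e * a) * H.e j) * e' := hvz
      _ = (e' * H.e j) * (b * e * a) * (H.e j * e') := by simp only [mul_assoc]
      _ = _ := by rw [h1, h2]; simp only [mul_assoc]
  have hvg : v ∈ A.gr 0 := by
    rw [hvz]
    simpa using A.mul_mem (A.mul_mem heg' hzg) heg'
  -- the degree zero part of the inverse is an inverse
  obtain ⟨w, hwg, hw1, hw2, hw3, hw4⟩ : ∃ w ∈ A.gr 0, e' * w = w ∧ w * e' = w ∧ v * w = e' ∧
      w * v = e' := by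
    refine ⟨homogComp A.internal 0 w', homogComp_mem _ _ _, ?_, ?_, ?_, ?_⟩
    · rw [← A.homogComp_mul heg', zero_add, hw1']
    · rw [← A.homogComp_mul_right heg', zero_add, hw2']
    · rw [← A.homogComp_mul hvg, zero_add, hw3', homogComp_of_mem _ heg', if_pos rfl]
    · rw [← A.homogComp_mul_right hvg, zero_add, hw4', homogComp_of_mem _ heg', if_pos rfl]
  have hwbw : w * (b * e * a) * w = w := by
    calc w * (b * e * a) * w = (w * e') * (b * e * a) * (e' * w) := by rw [hw2, hw1]
      _ = w * (e' * b * e * a * e') * w := by simp only [mul_assoc]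
      _ = w := by rw [← hvb, hw4, hw1]
  refine ⟨e * a * w * b * e, ?_, ?_, ?_, ?_, ?_, ?_⟩
  · have := A.mul_mem (A.mul_mem (A.mul_mem (A.mul_mem heg ha) hwg) hb) heg
    simpa [add_comm d d', hdd] using this
  · calc e * a * w * b * e * (e * a * w * b * e) = e * a * (w * (b * (e * e) * a) * w) * b * e := by
          simp only [mul_assoc]
      _ = _ := by rw [he, hwbw]
  · simp only [← mul_assoc, he]
  · simp only [mul_assoc, he]
  · have hej : H.e j ∈ H.ideal (Set.Ici j) := H.e_mem_ideal Set.self_mem_Ici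
    have hup' := isUpperSet_Ici j
    rw [← hw1, ← h1]
    refine H.ideal_mul_right hup' (H.ideal_mul_right hup' (H.ideal_mul_left hup' ?_ _) _) _
    exact H.ideal_mul_right hup' (H.ideal_mul_right hup' hej _) _
  · intro hmem
    have h4 : v ∈ IsLocalRing.maximalIdeal 𝕜 • (⊤ : Submodule 𝕜 A) := by
      have h5 : v = e' * b * (e * a * w * b * e) * (a * e') := by
        calc v = v * (w * v) := by rw [hw4, hvb]; simp only [mul_assoc, he']
          _ = (e' * b * e * a * e') * (w * (e' * b * e * a * e')) := by rw [← hvb]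
          _ = e' * b * (e * a * (e' * w * e') * b * e) * (a * e') := by simp only [mul_assoc]
          _ = _ := by rw [hw1, hw2]
      rw [h5]
      exact (mul_mem_smul_top _ (mul_mem_smul_top _ hmem _).1 _).2
    refine hcm (H.mem_of_smul_e_mem_sup (i := j) (Ω := Set.Ioi j) (by simp) _ ?_)
    have h6 : c • H.e j = (-(c • (e' - H.e j)) - n) + v := by
      rw [hv, smul_sub]
      abel
    rw [h6]
    exact Submodule.add_mem_sup (Submodule.sub_mem _ (Submodule.neg_mem _
      (Submodule.smul_mem _ _ h3)) hnm) h4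

/-- Each initial element `e_i` has a summand, congruent to it modulo `A^{>i}`, which kills all
heads `L(j)` with `j ≠ i`: a minimal summand congruent to `e_i` will do. -/
theorem exists_killsHead [Finite I] (i : I) : ∃ e ∈ A.gr 0, e * e = e ∧ H.e i * e = e ∧
    e * H.e i = e ∧ e - H.e i ∈ H.ideal (Set.Ioi i) ∧ ∀ j, j ≠ i → H.KillsHead e j := by
  induction i using WellFoundedGT.induction with
  | ind i ih =>
  have := H.finite
  have := isArtinian_quotient_maximalIdeal (𝕜 := 𝕜) (R := A)
  set Q := (IsLocalRing.maximalIdeal 𝕜 • (⊤ : Submodule 𝕜 A)) with hQ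
  let S : Set A := {e | e ∈ A.gr 0 ∧ e * e = e ∧ H.e i * e = e ∧ e * H.e i = e ∧
    e - H.e i ∈ H.ideal (Set.Ioi i)}
  -- minimality is measured by the image of `A e` in the Artinian module `A / 𝔪A`
  let M : A → Submodule 𝕜 (A ⧸ Q) := fun e => (LinearMap.range (LinearMap.mulRight 𝕜 e)).map Q.mkQ
  have hS : S.Nonempty := ⟨H.e i, H.e_gr i, H.e_idem i, H.e_idem i, H.e_idem i, by simp⟩
  obtain ⟨e, ⟨heg, he, h1, h2, h3⟩, hmin⟩ :=
    exists_minimalFor_of_wellFoundedLT (· ∈ S) M hS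
  refine ⟨e, heg, he, h1, h2, h3, ?_⟩
  by_contra! hk
  obtain ⟨j, hji, hk⟩ := hk
  -- `e` lies in the ideal of `{k | i ≤ k}`, so it kills all heads not above `i`
  have hij : i < j := by
    by_contra hij
    refine hk (H.killsHead_of_mem_ideal (isUpperSet_Ici i) (u := e) ?_
      fun h : i ≤ j => hij (lt_of_le_of_ne h hji.symm))
    rw [← h1]
    exact H.ideal_mul_right (isUpperSet_Ici i) (H.e_mem_ideal Set.self_mem_Ici) _
  obtain ⟨e', heg', he', h1', h2', h3', hk'⟩ := ih j hij
  obtain ⟨ε, hεg, hε, heε, hεe, hεj, hεm⟩ := H.exists_summand_of_not_killsHead he heg hk he' heg'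
    h1' h2' h3' (fun k hjk => hk' k (ne_of_gt hjk))
  have hεi : ε ∈ H.ideal (Set.Ioi i) := H.ideal_mono (fun k hk => lt_of_lt_of_le hij hk) hεj
  have hmem : e - ε ∈ S := by
    refine ⟨Submodule.sub_mem _ heg hεg, ?_, ?_, ?_, ?_⟩
    · rw [sub_mul, mul_sub, mul_sub, he, heε, hεe, hε, sub_self, sub_zero]
    · rw [mul_sub, h1, ← heε, ← mul_assoc, h1]
    · rw [sub_mul, h2, ← hεe, mul_assoc, h2]
    · rw [sub_right_comm]
      exact Submodule.sub_mem _ h3 hεi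
  have hle : M (e - ε) ≤ M e := by
    refine Submodule.map_mono ?_
    rintro _ ⟨a, rfl⟩
    refine ⟨a * (e - ε), ?_⟩
    rw [LinearMap.mulRight_apply, LinearMap.mulRight_apply, mul_assoc, sub_mul, he, hεe]
  have hεM : Q.mkQ ε ∈ M (e - ε) := hmin hmem hle ⟨ε, ⟨ε, by simpa using hεe⟩, rfl⟩
  obtain ⟨_, ⟨a, rfl⟩, ha⟩ := hεM
  rw [Submodule.mkQ_apply, Submodule.mkQ_apply, Submodule.Quotient.eq,
    LinearMap.mulRight_apply] at ha
  have := (mul_mem_smul_top _ ha ε).2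
  rw [sub_mul, mul_assoc, sub_mul, heε, hε, sub_self, mul_zero, zero_sub,
    Submodule.neg_mem_iff] at this
  exact hεm this

end HeredityData

/-! ### Replacing heredity data by congruent ones -/

section Selection

variable {𝕜 : Type u} [CommRing 𝕜] [IsLocalRing 𝕜] {V : Type v} [AddCommGroup V] [Module 𝕜 V]

/-- If the finite set `X₀` is linearly independent modulo `N`, then every set `S` which spans the
same submodule as `X₀` modulo `N` contains a set `T` of at most the same cardinality which still
does: over a local ring, a generating set of a free module contains a basis. -/
theorem exists_subset_span_sup {N : Submodule 𝕜 V} {X₀ S : Set V} (hfin : X₀.Finite)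
    (hli : ∀ x₀ ∈ X₀, ∃ l : V →ₗ[𝕜] 𝕜, l x₀ = 1 ∧ (∀ x ∈ X₀, x ≠ x₀ → l x = 0) ∧
      ∀ u ∈ N, l u = 0)
    (hS : S ⊆ (Submodule.span 𝕜 X₀ ⊔ N : Submodule 𝕜 V))
    (hX₀ : X₀ ⊆ (Submodule.span 𝕜 S ⊔ N : Submodule 𝕜 V)) :
    ∃ T ⊆ S, T.Finite ∧ T.ncard ≤ X₀.ncard ∧ X₀ ⊆ (Submodule.span 𝕜 T ⊔ N : Submodule 𝕜 V) := by
  classical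
  have := hfin.fintype
  let w : X₀ → V ⧸ N := fun x => N.mkQ x
  have hw : LinearIndependent 𝕜 w := by
    rw [linearIndependent_iff']
    intro s g hg x hx
    obtain ⟨l, h1, h2, h3⟩ := hli x x.2
    have h3' : N ≤ l.ker := fun u hu => LinearMap.mem_ker.2 (h3 u hu)
    have h4 := congrArg (N.liftQ l h3') hg
    simp only [w] at h4
    rw [map_sum, map_zero, Finset.sum_eq_single_of_mem x hx] at h4
    · rw [map_smul, Submodule.mkQ_apply, Submodule.liftQ_apply, h1, smul_eq_mul, mul_one] at h4
      exact h4
    · intro y _ hy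
      rw [map_smul, Submodule.mkQ_apply, Submodule.liftQ_apply,
        h2 y y.2 fun h => hy (Subtype.ext h), smul_zero]
  let P := Submodule.span 𝕜 (Set.range w)
  let b : Module.Basis X₀ 𝕜 P := Module.Basis.span hw
  have : Module.Free 𝕜 P := .of_basis b
  have : Module.Finite 𝕜 P := .of_basis b
  have : Module.FinitePresentation 𝕜 P := Module.finitePresentation_of_projective 𝕜 P
  have hP : ∀ T : Set V, (Submodule.span 𝕜 T).map N.mkQ = Submodule.span 𝕜 (N.mkQ '' T) :=
    fun T => Submodule.map_span _ _
  have hPw : P = (Submodule.span 𝕜 X₀).map N.mkQ := by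
    rw [hP, Set.image_eq_range]
  have hmk : ∀ (T : Set V) (x : V), N.mkQ x ∈ (Submodule.span 𝕜 T).map N.mkQ ↔
      x ∈ Submodule.span 𝕜 T ⊔ N := by
    intro T x
    rw [← Submodule.mem_comap, Submodule.comap_map_mkQ, sup_comm]
  let v : S → P := fun s => ⟨N.mkQ s, by rw [hPw, hmk]; exact hS s.2⟩
  have hv : Submodule.span 𝕜 (Set.range v) = ⊤ := by
    apply Submodule.map_injective_of_injective P.subtype_injective
    rw [Submodule.map_subtype_top, Submodule.map_span, ← Set.range_comp]
    have h1 : Set.range (P.subtype ∘ v) = N.mkQ '' S := by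
      rw [Set.image_eq_range]
      rfl
    rw [h1, ← hP]
    apply le_antisymm
    · rw [hP, Submodule.span_le]
      rintro _ ⟨s, hs, rfl⟩
      exact (v ⟨s, hs⟩).2
    · rw [hPw, hP, Submodule.span_le]
      rintro _ ⟨x, hx, rfl⟩
      exact (hmk S x).2 (hX₀ hx)
  obtain ⟨κ, a, b', hb'⟩ := Module.exists_basis_of_span_of_flat v hv
  have : Finite κ := Module.Finite.finite_basis b'
  refine ⟨Set.range fun t => (a t : V), ?_, Set.finite_range _, ?_, ?_⟩
  · rintro _ ⟨t, rfl⟩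
    exact (a t).2
  · have h1 : Nat.card κ = X₀.ncard := by
      rw [← Module.finrank_eq_nat_card_basis b', Module.finrank_eq_nat_card_basis b]
      rfl
    rw [← h1, ← Set.image_univ, ← Set.ncard_univ]
    exact Set.ncard_image_le Set.finite_univ
  · intro x hx
    rw [SetLike.mem_coe, ← hmk]
    have h1 : P ≤ (Submodule.span 𝕜 (Set.range fun t => (a t : V))).map N.mkQ := by
      have h2 := b'.span_eq
      have h3 := congrArg (Submodule.map P.subtype) h2
      rw [Submodule.map_subtype_top, Submodule.map_span, ← Set.range_comp] at h3
      rw [← h3, hP, Submodule.span_le]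
      rintro _ ⟨t, rfl⟩
      refine Submodule.subset_span ⟨a t, ⟨t, rfl⟩, ?_⟩
      rw [Function.comp_apply, hb']
      rfl
    exact h1 (Submodule.subset_span ⟨⟨x, hx⟩, rfl⟩)

end Selection

section Products

variable {𝕜 : Type u} [CommRing 𝕜] {R : Type v} [Ring R] [Algebra 𝕜 R]

theorem mul_mem_span_image2_sup {N : Submodule 𝕜 R} (hl : ∀ u ∈ N, ∀ a, a * u ∈ N)
    (hr : ∀ u ∈ N, ∀ a, u * a ∈ N) {X Y : Set R} {x y : R} (hx : x ∈ Submodule.span 𝕜 X ⊔ N)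
    (hy : y ∈ Submodule.span 𝕜 Y ⊔ N) :
    x * y ∈ Submodule.span 𝕜 (Set.image2 (· * ·) X Y) ⊔ N := by
  obtain ⟨s, hs, t, ht, rfl⟩ := Submodule.mem_sup.1 hx
  obtain ⟨s', hs', t', ht', rfl⟩ := Submodule.mem_sup.1 hy
  rw [add_mul, mul_add, add_assoc]
  refine Submodule.add_mem_sup ?_ (Submodule.add_mem _ (hl _ ht' _) (hr _ ht _))
  rw [show Set.image2 (· * ·) X Y = {a | ∃ x ∈ X, ∃ y ∈ Y, x * y = a} from rfl]
  have := Submodule.mul_mem_mul hs hs'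
  rw [Submodule.span_mul_span] at this
  exact this

end Products

namespace HeredityData

variable {𝕜 : Type u} [CommRing 𝕜] {A : GrSAlg.{u, v} 𝕜} {I : Type*}
  [PartialOrder I] (H : HeredityData A I)

theorem exists_coord_X {i : I} {x₀ : A} (hx₀ : x₀ ∈ H.X i) :
    ∃ l : A →ₗ[𝕜] 𝕜, l x₀ = 1 ∧ (∀ x ∈ H.X i, x ≠ x₀ → l x = 0) ∧
      ∀ u ∈ H.ideal (Set.Ioi i), l u = 0 := by
  obtain ⟨l, h1, h2, h3⟩ := H.exists_coord hx₀ (H.e_mem_Y i)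
  refine ⟨l, by rwa [H.X_mul_e i x₀ hx₀] at h1, fun x hx hne => ?_, h3 _ (by simp)⟩
  have := h2 x hx _ (H.e_mem_Y i) (Or.inl hne)
  rwa [H.X_mul_e i x hx] at this

theorem exists_coord_Y {i : I} {y₀ : A} (hy₀ : y₀ ∈ H.Y i) :
    ∃ l : A →ₗ[𝕜] 𝕜, l y₀ = 1 ∧ (∀ y ∈ H.Y i, y ≠ y₀ → l y = 0) ∧
      ∀ u ∈ H.ideal (Set.Ioi i), l u = 0 := by
  obtain ⟨l, h1, h2, h3⟩ := H.exists_coord (H.e_mem_X i) hy₀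
  refine ⟨l, by rwa [H.e_mul_Y i y₀ hy₀] at h1, fun y hy hne => ?_, h3 _ (by simp)⟩
  have := h2 _ (H.e_mem_X i) y hy (Or.inr hne)
  rwa [H.e_mul_Y i y hy] at this

theorem mul_mem_span_X_sup [Finite I] {i : I} {u : A}
    (hu : u ∈ Submodule.span 𝕜 (H.X i) ⊔ H.ideal (Set.Ioi i)) (a : A) :
    a * u ∈ Submodule.span 𝕜 (H.X i) ⊔ H.ideal (Set.Ioi i) := by
  obtain ⟨s, hs, t, ht, rfl⟩ := Submodule.mem_sup.1 hu
  rw [mul_add]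
  refine Submodule.add_mem _ ?_ (Submodule.mem_sup_right (H.ideal_Ioi i t ht a).1)
  have h1 : Submodule.span 𝕜 (H.X i) ≤
      (Submodule.span 𝕜 (H.X i) ⊔ H.ideal (Set.Ioi i)).comap (LinearMap.mulLeft 𝕜 a) :=
    Submodule.span_le.2 fun x hx => H.mul_X i x hx a
  exact h1 hs

theorem mul_mem_span_Y_sup [Finite I] {i : I} {u : A}
    (hu : u ∈ Submodule.span 𝕜 (H.Y i) ⊔ H.ideal (Set.Ioi i)) (a : A) :
    u * a ∈ Submodule.span 𝕜 (H.Y i) ⊔ H.ideal (Set.Ioi i) := by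
  obtain ⟨s, hs, t, ht, rfl⟩ := Submodule.mem_sup.1 hu
  rw [add_mul]
  refine Submodule.add_mem _ ?_ (Submodule.mem_sup_right (H.ideal_Ioi i t ht a).2)
  have h1 : Submodule.span 𝕜 (H.Y i) ≤
      (Submodule.span 𝕜 (H.Y i) ⊔ H.ideal (Set.Ioi i)).comap (LinearMap.mulRight 𝕜 a) :=
    Submodule.span_le.2 fun x hx => H.Y_mul i x hx a
  exact h1 hs

section Congruent

variable {H} {X' Y' : I → Set A}

theorem mul_mem_prodSpan_of_congruent [Finite I] {i : I} {X Y : I → Set A} {x y : A}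
    (hx : x ∈ Submodule.span 𝕜 (X i) ⊔ H.ideal (Set.Ioi i))
    (hy : y ∈ Submodule.span 𝕜 (Y i) ⊔ H.ideal (Set.Ioi i)) {P : Submodule 𝕜 A} {Ω : Set I}
    (hi : i ∈ Ω) (h1 : prodSpan A X Y Ω ≤ P) (h2 : H.ideal (Set.Ioi i) ≤ P) : x * y ∈ P := by
  have := mul_mem_span_image2_sup (fun u hu a => (H.ideal_Ioi i u hu a).1)
    (fun u hu a => (H.ideal_Ioi i u hu a).2) hx hy
  refine (sup_le (le_trans (Submodule.span_mono ?_) h1) h2) this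
  rintro _ ⟨x, hx, y, hy, rfl⟩
  exact ⟨i, hi, x, hx, y, hy, rfl⟩

theorem prodSpan_eq_ideal_of_congruent [Finite I]
    (hX : ∀ i, X' i ⊆ (Submodule.span 𝕜 (H.X i) ⊔ H.ideal (Set.Ioi i) : Submodule 𝕜 A))
    (hX' : ∀ i, H.X i ⊆ (Submodule.span 𝕜 (X' i) ⊔ H.ideal (Set.Ioi i) : Submodule 𝕜 A))
    (hY : ∀ i, Y' i ⊆ (Submodule.span 𝕜 (H.Y i) ⊔ H.ideal (Set.Ioi i) : Submodule 𝕜 A))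
    (hY' : ∀ i, H.Y i ⊆ (Submodule.span 𝕜 (Y' i) ⊔ H.ideal (Set.Ioi i) : Submodule 𝕜 A))
    {Ω : Set I} (hΩ : IsUpperSet Ω) : prodSpan A X' Y' Ω = H.ideal Ω := by
  have hmono : ∀ {Ω Ω' : Set I}, Ω ⊆ Ω' → prodSpan A X' Y' Ω ≤ prodSpan A X' Y' Ω' :=
    fun h => Submodule.span_mono fun _ ⟨i, hi, r⟩ => ⟨i, h hi, r⟩
  apply le_antisymm
  · refine Submodule.span_le.2 ?_
    rintro _ ⟨i, hi, x, hx, y, hy, rfl⟩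
    exact mul_mem_prodSpan_of_congruent (hX i hx) (hY i hy) hi le_rfl
      (H.ideal_mono fun k hk => hΩ (le_of_lt hk) hi)
  · have key : ∀ i, ∀ x ∈ H.X i, ∀ y ∈ H.Y i, x * y ∈ prodSpan A X' Y' (Set.Ici i) := by
      intro i
      induction i using WellFoundedGT.induction with
      | ind i ih =>
        intro x hx y hy
        refine mul_mem_prodSpan_of_congruent (hX' i hx) (hY' i hy) Set.self_mem_Ici le_rfl ?_
        refine Submodule.span_le.2 ?_
        rintro _ ⟨j, hj, x, hx, y, hy, rfl⟩
        exact hmono (Set.Ici_subset_Ici.2 (le_of_lt hj)) (ih j hj x hx y hy)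
    refine Submodule.span_le.2 ?_
    rintro _ ⟨i, hi, x, hx, y, hy, rfl⟩
    exact hmono (hΩ.Ici_subset hi) (key i x hx y hy)

/-- A spanning family with at most `rank A` members is a basis. -/
theorem linearIndependent_of_ncard_le [Nontrivial 𝕜] [Finite I] (hXf : ∀ i, (X' i).Finite)
    (hYf : ∀ i, (Y' i).Finite) (hXc : ∀ i, (X' i).ncard ≤ (H.X i).ncard)
    (hYc : ∀ i, (Y' i).ncard ≤ (H.Y i).ncard) (hs : prodSpan A X' Y' Set.univ = ⊤) :
    LinearIndependent 𝕜 fun z : (Σ i, X' i × Y' i) => ((z.2.1 : A) * (z.2.2 : A)) := by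
  classical
  have := Fintype.ofFinite I
  have := fun i => (hXf i).fintype
  have := fun i => (hYf i).fintype
  have := fun i => (H.X_finite i).fintype
  have := fun i => (H.Y_finite i).fintype
  have hle : ∀ X Y : I → Set A, prodSpan A X Y Set.univ = ⊤ → ⊤ ≤ Submodule.span 𝕜
      (Set.range fun z : (Σ i, X i × Y i) => ((z.2.1 : A) * (z.2.2 : A))) := by
    intro X Y h
    rw [← h]
    refine Submodule.span_mono ?_
    rintro _ ⟨i, _, x, hx, y, hy, rfl⟩
    exact ⟨⟨i, ⟨x, hx⟩, ⟨y, hy⟩⟩, rfl⟩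
  refine linearIndependent_of_top_le_span_of_card_le_finrank (hle _ _ hs) ?_
  rw [Module.finrank_eq_card_basis (Module.Basis.mk H.linearIndependent
    (hle _ _ H.span_eq_top)), Fintype.card_sigma, Fintype.card_sigma]
  refine Finset.sum_le_sum fun i _ => ?_
  rw [Fintype.card_prod, Fintype.card_prod]
  refine Nat.mul_le_mul ?_ ?_
  · rw [← Nat.card_eq_fintype_card, ← Nat.card_eq_fintype_card]
    exact hXc i
  · rw [← Nat.card_eq_fintype_card, ← Nat.card_eq_fintype_card]
    exact hYc i

end Congruent

/-! ### Refining the initial elements -/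

/-- The idempotents `e' i` of degree zero are summands of the initial elements `e_i`, congruent to
them modulo `A^{>i}`. -/
structure IsRefinement (e' : I → A) : Prop where
  mem_gr : ∀ i, e' i ∈ A.gr 0
  idem : ∀ i, e' i * e' i = e' i
  e_mul : ∀ i, H.e i * e' i = e' i
  mul_e : ∀ i, e' i * H.e i = e' i
  sub_mem : ∀ i, e' i - H.e i ∈ H.ideal (Set.Ioi i)

/-- The family consisting of the `e' i` and of the complement `1 - ∑ e' i`. -/
def complIdem [Fintype I] (e' : I → A) : Option I → A
  | some i => e' i
  | none => 1 - ∑ i, e' i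

theorem sum_complIdem {I : Type*} [Fintype I] (e' : I → A) : ∑ k, complIdem e' k = 1 := by
  rw [Fintype.sum_option]
  simp [complIdem]

namespace IsRefinement

variable {H} {e' : I → A} (hr : H.IsRefinement e')
include hr

theorem sub_mem_mul [Finite I] (i : I) (x : A) (hx : x ∈ H.X i) :
    x * e' i - x ∈ H.ideal (Set.Ioi i) := by
  have := (H.ideal_Ioi i _ (hr.sub_mem i) x).1
  rwa [mul_sub, H.X_mul_e i x hx] at this

theorem sub_mem_mul' [Finite I] (i : I) (y : A) (hy : y ∈ H.Y i) :
    e' i * y - y ∈ H.ideal (Set.Ioi i) := by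
  have := (H.ideal_Ioi i _ (hr.sub_mem i) y).2
  rwa [sub_mul, H.e_mul_Y i y hy] at this

theorem complIdem_mem [Fintype I] (k : Option I) : complIdem e' k ∈ A.gr 0 := by
  cases k with
  | none => exact Submodule.sub_mem _ A.one_mem (Submodule.sum_mem _ fun i _ => hr.mem_gr i)
  | some i => exact hr.mem_gr i

variable [IsLocalRing 𝕜]

theorem mul_of_ne {i j : I} (hij : i ≠ j) : e' i * e' j = 0 := by
  rw [← hr.mul_e i, ← hr.e_mul j, mul_assoc, ← mul_assoc (H.e i), H.e_mul_e_of_ne hij, zero_mul,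
    mul_zero]

variable [Fintype I]

theorem mul_sum (i : I) : e' i * ∑ j, e' j = e' i := by
  rw [Finset.mul_sum, Finset.sum_eq_single_of_mem i (Finset.mem_univ i), hr.idem]
  exact fun j _ hj => hr.mul_of_ne hj.symm

theorem sum_mul (i : I) : (∑ j, e' j) * e' i = e' i := by
  rw [Finset.sum_mul, Finset.sum_eq_single_of_mem i (Finset.mem_univ i), hr.idem]
  exact fun j _ hj => hr.mul_of_ne hj

theorem mul_complIdem (j : I) (k : Option I) :
    (k = some j ∧ e' j * complIdem e' k = e' j ∧ complIdem e' k * e' j = e' j) ∨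
      (e' j * complIdem e' k = 0 ∧ complIdem e' k * e' j = 0) := by
  cases k with
  | none =>
    right
    rw [complIdem, mul_sub, sub_mul, mul_one, one_mul, hr.mul_sum, hr.sum_mul, sub_self]
    exact ⟨rfl, rfl⟩
  | some i =>
    rcases eq_or_ne i j with rfl | hij
    · exact Or.inl ⟨rfl, hr.idem i, hr.idem i⟩
    · exact Or.inr ⟨hr.mul_of_ne hij.symm, hr.mul_of_ne hij⟩

/-- Replacement of a subset `X₀ ⊆ X(i)` by elements `g x e'_i` with `x ∈ X₀`. -/
theorem exists_X (i : I) {X₀ : Set A} (hX₀ : X₀ ⊆ H.X i)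
    (hst : ∀ a ∈ A.gr 0, ∀ x ∈ X₀, a * x ∈ Submodule.span 𝕜 X₀ ⊔ H.ideal (Set.Ioi i)) :
    ∃ T ⊆ {z | ∃ k, ∃ x ∈ X₀, z = complIdem e' k * x * e' i}, T.Finite ∧
      T.ncard ≤ X₀.ncard ∧ X₀ ⊆ (Submodule.span 𝕜 T ⊔ H.ideal (Set.Ioi i) : Submodule 𝕜 A) := by
  refine exists_subset_span_sup ((H.X_finite i).subset hX₀) ?_ ?_ ?_
  · intro x₀ hx₀
    obtain ⟨l, h1, h2, h3⟩ := H.exists_coord_X (hX₀ hx₀)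
    exact ⟨l, h1, fun x hx => h2 x (hX₀ hx), h3⟩
  · rintro _ ⟨k, x, hx, rfl⟩
    have h1 := hst _ (hr.complIdem_mem k) x hx
    have h2 := (H.ideal_Ioi i _ (hr.sub_mem_mul i x (hX₀ hx)) (complIdem e' k)).1
    have h3 := Submodule.add_mem _ h1 (Submodule.mem_sup_right h2)
    rwa [mul_sub, add_sub_cancel, ← mul_assoc] at h3
  · intro x hx
    have h1 : x = ∑ k, complIdem e' k * x * e' i - (x * e' i - x) := by
      rw [← Finset.sum_mul, ← Finset.sum_mul, sum_complIdem, one_mul, sub_sub_cancel]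
    rw [h1]
    refine Submodule.sub_mem _ (Submodule.mem_sup_left (Submodule.sum_mem _ fun k _ =>
      Submodule.subset_span ⟨k, x, hx, rfl⟩))
      (Submodule.mem_sup_right (hr.sub_mem_mul i x (hX₀ hx)))

/-- Replacement of a subset `Y₀ ⊆ Y(i)` by elements `e'_i y g` with `y ∈ Y₀`. -/
theorem exists_Y (i : I) {Y₀ : Set A} (hY₀ : Y₀ ⊆ H.Y i)
    (hst : ∀ a ∈ A.gr 0, ∀ y ∈ Y₀, y * a ∈ Submodule.span 𝕜 Y₀ ⊔ H.ideal (Set.Ioi i)) :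
    ∃ T ⊆ {z | ∃ k, ∃ y ∈ Y₀, z = e' i * y * complIdem e' k}, T.Finite ∧
      T.ncard ≤ Y₀.ncard ∧ Y₀ ⊆ (Submodule.span 𝕜 T ⊔ H.ideal (Set.Ioi i) : Submodule 𝕜 A) := by
  refine exists_subset_span_sup ((H.Y_finite i).subset hY₀) ?_ ?_ ?_
  · intro y₀ hy₀
    obtain ⟨l, h1, h2, h3⟩ := H.exists_coord_Y (hY₀ hy₀)
    exact ⟨l, h1, fun y hy => h2 y (hY₀ hy), h3⟩
  · rintro _ ⟨k, y, hy, rfl⟩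
    have h1 := hst _ (hr.complIdem_mem k) y hy
    have h2 := (H.ideal_Ioi i _ (hr.sub_mem_mul' i y (hY₀ hy)) (complIdem e' k)).2
    have h3 := Submodule.add_mem _ h1 (Submodule.mem_sup_right h2)
    rwa [sub_mul, add_sub_cancel] at h3
  · intro y hy
    have h1 : y = ∑ k, e' i * y * complIdem e' k - (e' i * y - y) := by
      rw [← Finset.mul_sum, sum_complIdem, mul_one, sub_sub_cancel]
    rw [h1]
    refine Submodule.sub_mem _ (Submodule.mem_sup_left (Submodule.sum_mem _ fun k _ =>
      Submodule.subset_span ⟨k, y, hy, rfl⟩))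
      (Submodule.mem_sup_right (hr.sub_mem_mul' i y (hY₀ hy)))

theorem e_mul_X (i : I) {z : A} (hz : ∃ k, ∃ x ∈ H.X i, z = complIdem e' k * x * e' i)
    (hne : z ≠ e' i) : e' i * z = 0 := by
  obtain ⟨k, x, hx, rfl⟩ := hz
  rcases hr.mul_complIdem i k with ⟨rfl, -⟩ | ⟨h, -⟩
  · rw [complIdem] at hne ⊢
    by_cases hxe : x = H.e i
    · rw [hxe, hr.mul_e, hr.idem] at hne
      exact absurd rfl hne
    · rw [← hr.mul_e i, mul_assoc (e' i) (H.e i) x, H.e_mul_X i x hx hxe]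
      simp
  · rw [← mul_assoc, ← mul_assoc, h, zero_mul, zero_mul]

theorem Y_mul_e (i : I) {z : A} (hz : ∃ k, ∃ y ∈ H.Y i, z = e' i * y * complIdem e' k)
    (hne : z ≠ e' i) : z * e' i = 0 := by
  obtain ⟨k, y, hy, rfl⟩ := hz
  rcases hr.mul_complIdem i k with ⟨rfl, -⟩ | ⟨-, h⟩
  · rw [complIdem] at hne ⊢
    by_cases hye : y = H.e i
    · rw [hye, hr.mul_e, hr.idem] at hne
      exact absurd rfl hne
    · rw [← hr.e_mul i, mul_assoc (H.e i * e' i) y, ← mul_assoc y, H.Y_mul_e i y hy hye]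
      simp
  · rw [mul_assoc, h, mul_zero]

/-- Heredity data whose elements have the form `g x e'_i` and `e'_i y g`. Their initial elements
are the `e'_i`, and their ideals are the original ones. -/
theorem exists_heredityData {X' Y' : I → Set A} (hXf : ∀ i, (X' i).Finite)
    (hYf : ∀ i, (Y' i).Finite) (hXc : ∀ i, (X' i).ncard ≤ (H.X i).ncard)
    (hYc : ∀ i, (Y' i).ncard ≤ (H.Y i).ncard)
    (hXs : ∀ i, X' i ⊆ {z | ∃ k, ∃ x ∈ H.X i, z = complIdem e' k * x * e' i})
    (hYs : ∀ i, Y' i ⊆ {z | ∃ k, ∃ y ∈ H.Y i, z = e' i * y * complIdem e' k})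
    (hX' : ∀ i, H.X i ⊆ (Submodule.span 𝕜 (X' i) ⊔ H.ideal (Set.Ioi i) : Submodule 𝕜 A))
    (hY' : ∀ i, H.Y i ⊆ (Submodule.span 𝕜 (Y' i) ⊔ H.ideal (Set.Ioi i) : Submodule 𝕜 A)) :
    ∃ H' : HeredityData A I, H'.X = X' ∧ H'.Y = Y' ∧ H'.e = e' ∧
      ∀ Ω, IsUpperSet Ω → H'.ideal Ω = H.ideal Ω := by
  have hX : ∀ i, X' i ⊆ (Submodule.span 𝕜 (H.X i) ⊔ H.ideal (Set.Ioi i) : Submodule 𝕜 A) := by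
    intro i z hz
    obtain ⟨k, x, hx, rfl⟩ := hXs i hz
    rw [mul_assoc]
    refine H.mul_mem_span_X_sup ?_ _
    rw [← add_sub_cancel x (x * e' i)]
    exact Submodule.add_mem_sup (Submodule.subset_span hx) (hr.sub_mem_mul i x hx)
  have hY : ∀ i, Y' i ⊆ (Submodule.span 𝕜 (H.Y i) ⊔ H.ideal (Set.Ioi i) : Submodule 𝕜 A) := by
    intro i z hz
    obtain ⟨k, y, hy, rfl⟩ := hYs i hz
    refine H.mul_mem_span_Y_sup ?_ _
    rw [← add_sub_cancel y (e' i * y)]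
    exact Submodule.add_mem_sup (Submodule.subset_span hy) (hr.sub_mem_mul' i y hy)
  have hid : ∀ Ω, IsUpperSet Ω → prodSpan A X' Y' Ω = H.ideal Ω := fun Ω hΩ =>
    prodSpan_eq_ideal_of_congruent hX hX' hY hY' hΩ
  have htop : prodSpan A X' Y' Set.univ = ⊤ := by
    rw [hid _ isUpperSet_univ]
    exact H.span_eq_top
  have hlin := linearIndependent_of_ncard_le hXf hYf hXc hYc htop
  have he'mem : ∀ i, e' i ∉ H.ideal (Set.Ioi i) := by
    intro i h
    have := Submodule.sub_mem _ h (hr.sub_mem i)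
    rw [sub_sub_cancel] at this
    exact H.e_notMem (by simp) this
  -- all elements of `X'(i)` but `e'_i` are annihilated by `e'_i`, so `e'_i` is needed to span
  have heX : ∀ i, e' i ∈ X' i := by
    intro i
    by_contra hi
    obtain ⟨s, hs, t, ht, hst⟩ := Submodule.mem_sup.1 (hX' i (H.e_mem_X i))
    have h0 : Submodule.span 𝕜 (X' i) ≤ LinearMap.ker (LinearMap.mulLeft 𝕜 (e' i)) :=
      Submodule.span_le.2 fun x hx => hr.e_mul_X i (hXs i hx) fun h => hi (h ▸ hx)
    have h1 : e' i * s = 0 := h0 hs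
    have h2 := congrArg (e' i * ·) hst
    simp only [mul_add, h1, zero_add, hr.mul_e] at h2
    exact he'mem i (h2 ▸ (H.ideal_Ioi i t ht _).1)
  have heY : ∀ i, e' i ∈ Y' i := by
    intro i
    by_contra hi
    obtain ⟨s, hs, t, ht, hst⟩ := Submodule.mem_sup.1 (hY' i (H.e_mem_Y i))
    have h0 : Submodule.span 𝕜 (Y' i) ≤ LinearMap.ker (LinearMap.mulRight 𝕜 (e' i)) :=
      Submodule.span_le.2 fun x hx => hr.Y_mul_e i (hYs i hx) fun h => hi (h ▸ hx)
    have h1 : s * e' i = 0 := h0 hs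
    have h2 := congrArg (· * e' i) hst
    simp only [add_mul, h1, zero_add, hr.e_mul] at h2
    exact he'mem i (h2 ▸ (H.ideal_Ioi i t ht _).2)
  refine ⟨{ X := X', Y := Y', e := e', X_finite := hXf, Y_finite := hYf,
            X_homog := ?_, Y_homog := ?_, e_mem_X := heX, e_mem_Y := heY,
            linearIndependent := hlin, span_eq_top := htop, mul_X := ?_, Y_mul := ?_,
            X_mul_e := ?_, e_mul_X := fun i z hz => hr.e_mul_X i (hXs i hz), e_mul_Y := ?_,
            Y_mul_e := fun i z hz => hr.Y_mul_e i (hYs i hz), e_mul_X' := ?_, Y_mul_e' := ?_ },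
    rfl, rfl, rfl, hid⟩
  · intro i x hx
    refine ⟨?_, ?_⟩
    · rintro rfl
      have := hlin.ne_zero ⟨i, ⟨0, hx⟩, ⟨e' i, heY i⟩⟩
      simp at this
    · obtain ⟨k, x, hx', rfl⟩ := hXs i hx
      obtain ⟨-, d, hd⟩ := H.X_homog i x hx'
      exact ⟨_, A.mul_mem (A.mul_mem (hr.complIdem_mem k) hd) (hr.mem_gr i)⟩
  · intro i y hy
    refine ⟨?_, ?_⟩
    · rintro rfl
      have := hlin.ne_zero ⟨i, ⟨e' i, heX i⟩, ⟨0, hy⟩⟩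
      simp at this
    · obtain ⟨k, y, hy', rfl⟩ := hYs i hy
      obtain ⟨-, d, hd⟩ := H.Y_homog i y hy'
      exact ⟨_, A.mul_mem (A.mul_mem (hr.mem_gr i) hd) (hr.complIdem_mem k)⟩
  · intro i x hx a
    rw [hid _ (isUpperSet_Ioi i)]
    exact (sup_le (Submodule.span_le.2 (hX' i)) le_sup_right :
      Submodule.span 𝕜 (H.X i) ⊔ H.ideal (Set.Ioi i) ≤ _) (H.mul_mem_span_X_sup (hX i hx) a)
  · intro i y hy a
    rw [hid _ (isUpperSet_Ioi i)]
    exact (sup_le (Submodule.span_le.2 (hY' i)) le_sup_right :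
      Submodule.span 𝕜 (H.Y i) ⊔ H.ideal (Set.Ioi i) ≤ _) (H.mul_mem_span_Y_sup (hY i hy) a)
  · intro i z hz
    obtain ⟨k, x, hx, rfl⟩ := hXs i hz
    rw [mul_assoc, hr.idem]
  · intro i z hz
    obtain ⟨k, y, hy, rfl⟩ := hYs i hz
    rw [← mul_assoc, ← mul_assoc, hr.idem]
  · intro i z hz j
    obtain ⟨k, x, hx, rfl⟩ := hXs i hz
    rcases hr.mul_complIdem j k with ⟨rfl, -⟩ | ⟨h, -⟩
    · left
      rw [complIdem, ← mul_assoc, ← mul_assoc, hr.idem]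
    · right
      rw [← mul_assoc, ← mul_assoc, h, zero_mul, zero_mul]
  · intro i z hz j
    obtain ⟨k, y, hy, rfl⟩ := hYs i hz
    rcases hr.mul_complIdem j k with ⟨rfl, -⟩ | ⟨-, h⟩
    · left
      rw [complIdem, mul_assoc, hr.idem]
    · right
      rw [mul_assoc, h, mul_zero]

end IsRefinement

end HeredityData

/-! ### Parities and conforming refinements -/

namespace GrSAlg

variable {𝕜 : Type u} [CommRing 𝕜] {A : GrSAlg.{u, v} 𝕜}

theorem mem_parity_of_mem_gr {d : Bideg} {a : A} (ha : a ∈ A.gr d) : a ∈ A.parity d.2 :=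
  Submodule.mem_iSup_of_mem d.1 ha

theorem eq_zero_of_mem_gr_of_mem_parity {d : Bideg} {ε : ZMod 2} {a : A} (ha : a ∈ A.gr d)
    (haε : a ∈ A.parity ε) (hd : d.2 ≠ ε) : a = 0 := by
  have h1 : homogComp A.internal d a = 0 := by
    refine Submodule.iSup_induction (fun n : ℤ => A.gr (n, ε))
      (motive := fun a => homogComp A.internal d a = 0) haε ?_ (map_zero _) ?_
    · intro n x hx
      rw [homogComp_of_mem _ hx, if_neg]
      rintro rfl
      exact hd rfl
    · intro x y hx hy
      rw [map_add, hx, hy, add_zero]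
  rwa [homogComp_of_mem _ ha, if_pos rfl] at h1

end GrSAlg

theorem mem_span_sup_mono {𝕜 : Type*} {V : Type*} [CommRing 𝕜] [AddCommGroup V] [Module 𝕜 V]
    {N : Submodule 𝕜 V} {Z Z' : Set V} (h : Z ⊆ Z') {u : V}
    (hu : u ∈ Submodule.span 𝕜 Z ⊔ N) : u ∈ Submodule.span 𝕜 Z' ⊔ N :=
  (sup_le_sup_right (Submodule.span_mono h) N :
    Submodule.span 𝕜 Z ⊔ N ≤ Submodule.span 𝕜 Z' ⊔ N) hu

namespace HeredityData

variable {𝕜 : Type u} [CommRing 𝕜] {A B : GrSAlg.{u, v} 𝕜} {I : Type*}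
  [PartialOrder I]

/-- A homogeneous element of a span of homogeneous elements, modulo `A^{>i}`, only involves
spanning elements of its own degree. -/
theorem mem_span_gr_sup [Finite I] (H : HeredityData A I) {i : I} {Z : Set A}
    (hZ : ∀ x ∈ Z, ∃ d, x ∈ A.gr d) {d : Bideg} {u : A} (hu : u ∈ A.gr d)
    (h : u ∈ Submodule.span 𝕜 Z ⊔ H.ideal (Set.Ioi i)) :
    u ∈ Submodule.span 𝕜 (Z ∩ A.gr d) ⊔ H.ideal (Set.Ioi i) := by
  obtain ⟨s, hs, t, ht, hst⟩ := Submodule.mem_sup.1 h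
  have h1 := congrArg (homogComp A.internal d) hst
  rw [map_add, homogComp_of_mem _ hu, if_pos rfl] at h1
  rw [← h1]
  refine Submodule.add_mem_sup ?_ (H.homogComp_mem_ideal_Ioi i ht d)
  have h2 : Submodule.span 𝕜 Z ≤
      (Submodule.span 𝕜 (Z ∩ A.gr d)).comap (homogComp A.internal d) := by
    refine Submodule.span_le.2 fun x hx => ?_
    obtain ⟨d', hd'⟩ := hZ x hx
    rw [SetLike.mem_coe, Submodule.mem_comap, homogComp_of_mem _ hd']
    split_ifs with hdd
    · exact Submodule.subset_span ⟨hx, hdd ▸ hd'⟩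
    · exact Submodule.zero_mem _
  exact h2 hs

theorem map_complIdem {I : Type*} [Fintype I] (ι : B →ₐ[𝕜] A) (e' : I → B) (k : Option I) :
    ι (complIdem e' k) = complIdem (fun i => ι (e' i)) k := by
  cases k with
  | none => simp [complIdem]
  | some i => rfl

namespace IsConforming

variable {ι : B →ₐ[𝕜] A} {H : HeredityData A I} {h : HeredityData B I}
  (hc : IsConforming ι H h)
include hc

theorem map_X {i : I} {x : B} (hx : x ∈ h.X i) : ι x ∈ H.X i :=
  ((hc.X_eq i).subset ⟨x, hx, rfl⟩).1

theorem map_Y {i : I} {y : B} (hy : y ∈ h.Y i) : ι y ∈ H.Y i :=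
  ((hc.Y_eq i).subset ⟨y, hy, rfl⟩).1

theorem map_ideal {Ω : Set I} {u : B} (hu : u ∈ h.ideal Ω) : ι u ∈ H.ideal Ω := by
  have : h.ideal Ω ≤ (H.ideal Ω).comap ι.toLinearMap := by
    refine Submodule.span_le.2 ?_
    rintro _ ⟨i, hi, x, hx, y, hy, rfl⟩
    rw [SetLike.mem_coe, Submodule.mem_comap, AlgHom.toLinearMap_apply, map_mul]
    exact H.mul_mem_ideal hi (hc.map_X hx) (hc.map_Y hy)
  exact this hu

theorem map_span_sup {Z : Set B} {Z' : Set A} (hZ : ι '' Z ⊆ Z') {Ω : Set I} {u : B}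
    (hu : u ∈ Submodule.span 𝕜 Z ⊔ h.ideal Ω) : ι u ∈ Submodule.span 𝕜 Z' ⊔ H.ideal Ω := by
  obtain ⟨s, hs, t, ht, rfl⟩ := Submodule.mem_sup.1 hu
  rw [map_add]
  refine Submodule.add_mem_sup (Submodule.span_mono hZ ?_) (hc.map_ideal ht)
  have := Submodule.mem_map_of_mem (f := ι.toLinearMap) hs
  rwa [Submodule.map_span] at this

theorem isRefinement {e' : I → B} (hr : h.IsRefinement e') :
    H.IsRefinement fun i => ι (e' i) where
  mem_gr i := (hc.gr_iff _ _).1 (hr.mem_gr i)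
  idem i := by rw [← map_mul, hr.idem]
  e_mul i := by rw [← hc.e_eq, ← map_mul, hr.e_mul]
  mul_e i := by rw [← hc.e_eq, ← map_mul, hr.mul_e]
  sub_mem i := by
    rw [← hc.e_eq, ← map_sub]
    exact hc.map_ideal (hr.sub_mem i)

/-- Conforming heredity data with the initial elements of a refinement: the even elements are
chosen in the subalgebra, and the odd ones in `A`. -/
theorem exists_refinement [IsLocalRing 𝕜] [Fintype I] {e' : I → B} (hr : h.IsRefinement e') :
    ∃ (H' : HeredityData A I) (h' : HeredityData B I), IsConforming ι H' h' ∧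
      (∀ Ω, IsUpperSet Ω → H'.ideal Ω = H.ideal Ω ∧ h'.ideal Ω = h.ideal Ω) ∧ h'.e = e' := by
  have hR := hc.isRefinement hr
  choose TX hTX hTXf hTXc hTXs using fun i => hr.exists_X i (X₀ := h.X i) subset_rfl
    (fun a _ x hx => h.mul_X i x hx a)
  choose TY hTY hTYf hTYc hTYs using fun i => hr.exists_Y i (Y₀ := h.Y i) subset_rfl
    (fun a _ y hy => h.Y_mul i y hy a)
  have hodd : ∀ {Z : Set A} {d : Bideg} {x : A}, (∀ z ∈ Z, z ≠ 0 ∧ ∃ d, z ∈ A.gr d) →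
      x ∈ Z \ A.parity 0 → x ∈ A.gr d → Z ∩ A.gr d ⊆ Z \ A.parity 0 := by
    rintro Z d x hZ ⟨hx, hx0⟩ hxd z ⟨hz, hzd⟩
    refine ⟨hz, fun hz0 => (hZ z hz).1 ?_⟩
    exact GrSAlg.eq_zero_of_mem_gr_of_mem_parity hzd hz0
      fun hd => hx0 (hd ▸ GrSAlg.mem_parity_of_mem_gr hxd)
  choose UX hUX hUXf hUXc hUXs using fun i => hR.exists_X i (X₀ := H.X i \ A.parity 0)
    Set.sdiff_subset (by
      intro a ha x hx
      obtain ⟨-, d, hd⟩ := H.X_homog i x hx.1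
      have h1 : a * x ∈ A.gr d := by simpa using A.mul_mem ha hd
      have h2 := H.mem_span_gr_sup (fun x hx => (H.X_homog i x hx).2) h1 (H.mul_X i x hx.1 a)
      exact mem_span_sup_mono (hodd (H.X_homog i) hx hd) h2)
  choose UY hUY hUYf hUYc hUYs using fun i => hR.exists_Y i (Y₀ := H.Y i \ A.parity 0)
    Set.sdiff_subset (by
      intro a ha x hx
      obtain ⟨-, d, hd⟩ := H.Y_homog i x hx.1
      have h1 : x * a ∈ A.gr d := by simpa using A.mul_mem hd ha
      have h2 := H.mem_span_gr_sup (fun x hx => (H.Y_homog i x hx).2) h1 (H.Y_mul i x hx.1 a)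
      exact mem_span_sup_mono (hodd (H.Y_homog i) hx hd) h2)
  obtain ⟨h', hX, hY, he, hid⟩ := hr.exists_heredityData hTXf hTYf hTXc hTYc hTX hTY hTXs hTYs
  have hcard : ∀ {T Z : Set B} {U W : Set A}, W.Finite → ι '' Z = W ∩ A.parity 0 →
      T.ncard ≤ Z.ncard → U.ncard ≤ (W \ A.parity 0).ncard →
      (ι '' T ∪ U).ncard ≤ W.ncard := by
    intro T Z U W hW hZ hT hU
    refine (Set.ncard_union_le _ _).trans ?_
    rw [← Set.ncard_inter_add_ncard_sdiff_eq_ncard W (A.parity 0) hW, ← hZ,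
      Set.ncard_image_of_injective _ hc.injective, Set.ncard_image_of_injective _ hc.injective]
    exact Nat.add_le_add hT hU
  obtain ⟨H', hX', hY', he', hid'⟩ := hR.exists_heredityData
    (X' := fun i => ι '' TX i ∪ UX i) (Y' := fun i => ι '' TY i ∪ UY i)
    (fun i => ((hTXf i).image _).union (hUXf i)) (fun i => ((hTYf i).image _).union (hUYf i))
    (fun i => hcard (H.X_finite i) (hc.X_eq i) (hTXc i) (hUXc i))
    (fun i => hcard (H.Y_finite i) (hc.Y_eq i) (hTYc i) (hUYc i))
    (by
      rintro i _ (⟨z, hz, rfl⟩ | hz)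
      · obtain ⟨k, x, hx, rfl⟩ := hTX i hz
        exact ⟨k, ι x, hc.map_X hx, by rw [map_mul, map_mul, map_complIdem]⟩
      · obtain ⟨k, x, hx, rfl⟩ := hUX i hz
        exact ⟨k, x, hx.1, rfl⟩)
    (by
      rintro i _ (⟨z, hz, rfl⟩ | hz)
      · obtain ⟨k, x, hx, rfl⟩ := hTY i hz
        exact ⟨k, ι x, hc.map_Y hx, by rw [map_mul, map_mul, map_complIdem]⟩
      · obtain ⟨k, x, hx, rfl⟩ := hUY i hz
        exact ⟨k, x, hx.1, rfl⟩)
    (by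
      intro i x hx
      by_cases hx0 : x ∈ A.parity 0
      · obtain ⟨x, hx', rfl⟩ := (hc.X_eq i).superset ⟨hx, hx0⟩
        exact hc.map_span_sup Set.subset_union_left (hTXs i hx')
      · exact mem_span_sup_mono Set.subset_union_right (hUXs i ⟨hx, hx0⟩))
    (by
      intro i x hx
      by_cases hx0 : x ∈ A.parity 0
      · obtain ⟨x, hx', rfl⟩ := (hc.Y_eq i).superset ⟨hx, hx0⟩
        exact hc.map_span_sup Set.subset_union_left (hTYs i hx')
      · exact mem_span_sup_mono Set.subset_union_right (hUYs i ⟨hx, hx0⟩))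
  have hpar : ∀ {z : A} {d : Bideg}, z ≠ 0 → z ∈ A.gr d → d.2 ≠ 0 → z ∉ A.parity 0 :=
    fun hz hzd hd hz0 => hz (GrSAlg.eq_zero_of_mem_gr_of_mem_parity hzd hz0 hd)
  refine ⟨H', h', ⟨hc.injective, hc.gr_iff, hc.even, ?_, ?_, ?_⟩,
    fun Ω hΩ => ⟨hid' Ω hΩ, hid Ω hΩ⟩, he⟩
  · intro i
    rw [hX, hX']
    ext z
    constructor
    · rintro ⟨z, hz, rfl⟩
      exact ⟨Or.inl ⟨z, hz, rfl⟩, hc.even z⟩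
    · rintro ⟨hz | hz, hz0⟩
      · exact hz
      · have hz1 : z ≠ 0 := (H'.X_homog i z (by rw [hX']; exact Or.inr hz)).1
        obtain ⟨k, x, hx, rfl⟩ := hUX i hz
        obtain ⟨-, d, hd⟩ := H.X_homog i x hx.1
        refine absurd hz0 (hpar (d := d) hz1 ?_ fun h0 => hx.2 ?_)
        · simpa using A.mul_mem (A.mul_mem (hR.complIdem_mem k) hd) (hR.mem_gr i)
        · exact h0 ▸ GrSAlg.mem_parity_of_mem_gr hd
  · intro i
    rw [hY, hY']
    ext z
    constructor
    · rintro ⟨z, hz, rfl⟩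
      exact ⟨Or.inl ⟨z, hz, rfl⟩, hc.even z⟩
    · rintro ⟨hz | hz, hz0⟩
      · exact hz
      · have hz1 : z ≠ 0 := (H'.Y_homog i z (by rw [hY']; exact Or.inr hz)).1
        obtain ⟨k, x, hx, rfl⟩ := hUY i hz
        obtain ⟨-, d, hd⟩ := H.Y_homog i x hx.1
        refine absurd hz0 (hpar (d := d) hz1 ?_ fun h0 => hx.2 ?_)
        · simpa using A.mul_mem (A.mul_mem (hR.mem_gr i) hd) (hR.complIdem_mem k)
        · exact h0 ▸ GrSAlg.mem_parity_of_mem_gr hd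
  · intro i
    rw [he, he']

end IsConforming

end HeredityData

/-! ### Truncation of heredity data -/

namespace GrSAlg

variable {𝕜 : Type u} [CommRing 𝕜] (A : GrSAlg.{u, v} 𝕜) (f : A.HomIdem)

/-- The inclusion `fAf → A` as a linear map. -/
def cornerInc : A.corner f →ₗ[𝕜] A := cornerLin f.idem

/-- The projection `A → fAf`, `a ↦ f a f`. -/
def cornerProj : A →ₗ[𝕜] A.corner f where
  toFun a := ⟨f.val * a * f.val, a, rfl⟩
  map_add' a b := Subtype.ext (by
    change f.val * (a + b) * f.val = f.val * a * f.val + f.val * b * f.val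
    rw [mul_add, add_mul])
  map_smul' c a := Subtype.ext (by
    change f.val * (c • a) * f.val = c • (f.val * a * f.val)
    rw [mul_smul_comm, smul_mul_assoc])

variable {A f}

theorem cornerInc_injective : Function.Injective (A.cornerInc f) := Subtype.val_injective

theorem cornerInc_mul (a b : A.corner f) :
    A.cornerInc f (a * b) = A.cornerInc f a * A.cornerInc f b := rfl

theorem cornerInc_one : A.cornerInc f 1 = f.val := rfl

theorem cornerInc_proj (a : A) : A.cornerInc f (A.cornerProj f a) = f.val * a * f.val := rfl

theorem mem_corner_gr {d : Bideg} {c : A.corner f} :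
    c ∈ (A.corner f).gr d ↔ A.cornerInc f c ∈ A.gr d := Iff.rfl

theorem mul_cornerInc (c : A.corner f) : f.val * A.cornerInc f c = A.cornerInc f c :=
  corner_left f.idem c

theorem cornerInc_mul_idem (c : A.corner f) : A.cornerInc f c * f.val = A.cornerInc f c :=
  corner_right f.idem c

theorem cornerProj_inc (c : A.corner f) : A.cornerProj f (A.cornerInc f c) = c := by
  apply cornerInc_injective
  rw [cornerInc_proj, mul_cornerInc, cornerInc_mul_idem]

theorem cornerInc_proj_of_eq {a : A} (h1 : f.val * a = a) (h2 : a * f.val = a) :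
    A.cornerInc f (A.cornerProj f a) = a := by
  rw [cornerInc_proj, h1, h2]

theorem cornerProj_mem_gr {d : Bideg} {a : A} (ha : a ∈ A.gr d) :
    A.cornerProj f a ∈ (A.corner f).gr d := by
  rw [mem_corner_gr, cornerInc_proj]
  simpa using A.mul_mem (A.mul_mem f.mem ha) f.mem

theorem mem_corner_parity {ε : ZMod 2} {c : A.corner f} :
    c ∈ (A.corner f).parity ε ↔ A.cornerInc f c ∈ A.parity ε := by
  constructor
  · intro hc
    have : (A.corner f).parity ε ≤ (A.parity ε).comap (A.cornerInc f) :=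
      iSup_le fun n c hc => Submodule.mem_iSup_of_mem n hc
    exact this hc
  · intro hc
    have : A.parity ε ≤ ((A.corner f).parity ε).comap (A.cornerProj f) :=
      iSup_le fun n a ha => Submodule.mem_iSup_of_mem n (cornerProj_mem_gr ha)
    rw [← cornerProj_inc c]
    exact this hc

end GrSAlg

namespace HeredityData

open GrSAlg

variable {𝕜 : Type u} [CommRing 𝕜] {A : GrSAlg.{u, v} 𝕜} {I : Type*} [PartialOrder I]

/-- The sum of all initial elements is strongly adapted. -/
theorem isStronglyAdapted_sum [Nontrivial 𝕜] [Fintype I] (H : HeredityData A I) {f : A.HomIdem}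
    (hf : f.val = ∑ i, H.e i) :
    H.IsStronglyAdapted f ∧ H.IBar f = Set.univ ∧
      ∀ i, f.val * H.e i = H.e i ∧ H.e i * f.val = H.e i := by
  have he : ∀ i, f.val * H.e i = H.e i ∧ H.e i * f.val = H.e i := by
    intro i
    rw [hf, Finset.sum_mul, Finset.mul_sum, Finset.sum_eq_single_of_mem i (Finset.mem_univ i),
      Finset.sum_eq_single_of_mem i (Finset.mem_univ i), H.e_idem]
    · exact ⟨rfl, rfl⟩
    · exact fun j _ hj => H.e_mul_e_of_ne hj.symm
    · exact fun j _ hj => H.e_mul_e_of_ne hj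
  refine ⟨⟨fun i => ⟨fun x hx => ?_, fun y hy => ?_⟩, fun i _ => he i⟩, ?_, he⟩
  · by_cases h : ∃ j, H.e j * x = x
    · obtain ⟨j, hj⟩ := h
      left
      rw [← hj, ← mul_assoc, (he j).1]
    · push Not at h
      right
      rw [hf, Finset.sum_mul]
      exact Finset.sum_eq_zero fun j _ => (H.e_mul_X' i x hx j).resolve_left (h j)
  · by_cases h : ∃ j, y * H.e j = y
    · obtain ⟨j, hj⟩ := h
      left
      rw [← hj, mul_assoc, (he j).2]
    · push Not at h
      right
      rw [hf, Finset.mul_sum]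
      exact Finset.sum_eq_zero fun j _ => (H.Y_mul_e' i y hy j).resolve_left (h j)
  · rw [Set.eq_univ_iff_forall]
    exact fun i => ⟨⟨H.e i, H.e_mem_X i, (he i).1⟩, ⟨H.e i, H.e_mem_Y i, (he i).2⟩⟩

variable {H : HeredityData A I} {f : A.HomIdem}

theorem X_mul_idem (he : ∀ i, H.e i * f.val = H.e i) {i : I} {x : A} (hx : x ∈ H.X i) :
    x * f.val = x := by
  rw [← H.X_mul_e i x hx, mul_assoc, he]

theorem idem_mul_Y (he : ∀ i, f.val * H.e i = H.e i) {i : I} {y : A} (hy : y ∈ H.Y i) :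
    f.val * y = y := by
  rw [← H.e_mul_Y i y hy, ← mul_assoc, he]

theorem cornerProj_mem_prodSpan (ha : H.IsAdapted f) (he : ∀ i, H.e i * f.val = H.e i)
    {X Y : I → Set (A.corner f)}
    (hX : ∀ i, ∀ x ∈ H.XBar f i, A.cornerProj f x ∈ X i)
    (hY : ∀ i, ∀ y ∈ H.YBar f i, A.cornerProj f y ∈ Y i) {Ω : Set I} {u : A}
    (hu : u ∈ H.ideal Ω) : A.cornerProj f u ∈ prodSpan (A.corner f) X Y Ω := by
  have : H.ideal Ω ≤ (prodSpan (A.corner f) X Y Ω).comap (A.cornerProj f) := by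
    refine Submodule.span_le.2 ?_
    rintro _ ⟨i, hi, x, hx, y, hy, rfl⟩
    rw [SetLike.mem_coe, Submodule.mem_comap]
    have h0 : A.cornerInc f (A.cornerProj f (x * y)) = (f.val * x) * (y * f.val) := by
      rw [cornerInc_proj]
      simp only [mul_assoc]
    have hzero : (f.val * x) * (y * f.val) = 0 →
        A.cornerProj f (x * y) ∈ prodSpan (A.corner f) X Y Ω := by
      intro h
      have : A.cornerProj f (x * y) = 0 := by
        apply cornerInc_injective
        rw [h0, h, map_zero]
      rw [this]
      exact Submodule.zero_mem _
    rcases (ha i).1 x hx with h1 | h1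
    · rcases (ha i).2 y hy with h2 | h2
      · refine Submodule.subset_span ⟨i, hi, _, hX i x ⟨hx, h1⟩, _, hY i y ⟨hy, h2⟩, ?_⟩
        apply cornerInc_injective
        rw [h0, cornerInc_mul, cornerInc_proj, cornerInc_proj, h1, mul_assoc f.val y, h2,
          X_mul_idem he hx, ← mul_assoc, X_mul_idem he hx]
      · exact hzero (by rw [h2, mul_zero])
    · exact hzero (by rw [h1, zero_mul])
  exact this hu

/-- Truncation of heredity data at an adapted idempotent fixing all initial elements. -/
theorem exists_truncation (ha : H.IsAdapted f)
    (he : ∀ i, f.val * H.e i = H.e i ∧ H.e i * f.val = H.e i) :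
    ∃ K : HeredityData (A.corner f) I, H.IsTruncation f K := by
  let X : I → Set (A.corner f) := fun i => A.cornerInc f ⁻¹' H.XBar f i
  let Y : I → Set (A.corner f) := fun i => A.cornerInc f ⁻¹' H.YBar f i
  have hX : ∀ {i x}, x ∈ H.XBar f i → A.cornerInc f (A.cornerProj f x) = x := fun hx =>
    cornerInc_proj_of_eq hx.2 (X_mul_idem (fun i => (he i).2) hx.1)
  have hY : ∀ {i y}, y ∈ H.YBar f i → A.cornerInc f (A.cornerProj f y) = y := fun hy =>
    cornerInc_proj_of_eq (idem_mul_Y (fun i => (he i).1) hy.1) hy.2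
  have hE : ∀ i, A.cornerInc f (A.cornerProj f (H.e i)) = H.e i := fun i =>
    cornerInc_proj_of_eq (he i).1 (he i).2
  have hideal : ∀ Ω, ∀ u ∈ H.ideal Ω, A.cornerProj f u ∈ prodSpan (A.corner f) X Y Ω :=
    fun Ω u hu => cornerProj_mem_prodSpan ha (fun i => (he i).2)
      (fun i x hx => Set.mem_preimage.2 ((hX hx).symm ▸ hx))
      (fun i y hy => Set.mem_preimage.2 ((hY hy).symm ▸ hy)) hu
  have hspX : ∀ i, ∀ s ∈ Submodule.span 𝕜 (H.X i), A.cornerProj f s ∈ Submodule.span 𝕜 (X i) := by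
    intro i s hs
    have : Submodule.span 𝕜 (H.X i) ≤ (Submodule.span 𝕜 (X i)).comap (A.cornerProj f) := by
      refine Submodule.span_le.2 fun x hx => ?_
      rcases (ha i).1 x hx with h1 | h1
      · exact Submodule.subset_span (Set.mem_preimage.2 ((hX ⟨hx, h1⟩).symm ▸ ⟨hx, h1⟩))
      · have : A.cornerProj f x = 0 := by
          apply cornerInc_injective
          rw [cornerInc_proj, h1, zero_mul, map_zero]
        rw [SetLike.mem_coe, Submodule.mem_comap, this]
        exact Submodule.zero_mem _
    exact this hs
  have hspY : ∀ i, ∀ s ∈ Submodule.span 𝕜 (H.Y i), A.cornerProj f s ∈ Submodule.span 𝕜 (Y i) := by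
    intro i s hs
    have : Submodule.span 𝕜 (H.Y i) ≤ (Submodule.span 𝕜 (Y i)).comap (A.cornerProj f) := by
      refine Submodule.span_le.2 fun y hy => ?_
      rcases (ha i).2 y hy with h1 | h1
      · exact Submodule.subset_span (Set.mem_preimage.2 ((hY ⟨hy, h1⟩).symm ▸ ⟨hy, h1⟩))
      · have : A.cornerProj f y = 0 := by
          apply cornerInc_injective
          rw [cornerInc_proj, mul_assoc, h1, mul_zero, map_zero]
        rw [SetLike.mem_coe, Submodule.mem_comap, this]
        exact Submodule.zero_mem _
    exact this hs
  refine ⟨{ X := X, Y := Y, e := fun i => A.cornerProj f (H.e i),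
            X_finite := fun i => ((H.X_finite i).subset fun x hx => hx.1).preimage
              cornerInc_injective.injOn,
            Y_finite := fun i => ((H.Y_finite i).subset fun x hx => hx.1).preimage
              cornerInc_injective.injOn,
            X_homog := ?_, Y_homog := ?_, e_mem_X := ?_, e_mem_Y := ?_,
            linearIndependent := ?_, span_eq_top := ?_, mul_X := ?_, Y_mul := ?_,
            X_mul_e := ?_, e_mul_X := ?_, e_mul_Y := ?_,
            Y_mul_e := ?_, e_mul_X' := ?_, Y_mul_e' := ?_ }, ⟨?_, ?_, hE⟩⟩
  · intro i x hx
    obtain ⟨h0, d, hd⟩ := H.X_homog i _ hx.1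
    exact ⟨fun h => h0 (by rw [h, map_zero]), d, hd⟩
  · intro i y hy
    obtain ⟨h0, d, hd⟩ := H.Y_homog i _ hy.1
    exact ⟨fun h => h0 (by rw [h, map_zero]), d, hd⟩
  · exact fun i => Set.mem_preimage.2 ((hE i).symm ▸ ⟨H.e_mem_X i, (he i).1⟩)
  · exact fun i => Set.mem_preimage.2 ((hE i).symm ▸ ⟨H.e_mem_Y i, (he i).2⟩)
  · refine LinearIndependent.of_comp (A.cornerInc f) ?_
    refine H.linearIndependent.comp
      (fun z : (Σ i, X i × Y i) => (⟨z.1, ⟨A.cornerInc f z.2.1, z.2.1.2.1⟩,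
        ⟨A.cornerInc f z.2.2, z.2.2.2.1⟩⟩ : Σ i, H.X i × H.Y i)) ?_
    rintro ⟨i, x, y⟩ ⟨j, x', y'⟩ hxy
    obtain rfl : i = j := congrArg Sigma.fst hxy
    simp only [Sigma.mk.injEq, heq_eq_eq, true_and, Prod.mk.injEq, Subtype.mk.injEq] at hxy
    rw [Subtype.ext (cornerInc_injective hxy.1), Subtype.ext (cornerInc_injective hxy.2)]
  · rw [eq_top_iff]
    intro c _
    rw [← cornerProj_inc c]
    exact hideal _ _ (by rw [ideal, H.span_eq_top]; trivial)
  · intro i x hx c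
    obtain ⟨s, hs, t, ht, hst⟩ := Submodule.mem_sup.1 (H.mul_X i _ hx.1 (A.cornerInc f c))
    have : c * x = A.cornerProj f s + A.cornerProj f t := by
      rw [← map_add, hst, ← cornerInc_mul, cornerProj_inc]
    rw [this]
    exact Submodule.add_mem_sup (hspX i s hs) (hideal _ t ht)
  · intro i y hy c
    obtain ⟨s, hs, t, ht, hst⟩ := Submodule.mem_sup.1 (H.Y_mul i _ hy.1 (A.cornerInc f c))
    have : y * c = A.cornerProj f s + A.cornerProj f t := by
      rw [← map_add, hst, ← cornerInc_mul, cornerProj_inc]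
    rw [this]
    exact Submodule.add_mem_sup (hspY i s hs) (hideal _ t ht)
  · intro i x hx
    apply cornerInc_injective
    rw [cornerInc_mul, hE, H.X_mul_e i _ hx.1]
  · intro i x hx hne
    apply cornerInc_injective
    rw [cornerInc_mul, hE, H.e_mul_X i _ hx.1, map_zero]
    rw [← hE]
    exact fun h => hne (cornerInc_injective h)
  · intro i y hy
    apply cornerInc_injective
    rw [cornerInc_mul, hE, H.e_mul_Y i _ hy.1]
  · intro i y hy hne
    apply cornerInc_injective
    rw [cornerInc_mul, hE, H.Y_mul_e i _ hy.1, map_zero]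
    rw [← hE]
    exact fun h => hne (cornerInc_injective h)
  · intro i x hx j
    refine (H.e_mul_X' i _ hx.1 j).imp (fun h => ?_) fun h => ?_
    · apply cornerInc_injective
      rw [cornerInc_mul, hE, h]
    · apply cornerInc_injective
      rw [cornerInc_mul, hE, h, map_zero]
  · intro i y hy j
    refine (H.Y_mul_e' i _ hy.1 j).imp (fun h => ?_) fun h => ?_
    · apply cornerInc_injective
      rw [cornerInc_mul, hE, h]
    · apply cornerInc_injective
      rw [cornerInc_mul, hE, h, map_zero]
  · exact fun i => Set.image_preimage_eq_of_subset fun x hx => ⟨_, hX hx⟩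
  · exact fun i => Set.image_preimage_eq_of_subset fun y hy => ⟨_, hY hy⟩

namespace IsTruncation

variable {K : HeredityData (A.corner f) I} (hK : H.IsTruncation f K)
include hK

theorem mem_X {i : I} {x : A.corner f} : x ∈ K.X i ↔ A.cornerInc f x ∈ H.XBar f i := by
  rw [← hK.X_eq]
  exact (cornerInc_injective.mem_set_image (f := A.cornerInc f)).symm

theorem mem_Y {i : I} {y : A.corner f} : y ∈ K.Y i ↔ A.cornerInc f y ∈ H.YBar f i := by
  rw [← hK.Y_eq]
  exact (cornerInc_injective.mem_set_image (f := A.cornerInc f)).symm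

theorem inc_e (i : I) : A.cornerInc f (K.e i) = H.e i := hK.e_eq i

theorem e_mul_idem (i : I) : H.e i * f.val = H.e i := by
  rw [← hK.inc_e, cornerInc_mul_idem]

theorem mem_ideal_iff (ha : H.IsAdapted f) {Ω : Set I} {c : A.corner f} :
    c ∈ K.ideal Ω ↔ A.cornerInc f c ∈ H.ideal Ω := by
  constructor
  · intro hc
    have : K.ideal Ω ≤ (H.ideal Ω).comap (A.cornerInc f) := by
      refine Submodule.span_le.2 ?_
      rintro _ ⟨i, hi, x, hx, y, hy, rfl⟩
      exact H.mul_mem_ideal hi (hK.mem_X.1 hx).1 (hK.mem_Y.1 hy).1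
    exact this hc
  · intro hc
    rw [← cornerProj_inc c]
    refine cornerProj_mem_prodSpan ha hK.e_mul_idem (fun i x hx => ?_) (fun i y hy => ?_) hc
    · obtain ⟨x', hx', rfl⟩ := (hK.X_eq i).superset hx
      exact (cornerProj_inc x').symm ▸ hx'
    · obtain ⟨y', hy', rfl⟩ := (hK.Y_eq i).superset hy
      exact (cornerProj_inc y').symm ▸ hy'

end IsTruncation

/-- Truncations of conforming heredity data are conforming. -/
theorem IsConforming.truncation {𝔞 : Subalgebra 𝕜 A}
    {h𝔞 : IsHomogSub A.gr (Subalgebra.toSubmodule 𝔞)} {h : HeredityData (A.sub 𝔞 h𝔞) I}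
    (hc : IsConforming (A.subIncl 𝔞 h𝔞) H h) {f : (A.sub 𝔞 h𝔞).HomIdem}
    {K : HeredityData (A.corner (f.ofSub A 𝔞 h𝔞)) I} {k : HeredityData ((A.sub 𝔞 h𝔞).corner f) I}
    (hK : H.IsTruncation (f.ofSub A 𝔞 h𝔞) K) (hk : h.IsTruncation f k) :
    IsConforming (A.cornerSubIncl 𝔞 h𝔞 f) K k := by
  have hval : ∀ c, A.cornerInc (f.ofSub A 𝔞 h𝔞) (A.cornerSubIncl 𝔞 h𝔞 f c) =
      A.subIncl 𝔞 h𝔞 ((A.sub 𝔞 h𝔞).cornerInc f c) := fun _ => rfl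
  refine ⟨?_, ?_, ?_, ?_, ?_, ?_⟩
  · intro c c' h
    have := congrArg (A.cornerInc (f.ofSub A 𝔞 h𝔞)) h
    rw [hval, hval] at this
    exact cornerInc_injective (hc.injective this)
  · intro d c
    rw [mem_corner_gr, mem_corner_gr, hval]
    exact hc.gr_iff _ _
  · intro c
    rw [mem_corner_parity, hval]
    exact hc.even _
  · intro i
    ext x
    constructor
    · rintro ⟨c, hx, rfl⟩
      refine ⟨hK.mem_X.2 ?_, ?_⟩
      · rw [hval]
        obtain ⟨h1, h2⟩ := hk.mem_X.1 hx
        exact ⟨hc.map_X h1, congrArg (A.subIncl 𝔞 h𝔞) h2⟩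
      · rw [SetLike.mem_coe, mem_corner_parity, hval]
        exact hc.even _
    · rintro ⟨hx, hx0⟩
      obtain ⟨h1, h2⟩ := hK.mem_X.1 hx
      obtain ⟨z, hz, hzx⟩ := (hc.X_eq i).superset ⟨h1, mem_corner_parity.1 hx0⟩
      have hz2 : z ∈ h.XBar f i := by
        refine ⟨hz, hc.injective ?_⟩
        rw [map_mul, hzx]
        exact h2
      obtain ⟨c, hc', rfl⟩ := (hk.X_eq i).superset hz2
      exact ⟨c, hc', cornerInc_injective hzx⟩
  · intro i
    ext x
    constructor
    · rintro ⟨c, hx, rfl⟩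
      refine ⟨hK.mem_Y.2 ?_, ?_⟩
      · rw [hval]
        obtain ⟨h1, h2⟩ := hk.mem_Y.1 hx
        exact ⟨hc.map_Y h1, congrArg (A.subIncl 𝔞 h𝔞) h2⟩
      · rw [SetLike.mem_coe, mem_corner_parity, hval]
        exact hc.even _
    · rintro ⟨hx, hx0⟩
      obtain ⟨h1, h2⟩ := hK.mem_Y.1 hx
      obtain ⟨z, hz, hzx⟩ := (hc.Y_eq i).superset ⟨h1, mem_corner_parity.1 hx0⟩
      have hz2 : z ∈ h.YBar f i := by
        refine ⟨hz, hc.injective ?_⟩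
        rw [map_mul, hzx]
        exact h2
      obtain ⟨c, hc', rfl⟩ := (hk.Y_eq i).superset hz2
      exact ⟨c, hc', cornerInc_injective hzx⟩
  · intro i
    apply cornerInc_injective
    rw [hval, hk.inc_e, hK.inc_e, hc.e_eq]

end HeredityData

/-! ### Cyclic graded modules -/

namespace GrMod

variable {𝕜 : Type u} [CommRing 𝕜] {A : GrSAlg.{u, v} 𝕜}

theorem homogComp_smul_of_mem (V : GrMod A) {v : V} (hv : v ∈ V.gr 0) (a : A) (d : Bideg) :
    homogComp V.internal d (a • v) = homogComp A.internal d a • v := by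
  have ha : a ∈ ⨆ d, A.gr d := by simp [A.internal.submodule_iSup_eq_top]
  refine Submodule.iSup_induction A.gr
    (motive := fun a => homogComp V.internal d (a • v) = homogComp A.internal d a • v)
    ha ?_ (by simp) ?_
  · intro d' x hx
    have := V.smul_mem hx hv
    rw [add_zero] at this
    rw [homogComp_of_mem _ this, homogComp_of_mem _ hx]
    split_ifs <;> simp
  · intro x y hx hy
    rw [add_smul, map_add, map_add, add_smul, hx, hy]

theorem exists_hom_of_cyclic {V W : GrMod A} {v : V} {w : W} (hv : v ∈ V.gr 0) (hw : w ∈ W.gr 0)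
    (hV : ∀ x : V, ∃ a : A, x = a • v) (h : ∀ a : A, a • v = 0 → a • w = 0) :
    ∃ g : V ⟶ W, ∀ a : A, Hom.toLin g (a • v) = a • w := by
  have hwd : ∀ a b : A, a • v = b • v → a • w = b • w := by
    intro a b hab
    have := h (a - b) (by rw [sub_smul, hab, sub_self])
    rwa [sub_smul, sub_eq_zero] at this
  choose r hr using hV
  have hg : ∀ a : A, r (a • v) • w = a • w := fun a => hwd _ _ (hr _).symm
  let g : V →ₗ[A] W :=
    { toFun := fun x => r x • w
      map_add' := fun x y => by
        rw [← add_smul]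
        apply hwd
        rw [← hr, add_smul, ← hr, ← hr]
      map_smul' := fun a x => by
        rw [RingHom.id_apply, smul_smul]
        apply hwd
        rw [← hr, mul_smul, ← hr] }
  refine ⟨⟨g, fun d x hx => ?_⟩, hg⟩
  have h1 : x = homogComp A.internal d (r x) • v := by
    rw [← homogComp_smul_of_mem V hv, ← hr, homogComp_of_mem _ hx, if_pos rfl]
  rw [h1]
  change r _ • w ∈ _
  rw [hg]
  simpa using W.smul_mem (homogComp_mem A.internal d (r x)) hw

/-- Graded modules generated by elements of degree zero with the same annihilator are
isomorphic. -/
theorem nonempty_iso_of_cyclic {V W : GrMod A} {v : V} {w : W} (hv : v ∈ V.gr 0)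
    (hw : w ∈ W.gr 0) (hV : ∀ x : V, ∃ a : A, x = a • v) (hW : ∀ x : W, ∃ a : A, x = a • w)
    (h : ∀ a : A, a • v = 0 ↔ a • w = 0) : Nonempty (V ≅ W) := by
  obtain ⟨g, hg⟩ := exists_hom_of_cyclic hv hw hV fun a => (h a).1
  obtain ⟨g', hg'⟩ := exists_hom_of_cyclic hw hv hW fun a => (h a).2
  refine ⟨⟨g, g', ?_, ?_⟩⟩
  · refine Hom.ext (LinearMap.ext fun x => ?_)
    obtain ⟨a, rfl⟩ := hV x
    exact (congrArg (Hom.toLin g') (hg a)).trans (hg' a)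
  · refine Hom.ext (LinearMap.ext fun x => ?_)
    obtain ⟨a, rfl⟩ := hW x
    exact (congrArg (Hom.toLin g) (hg' a)).trans (hg a)

theorem nonempty_truncObj_iso_of_cyclic (hA : Module.Finite 𝕜 A) {f : A.HomIdem} {V : GrMod A}
    {v : V} (hv : v ∈ V.gr 0) (hV : ∀ x : V, ∃ a : A, x = a • v) (hfv : f.val • v = v)
    {W : GrMod (A.corner f)} {w : W} (hw : w ∈ W.gr 0)
    (hW : ∀ x : W, ∃ c : A.corner f, x = c • w)
    (h : ∀ c : A.corner f, A.cornerInc f c • v = 0 ↔ c • w = 0) :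
    Nonempty ((truncFunctor hA f).obj V ≅ W) := by
  let v' : truncObj hA f V := (⟨v, v, hfv.symm⟩ : truncSub f V)
  refine nonempty_iso_of_cyclic (V := truncObj hA f V) (v := v') hv hw ?_ hW fun c => ?_
  · rintro ⟨_, x, rfl⟩
    obtain ⟨a, rfl⟩ := hV x
    refine ⟨A.cornerProj f a, Subtype.ext ?_⟩
    change f.val • a • v = (f.val * a * f.val) • v
    rw [mul_smul, mul_smul, hfv]
  · rw [← h]
    exact Subtype.ext_iff

end GrMod

/-! ### Standard and simple modules -/

namespace HeredityData

open GrSAlg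

variable {𝕜 : Type u} [CommRing 𝕜] {A : GrSAlg.{u, v} 𝕜} {I : Type*} [PartialOrder I]
  [Finite I] (H : HeredityData A I)

/-- The canonical generator of the standard module `Δ(i)`. -/
def gen (i : I) : H.standard i :=
  (⟨H.cls i (H.e i), Submodule.mem_span_singleton_self _⟩ : Submodule.span A {H.cls i (H.e i)})

theorem gen_mem_gr (i : I) : H.gen i ∈ (H.standard i).gr 0 := H.cls_e_mem i

theorem exists_smul_gen (i : I) (v : H.standard i) : ∃ a : A, v = a • H.gen i := by
  obtain ⟨v, hv⟩ := v
  obtain ⟨a, rfl⟩ := Submodule.mem_span_singleton.1 hv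
  exact ⟨a, rfl⟩

theorem cls_eq_zero {i : I} {a : A} : H.cls i a = 0 ↔ a ∈ H.ideal (Set.Ioi i) :=
  Submodule.Quotient.mk_eq_zero _

theorem smul_gen_eq_zero {i : I} {a : A} :
    a • H.gen i = 0 ↔ a * H.e i ∈ H.ideal (Set.Ioi i) := by
  rw [← cls_eq_zero]
  exact Subtype.ext_iff

theorem pairs_smul_gen {i : I} {a b : A} {c : 𝕜} :
    H.Pairs i (a • H.gen i) b c ↔
      H.e i * (b * a) * H.e i - c • H.e i ∈ H.ideal (Set.Ioi i) := by
  have h1 : H.cls i (H.e i * (b * a) * H.e i - c • H.e i) =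
      (H.e i * b) • H.standardIncl i (a • H.gen i) - c • H.cls i (H.e i) := by
    rw [show H.e i * (b * a) * H.e i = H.e i * b * (a * H.e i) by simp only [mul_assoc]]
    rfl
  rw [← cls_eq_zero, h1, sub_eq_zero, Pairs]

theorem smul_gen_mem_radMod {J : Ideal 𝕜} {i : I} {a : A} : a • H.gen i ∈ H.radMod J i ↔
    ∀ b : A, ∃ c ∈ J, H.e i * (b * a) * H.e i - c • H.e i ∈ H.ideal (Set.Ioi i) :=
  forall_congr' fun _ => exists_congr fun _ => and_congr_right fun _ => H.pairs_smul_gen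

variable [IsLocalRing 𝕜]

/-- The canonical generator of the simple module `L(i)`. -/
def simpleGen (i : I) : H.simple i :=
  (H.radMod (IsLocalRing.maximalIdeal 𝕜) i).mkQ (H.gen i)

theorem simpleGen_mem_gr (i : I) : H.simpleGen i ∈ (H.simple i).gr 0 :=
  ⟨H.gen i, H.gen_mem_gr i, rfl⟩

theorem exists_smul_simpleGen (i : I) (v : H.simple i) : ∃ a : A, v = a • H.simpleGen i := by
  obtain ⟨v, rfl⟩ := (H.radMod (IsLocalRing.maximalIdeal 𝕜) i).mkQ_surjective v
  obtain ⟨a, rfl⟩ := H.exists_smul_gen i v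
  exact ⟨a, map_smul _ _ _⟩

theorem smul_simpleGen_eq_zero_iff_mem {i : I} {a : A} :
    a • H.simpleGen i = 0 ↔ a • H.gen i ∈ H.radMod (IsLocalRing.maximalIdeal 𝕜) i :=
  Submodule.Quotient.mk_eq_zero _

theorem smul_simpleGen_eq_zero {i : I} {a : A} : a • H.simpleGen i = 0 ↔
    ∀ b : A, ∃ c ∈ IsLocalRing.maximalIdeal 𝕜,
      H.e i * (b * a) * H.e i - c • H.e i ∈ H.ideal (Set.Ioi i) :=
  H.smul_simpleGen_eq_zero_iff_mem.trans H.smul_gen_mem_radMod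

theorem smul_simpleGen_of_mem {i : I} {a : A} (ha : a * H.e i ∈ H.ideal (Set.Ioi i)) :
    a • H.simpleGen i = 0 := by
  rw [smul_simpleGen_eq_zero_iff_mem, H.smul_gen_eq_zero.2 ha]
  exact Submodule.zero_mem _

theorem e_smul_simpleGen (i : I) : H.e i • H.simpleGen i = H.simpleGen i := by
  have h := H.smul_simpleGen_of_mem (i := i) (a := H.e i - 1)
    (by rw [sub_mul, one_mul, H.e_idem, sub_self]; exact Submodule.zero_mem _)
  rwa [sub_smul, one_smul, sub_eq_zero] at h

theorem smul_simpleGen_of_sub_mem {i : I} {a : A} {c : 𝕜}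
    (h : a * H.e i - c • H.e i ∈ H.ideal (Set.Ioi i)) :
    a • H.simpleGen i = c • H.simpleGen i := by
  have h1 := H.smul_simpleGen_of_mem (i := i) (a := a - c • 1) (by
    rwa [sub_mul, smul_mul_assoc, one_mul])
  rwa [sub_smul, smul_assoc, one_smul, sub_eq_zero] at h1

theorem base_smul_simpleGen_eq_zero {i : I} {c : 𝕜} :
    c • H.simpleGen i = 0 ↔ c ∈ IsLocalRing.maximalIdeal 𝕜 := by
  rw [← one_smul A (H.simpleGen i), ← smul_assoc, smul_simpleGen_eq_zero]
  constructor
  · intro h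
    obtain ⟨r, hr, h⟩ := h 1
    rw [one_mul, mul_smul_comm, mul_one, smul_mul_assoc, H.e_idem, ← sub_smul] at h
    have := H.eq_zero_of_smul_e_mem (by simp) h
    rwa [sub_eq_zero.1 this]
  · intro hc b
    obtain ⟨r, hr⟩ := H.exists_coeff i b
    refine ⟨c * r, Ideal.mul_mem_right _ _ hc, ?_⟩
    have := Submodule.smul_mem _ c hr
    rwa [smul_sub, smul_smul, ← smul_mul_assoc, ← mul_smul_comm, ← mul_one b,
      ← mul_smul_comm] at this

/-- `L(i)` is a simple graded supermodule: a non-zero vector pairs to a unit with some element of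
`Δᵒᵖ(i)`, hence generates. -/
theorem isGrSimple_simple (i : I) : (H.simple i).IsGrSimple := by
  refine ⟨⟨H.simpleGen i, 0, fun h => ?_⟩, fun W _ => ?_⟩
  · have := H.base_smul_simpleGen_eq_zero.1 (show (1 : 𝕜) • H.simpleGen i = 0 by rw [h, smul_zero])
    exact (Ideal.ne_top_iff_one _).1 (IsLocalRing.maximalIdeal.isMaximal 𝕜).ne_top this
  · rw [or_iff_not_imp_left, Submodule.eq_bot_iff]
    intro hW
    push Not at hW
    obtain ⟨w, hwW, hw0⟩ := hW
    obtain ⟨a, rfl⟩ := H.exists_smul_simpleGen i w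
    rw [Ne, smul_simpleGen_eq_zero] at hw0
    push Not at hw0
    obtain ⟨b, hb⟩ := hw0
    obtain ⟨c, hc⟩ := H.exists_coeff i (b * a)
    have hcu : IsUnit c := by
      by_contra h
      exact hb c h hc
    obtain ⟨c, rfl⟩ := hcu
    have h1 : (H.e i * (b * a)) • H.simpleGen i = (c : 𝕜) • H.simpleGen i :=
      H.smul_simpleGen_of_sub_mem hc
    have h2 : H.simpleGen i ∈ W := by
      have h3 := W.smul_mem (H.e i * b) hwW
      rw [smul_smul, mul_assoc, h1, ← one_smul A (H.simpleGen i), ← smul_assoc] at h3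
      have h4 := W.smul_mem ((↑c⁻¹ : 𝕜) • (1 : A)) h3
      rwa [smul_smul, smul_mul_smul_comm, Units.inv_mul, mul_one, one_smul, one_smul] at h4
    rw [eq_top_iff]
    intro v _
    obtain ⟨a, rfl⟩ := H.exists_smul_simpleGen i v
    exact W.smul_mem a h2

/-- If the elements of `X(i)` other than `e_i` lie in the radical of the pairing, then each `L(i)`
is one-dimensional. -/
theorem isBasic_of_smul_simpleGen
    (h : ∀ i, ∀ x ∈ H.X i, x ≠ H.e i → x • H.simpleGen i = 0) : H.IsBasic := by
  intro i
  let φ : 𝕜 →ₗ[𝕜] H.simple i := LinearMap.toSpanSingleton 𝕜 _ (H.simpleGen i)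
  have hker : LinearMap.ker φ = IsLocalRing.maximalIdeal 𝕜 := by
    ext c
    rw [LinearMap.mem_ker, LinearMap.toSpanSingleton_apply]
    exact H.base_smul_simpleGen_eq_zero
  have hsurj : Function.Surjective φ := by
    intro v
    obtain ⟨a, rfl⟩ := H.exists_smul_simpleGen i v
    obtain ⟨s, hs, t, ht, hst⟩ := Submodule.mem_sup.1 (H.mul_X i _ (H.e_mem_X i) a)
    have h1 : a • H.simpleGen i = s • H.simpleGen i := by
      have h2 : t • H.simpleGen i = 0 := H.smul_simpleGen_of_mem (H.ideal_Ioi i t ht _).2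
      rw [← H.e_smul_simpleGen, smul_smul, ← hst, add_smul, h2, add_zero, H.e_smul_simpleGen]
    rw [h1]
    refine Submodule.span_induction (p := fun s _ => ∃ c : 𝕜, φ c = s • H.simpleGen i)
      ?_ ⟨0, by simp⟩ ?_ ?_ hs
    · intro x hx
      by_cases hxe : x = H.e i
      · exact ⟨1, by rw [hxe, H.e_smul_simpleGen, LinearMap.toSpanSingleton_apply, one_smul]⟩
      · exact ⟨0, by rw [h i x hx hxe, map_zero]⟩
    · rintro x y _ _ ⟨c, hc⟩ ⟨c', hc'⟩
      exact ⟨c + c', by rw [map_add, hc, hc', add_smul]⟩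
    · rintro r x _ ⟨c, hc⟩
      exact ⟨r • c, by rw [map_smul, hc, smul_assoc]⟩
  exact ⟨((Submodule.quotEquivOfEq _ _ hker).symm.trans
    (φ.quotKerEquivOfSurjective hsurj)).symm⟩

variable {H}

omit [IsLocalRing 𝕜] in
/-- Replacing `e_i` by a congruent idempotent does not change coefficients modulo `A^{>i}`. -/
theorem coeff_congr {i : I} {e : A} (h : e - H.e i ∈ H.ideal (Set.Ioi i)) (z : A) (c : 𝕜) :
    H.e i * z * H.e i - c • H.e i ∈ H.ideal (Set.Ioi i) ↔
      e * z * e - c • e ∈ H.ideal (Set.Ioi i) := by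
  have hup := isUpperSet_Ioi i
  have h1 : e * z * e - H.e i * z * H.e i ∈ H.ideal (Set.Ioi i) := by
    have h2 := Submodule.add_mem _ (H.ideal_mul_right hup h (z * e))
      (H.ideal_mul_left hup h (H.e i * z))
    convert h2 using 1
    simp only [mul_sub, sub_mul, mul_assoc]
    abel
  have h3 := Submodule.sub_mem _ h1 (Submodule.smul_mem _ c h)
  have h4 : e * z * e - H.e i * z * H.e i - c • (e - H.e i) =
      (e * z * e - c • e) - (H.e i * z * H.e i - c • H.e i) := by
    rw [smul_sub]
    abel
  rw [h4] at h3
  constructor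
  · intro h5
    have := Submodule.add_mem _ h3 h5
    rwa [sub_add_cancel] at this
  · intro h5
    have := Submodule.sub_mem _ h5 h3
    rwa [sub_sub_cancel] at this

/-- Heads are killed independently of the heredity data, as long as the ideals agree and the
initial elements are congruent. -/
theorem KillsHead.congr {H' : HeredityData A I} {u : A} {i : I} (h : H.KillsHead u i)
    (hid : H'.ideal (Set.Ioi i) = H.ideal (Set.Ioi i))
    (he : H'.e i - H.e i ∈ H.ideal (Set.Ioi i)) : H'.KillsHead u i := by
  intro a b
  obtain ⟨c, hc, h1⟩ := h a b
  refine ⟨c, hc, ?_⟩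
  rw [hid]
  exact (coeff_congr he _ _).1 h1

/-- If odd elements act by zero on simple graded supermodules, then the condition to kill a head
can be checked in a conforming subalgebra. -/
theorem IsConforming.killsHead {B : GrSAlg.{u, v} 𝕜} {ι : B →ₐ[𝕜] A} {h : HeredityData B I}
    (hc : IsConforming ι H h) (hJ : (A.parity 1 : Set A) ⊆ A.jacobson) {u : B} {i : I}
    (hu : h.KillsHead u i) : H.KillsHead (ι u) i := by
  have hodd : ∀ {d : Bideg} {a : A}, a ∈ A.gr d → d.2 ≠ 0 → ∀ v : H.simple i, a • v = 0 := by
    intro d a ha hd v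
    have hd1 : d.2 = 1 := by
      revert hd
      generalize d.2 = ε
      revert ε
      decide
    exact hJ (hd1 ▸ GrSAlg.mem_parity_of_mem_gr ha) _ (H.isGrSimple_simple i) v
  have hup := isUpperSet_Ioi i
  refine H.killsHead_of_homog fun d d' a ha b hb => ?_
  obtain ⟨c, hcz⟩ := H.exists_coeff i (b * ι u * a)
  have hzero : (H.e i * (b * ι u * a)) • H.simpleGen i = 0 → ∃ c ∈ IsLocalRing.maximalIdeal 𝕜,
      H.e i * (b * ι u * a) * H.e i - c • H.e i ∈ H.ideal (Set.Ioi i) := by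
    intro h0
    refine ⟨c, ?_, hcz⟩
    rwa [H.smul_simpleGen_of_sub_mem hcz, H.base_smul_simpleGen_eq_zero] at h0
  by_cases hd : d.2 ≠ 0
  · refine hzero ?_
    rw [mul_smul, mul_smul, hodd ha hd, smul_zero, smul_zero]
  by_cases hd' : d'.2 ≠ 0
  · refine hzero ?_
    rw [mul_smul, mul_smul, mul_smul, hodd hb hd', smul_zero]
  push Not at hd hd'
  -- modulo `A^{>i}`, the even elements `a e_i` and `e_i b` come from the subalgebra
  obtain ⟨a', ha'⟩ : ∃ a' : B, a * H.e i - ι a' ∈ H.ideal (Set.Ioi i) := by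
    have h1 : a * H.e i ∈ A.gr d := by simpa using A.mul_mem ha (H.e_gr i)
    obtain ⟨s, hs, t, ht, hst⟩ := Submodule.mem_sup.1
      (H.mem_span_gr_sup (fun x hx => (H.X_homog i x hx).2) h1 (H.mul_X i _ (H.e_mem_X i) a))
    have h2 : Submodule.span 𝕜 (H.X i ∩ A.gr d) ≤ LinearMap.range ι.toLinearMap := by
      refine Submodule.span_le.2 fun x hx => ?_
      obtain ⟨x', -, rfl⟩ := (hc.X_eq i).superset
        ⟨hx.1, hd ▸ GrSAlg.mem_parity_of_mem_gr hx.2⟩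
      exact ⟨x', rfl⟩
    obtain ⟨s', rfl⟩ := h2 hs
    refine ⟨s', ?_⟩
    rw [← hst, AlgHom.toLinearMap_apply, add_sub_cancel_left]
    exact ht
  obtain ⟨b', hb'⟩ : ∃ b' : B, H.e i * b - ι b' ∈ H.ideal (Set.Ioi i) := by
    have h1 : H.e i * b ∈ A.gr d' := by simpa using A.mul_mem (H.e_gr i) hb
    obtain ⟨s, hs, t, ht, hst⟩ := Submodule.mem_sup.1
      (H.mem_span_gr_sup (fun x hx => (H.Y_homog i x hx).2) h1 (H.Y_mul i _ (H.e_mem_Y i) b))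
    have h2 : Submodule.span 𝕜 (H.Y i ∩ A.gr d') ≤ LinearMap.range ι.toLinearMap := by
      refine Submodule.span_le.2 fun x hx => ?_
      obtain ⟨x', -, rfl⟩ := (hc.Y_eq i).superset
        ⟨hx.1, hd' ▸ GrSAlg.mem_parity_of_mem_gr hx.2⟩
      exact ⟨x', rfl⟩
    obtain ⟨s', rfl⟩ := h2 hs
    refine ⟨s', ?_⟩
    rw [← hst, AlgHom.toLinearMap_apply, add_sub_cancel_left]
    exact ht
  obtain ⟨r, hr, h1⟩ := hu a' b'
  refine ⟨r, hr, ?_⟩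
  have h2 := hc.map_ideal h1
  simp only [map_sub, map_mul, map_smul, hc.e_eq] at h2
  have h3 := H.ideal_mul_right hup (H.ideal_mul_left hup hb' (H.e i)) (ι u * (a * H.e i))
  have h4 := H.ideal_mul_right hup (H.ideal_mul_left hup ha' (H.e i * ι b' * ι u)) (H.e i)
  convert Submodule.add_mem _ h2 (Submodule.add_mem _ h3 h4) using 1
  have h5 : ∀ z, H.e i * (H.e i * z) = H.e i * z := fun z => by rw [← mul_assoc, H.e_idem]
  simp only [mul_sub, sub_mul, mul_assoc, h5, H.e_idem]
  abel

section Truncation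

variable {f : A.HomIdem} {K : HeredityData (A.corner f) I}

omit [Finite I] [IsLocalRing 𝕜] in
theorem exists_e_mul_eq [Fintype I] (hf : f.val = ∑ i, H.e i) {i : I} {x : A}
    (hx : x ∈ H.XBar f i) : ∃ j, H.e j * x = x := by
  by_contra! h
  refine (H.X_homog i x hx.1).1 ?_
  rw [← hx.2, hf, Finset.sum_mul]
  exact Finset.sum_eq_zero fun j _ => (H.e_mul_X' i x hx.1 j).resolve_left (h j)

/-- The truncation by `f = ∑ e_i` is basic if `e_j` kills `L(i)` for `i ≠ j`. -/
theorem IsTruncation.isBasic [Fintype I] (hK : H.IsTruncation f K) (ha : H.IsAdapted f)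
    (hf : f.val = ∑ i, H.e i) (hk : ∀ i j, j ≠ i → H.KillsHead (H.e j) i) : K.IsBasic := by
  refine K.isBasic_of_smul_simpleGen fun i x hx hne => ?_
  rw [smul_simpleGen_eq_zero]
  intro b
  have hxb := hK.mem_X.1 hx
  obtain ⟨j, hj⟩ := exists_e_mul_eq hf hxb
  have hji : j ≠ i := by
    rintro rfl
    have hne' : A.cornerInc f x ≠ H.e j := by
      rw [← hK.inc_e]
      exact fun h => hne (cornerInc_injective h)
    rw [H.e_mul_X j _ hxb.1 hne'] at hj
    exact (H.X_homog j _ hxb.1).1 hj.symm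
  obtain ⟨c, hc, h⟩ := hk i j hji (A.cornerInc f x) (A.cornerInc f b)
  refine ⟨c, hc, ?_⟩
  rw [hK.mem_ideal_iff ha, map_sub, map_smul, cornerInc_mul, cornerInc_mul, cornerInc_mul,
    hK.inc_e]
  rwa [mul_assoc _ _ (A.cornerInc f x), hj] at h

variable (hA : Module.Finite 𝕜 A) {i : I}
  (hid : ∀ c, c ∈ K.ideal (Set.Ioi i) ↔ A.cornerInc f c ∈ H.ideal (Set.Ioi i))
  (he : A.cornerInc f (K.e i) - H.e i ∈ H.ideal (Set.Ioi i))
include hid he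

omit [IsLocalRing 𝕜] in
theorem nonempty_trunc_standard_iso :
    Nonempty ((GrMod.truncFunctor hA f).obj (H.standard i) ≅ K.standard i) := by
  have hup := isUpperSet_Ioi i
  refine GrMod.nonempty_truncObj_iso_of_cyclic hA (H.gen_mem_gr i) (H.exists_smul_gen i) ?_
    (K.gen_mem_gr i) (K.exists_smul_gen i) fun c => ?_
  · rw [← sub_eq_zero, ← one_smul A (H.gen i), smul_smul, ← sub_smul, smul_gen_eq_zero]
    have := H.ideal_mul_left hup he (1 - f.val)
    rw [mul_sub, sub_mul, mul_cornerInc, one_mul, sub_self, zero_sub, Submodule.neg_mem_iff] at this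
    rw [mul_one, ← neg_sub, neg_mul, Submodule.neg_mem_iff]
    exact this
  · rw [smul_gen_eq_zero, smul_gen_eq_zero, hid, cornerInc_mul]
    have h1 := H.ideal_mul_left hup he (A.cornerInc f c)
    rw [mul_sub] at h1
    exact ⟨fun h => by simpa using Submodule.add_mem _ h1 h,
      fun h => by simpa using Submodule.sub_mem _ h h1⟩

theorem nonempty_trunc_simple_iso :
    Nonempty ((GrMod.truncFunctor hA f).obj (H.simple i) ≅ K.simple i) := by
  have hup := isUpperSet_Ioi i
  refine GrMod.nonempty_truncObj_iso_of_cyclic hA (H.simpleGen_mem_gr i)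
    (H.exists_smul_simpleGen i) ?_ (K.simpleGen_mem_gr i) (K.exists_smul_simpleGen i) fun c => ?_
  · rw [← sub_eq_zero, ← one_smul A (H.simpleGen i), smul_smul, ← sub_smul]
    apply H.smul_simpleGen_of_mem
    have := H.ideal_mul_left hup he (1 - f.val)
    rw [mul_sub, sub_mul, mul_cornerInc, one_mul, sub_self, zero_sub, Submodule.neg_mem_iff] at this
    rw [mul_one, ← neg_sub, neg_mul, Submodule.neg_mem_iff]
    exact this
  · rw [smul_simpleGen_eq_zero, smul_simpleGen_eq_zero]
    simp only [hid, coeff_congr he, map_sub, map_smul, cornerInc_mul]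
    constructor
    · exact fun h b => h (A.cornerInc f b)
    · intro h b
      obtain ⟨r, hr, h⟩ := h (A.cornerProj f b)
      refine ⟨r, hr, ?_⟩
      have h1 : A.cornerInc f (K.e i) * (A.cornerInc f (A.cornerProj f b) * A.cornerInc f c) =
          A.cornerInc f (K.e i) * (b * A.cornerInc f c) := by
        rw [cornerInc_proj, mul_assoc (f.val * b), mul_cornerInc, mul_assoc f.val,
          ← mul_assoc _ f.val, cornerInc_mul_idem]
      rwa [h1] at h

end Truncation

end HeredityData

/-! ### The truncation functor at a full idempotent -/

open GrSAlg

/-- A homogeneous decomposition `1 = ∑ a_k f b_k`, witnessing that the idempotent `f` is full,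
that is, `A f A = A`. -/
structure FullDecomposition {𝕜 : Type u} [CommRing 𝕜] (A : GrSAlg.{u, v} 𝕜) (f : A.HomIdem)
    (ι : Type) [Fintype ι] where
  a : ι → A
  b : ι → A
  deg : ι → Bideg
  a_mem : ∀ k, a k ∈ A.gr (-deg k)
  b_mem : ∀ k, b k ∈ A.gr (deg k)
  sum_eq : ∑ k, a k * f.val * b k = 1

namespace FullDecomposition

variable {𝕜 : Type u} [CommRing 𝕜] {A : GrSAlg.{u, v} 𝕜} {f : A.HomIdem} {ι : Type} [Fintype ι]
  (D : FullDecomposition A f ι)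

/-- The degree zero part of a decomposition `1 = ∑ c_k x_k f y_k` into homogeneous summands is a
homogeneous decomposition. -/
theorem exists_of_one_mem_span {f : A.HomIdem}
    (h : (1 : A) ∈ Submodule.span 𝕜 {z | ∃ d d' : Bideg, ∃ x ∈ A.gr d, ∃ y ∈ A.gr d',
      z = x * f.val * y}) : ∃ n : ℕ, Nonempty (FullDecomposition A f (Fin n)) := by
  have h1 : (1 : A) ∈ Submodule.span 𝕜 {z | ∃ d : Bideg, ∃ x ∈ A.gr (-d), ∃ y ∈ A.gr d,
      z = x * f.val * y} := by
    have h2 : homogComp A.internal 0 (1 : A) = 1 := by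
      rw [homogComp_of_mem _ A.one_mem, if_pos rfl]
    rw [← h2]
    refine (Submodule.span_le.2 ?_ : _ ≤ Submodule.comap (homogComp A.internal 0)
      (Submodule.span 𝕜 {z | ∃ d : Bideg, ∃ x ∈ A.gr (-d), ∃ y ∈ A.gr d, z = x * f.val * y})) h
    rintro _ ⟨d, d', x, hx, y, hy, rfl⟩
    have h3 : x * f.val * y ∈ A.gr (d + d') := by
      simpa using A.mul_mem (A.mul_mem hx f.mem) hy
    rw [SetLike.mem_coe, Submodule.mem_comap, homogComp_of_mem _ h3]
    split_ifs with hd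
    · refine Submodule.subset_span ⟨d', x, ?_, y, hy, rfl⟩
      rwa [← eq_neg_of_add_eq_zero_left hd]
    · exact Submodule.zero_mem _
  obtain ⟨n, c, g, hg⟩ := Submodule.mem_span_set'.1 h1
  choose d x hx y hy hxy using fun k => (g k).2
  refine ⟨n, ⟨⟨fun k => c k • x k, y, d, fun k => Submodule.smul_mem _ _ (hx k), hy, ?_⟩⟩⟩
  rw [← hg]
  refine Finset.sum_congr rfl fun k _ => ?_
  rw [hxy, smul_mul_assoc, smul_mul_assoc]

theorem sum_mul_eq (x : A) : ∑ k, D.a k * f.val * D.b k * x = x := by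
  rw [← Finset.sum_mul, D.sum_eq, one_mul]

theorem sum_smul_eq {V : GrMod A} (v : V) : ∑ k, D.a k • f.val • D.b k • v = v := by
  conv_rhs => rw [← one_smul A v, ← D.sum_eq, Finset.sum_smul]
  simp only [mul_smul]

theorem sum_proj_mul_proj (x y : A) :
    ∑ l, A.cornerProj f (x * D.a l) * A.cornerProj f (D.b l * y) = A.cornerProj f (x * y) := by
  apply cornerInc_injective
  have hf : ∀ z : A, f.val * (f.val * z) = f.val * z := fun z => by rw [← mul_assoc, f.idem.eq]
  rw [map_sum, cornerInc_proj]
  conv_rhs => rw [← D.sum_mul_eq y, Finset.mul_sum, Finset.mul_sum, Finset.sum_mul]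
  refine Finset.sum_congr rfl fun l _ => ?_
  rw [cornerInc_mul, cornerInc_proj, cornerInc_proj]
  simp only [mul_assoc, hf]

end FullDecomposition

/-! ### Fullness and faithfulness -/

namespace FullDecomposition

variable {𝕜 : Type u} [CommRing 𝕜] {A : GrSAlg.{u, v} 𝕜} {f : A.HomIdem} {ι : Type} [Fintype ι]
  (D : FullDecomposition A f ι) (hA : Module.Finite 𝕜 A)
include D

theorem faithful_truncFunctor : (GrMod.truncFunctor hA f).Faithful := by
  refine ⟨fun {V W} g g' h => ?_⟩
  have h1 : ∀ v : V, g.toLin (f.val • v) = g'.toLin (f.val • v) := by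
    intro v
    have h2 := congrArg
      (fun φ : (GrMod.truncFunctor hA f).obj V ⟶ (GrMod.truncFunctor hA f).obj W =>
      GrMod.Hom.toLin φ (⟨f.val • v, v, rfl⟩ : GrMod.truncSub f V)) h
    exact congrArg Subtype.val h2
  refine GrMod.Hom.ext (LinearMap.ext fun v => ?_)
  rw [← D.sum_smul_eq v, map_sum, map_sum]
  refine Finset.sum_congr rfl fun k _ => ?_
  rw [map_smul g.toLin (D.a k), map_smul g'.toLin (D.a k), h1]

theorem full_truncFunctor : (GrMod.truncFunctor hA f).Full := by
  refine ⟨fun {V W} φ => ?_⟩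
  let t : V → GrMod.truncSub f V := fun v => ⟨f.val • v, v, rfl⟩
  let φ' : GrMod.truncSub f V →ₗ[A.corner f] GrMod.truncSub f W := GrMod.Hom.toLin φ
  have hφ' : ∀ v, f.val • (φ' v).1 = (φ' v).1 := fun v => GrMod.truncSub_smul f W (φ' v).2
  have hφs : ∀ (c : A.corner f) v, (φ' (c • v)).1 = A.cornerInc f c • (φ' v).1 := fun c v =>
    congrArg Subtype.val (map_smul φ' c v)
  have ht : ∀ (x : A) (v : V), t (x • v) = ∑ l, A.cornerProj f (x * D.a l) • t (D.b l • v) := by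
    intro x v
    apply Subtype.ext
    rw [AddSubmonoidClass.coe_finsetSum]
    change f.val • x • v = ∑ l, (f.val * (x * D.a l) * f.val) • (f.val • D.b l • v)
    conv_lhs => rw [← D.sum_smul_eq v, Finset.smul_sum, Finset.smul_sum]
    refine Finset.sum_congr rfl fun l _ => ?_
    simp only [smul_smul, mul_assoc]
    rw [← mul_assoc f.val f.val, f.idem.eq]
  let g : V →ₗ[A] W :=
    { toFun := fun v => ∑ k, D.a k • (φ' (t (D.b k • v))).1
      map_add' := fun v w => by
        rw [← Finset.sum_add_distrib]
        refine Finset.sum_congr rfl fun k _ => ?_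
        have : t (D.b k • (v + w)) = t (D.b k • v) + t (D.b k • w) :=
          Subtype.ext (by simp [t])
        rw [this, map_add, ← smul_add]
        rfl
      map_smul' := fun x v => by
        rw [RingHom.id_apply]
        calc ∑ k, D.a k • (φ' (t (D.b k • x • v))).1
            = ∑ k, ∑ l, (D.a k * f.val * D.b k * (x * D.a l)) • (φ' (t (D.b l • v))).1 := by
              refine Finset.sum_congr rfl fun k _ => ?_
              rw [smul_smul, ht, map_sum, AddSubmonoidClass.coe_finsetSum, Finset.smul_sum]
              refine Finset.sum_congr rfl fun l _ => ?_
              rw [hφs, cornerInc_proj, mul_smul _ f.val, hφ', smul_smul]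
              simp only [mul_assoc]
          _ = ∑ l, (x * D.a l) • (φ' (t (D.b l • v))).1 := by
              rw [Finset.sum_comm]
              refine Finset.sum_congr rfl fun l _ => ?_
              rw [← Finset.sum_smul, D.sum_mul_eq]
          _ = x • ∑ k, D.a k • (φ' (t (D.b k • v))).1 := by
              rw [Finset.smul_sum]
              simp only [mul_smul] }
  refine ⟨(⟨g, fun d v hv => ?_⟩ : GrMod.Hom V W), ?_⟩
  · refine Submodule.sum_mem _ fun k _ => ?_
    have h1 : f.val • D.b k • v ∈ V.gr (D.deg k + d) := by
      simpa using V.smul_mem f.mem (V.smul_mem (D.b_mem k) hv)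
    have h2 : (φ' (t (D.b k • v))).1 ∈ W.gr (D.deg k + d) :=
      GrMod.Hom.map_mem φ (D.deg k + d) (t (D.b k • v)) h1
    simpa using W.smul_mem (D.a_mem k) h2
  · refine GrMod.Hom.ext (LinearMap.ext fun v => ?_)
    refine Subtype.ext ?_
    suffices h : ∀ v : GrMod.truncSub f V,
      ∑ k, D.a k • (φ' (t (D.b k • v.1))).1 = (φ' v).1 from h v
    clear v
    intro v
    rw [← hφ' v, ← D.sum_smul_eq (f.val • (φ' v).1)]
    refine Finset.sum_congr rfl fun k _ => ?_
    have h1 : t (D.b k • v.1) = A.cornerProj f (D.b k) • v := by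
      refine Subtype.ext ?_
      change f.val • D.b k • v.1 = (f.val * D.b k * f.val) • v.1
      rw [mul_smul, GrMod.truncSub_smul f V v.2, mul_smul]
    rw [h1, hφs, cornerInc_proj, mul_smul, mul_smul]

end FullDecomposition

/-! ### Induction of modules from the truncation -/

namespace FullDecomposition

variable {𝕜 : Type u} [CommRing 𝕜] {A : GrSAlg.{u, v} 𝕜} {f : A.HomIdem} {ι : Type} [Fintype ι]
  (D : FullDecomposition A f ι) (N : GrMod (A.corner f))

/-- The action of `x ∈ A` on `N^ι` through the matrix `(f b_k x a_l f)`. -/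
def act (x : A) : (ι → N) →ₗ[𝕜] (ι → N) where
  toFun n k := ∑ l, A.cornerProj f (D.b k * x * D.a l) • n l
  map_add' n n' := by
    funext k
    simp only [Pi.add_apply, smul_add, Finset.sum_add_distrib]
  map_smul' c n := by
    funext k
    simp only [Pi.smul_apply, RingHom.id_apply, Finset.smul_sum]
    refine Finset.sum_congr rfl fun l _ => ?_
    rw [← algebraMap_smul (A.corner f) c, ← algebraMap_smul (A.corner f) c, smul_smul, smul_smul,
      Algebra.commutes]

theorem act_apply (x : A) (n : ι → N) (k : ι) :
    D.act N x n k = ∑ l, A.cornerProj f (D.b k * x * D.a l) • n l := rfl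

theorem act_mul (x y : A) (n : ι → N) : D.act N (x * y) n = D.act N x (D.act N y n) := by
  funext k
  simp only [act_apply, Finset.smul_sum]
  rw [Finset.sum_comm]
  refine Finset.sum_congr rfl fun m _ => ?_
  simp only [smul_smul]
  rw [← Finset.sum_smul]
  have := D.sum_proj_mul_proj (D.b k * x) (y * D.a m)
  simp only [mul_assoc] at this ⊢
  rw [this]

theorem act_add (x y : A) (n : ι → N) : D.act N (x + y) n = D.act N x n + D.act N y n := by
  funext k
  simp only [act_apply, Pi.add_apply, mul_add, add_mul, map_add, add_smul, Finset.sum_add_distrib]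

theorem act_smul (c : 𝕜) (x : A) (n : ι → N) : D.act N (c • x) n = c • D.act N x n := by
  funext k
  simp only [act_apply, Pi.smul_apply, mul_smul_comm, smul_mul_assoc, map_smul, smul_assoc,
    Finset.smul_sum]

/-- The underlying module of the induced module `Af ⊗ N`, realized as the image of the idempotent
matrix `(f b_k a_l f)` acting on `N^ι`. -/
def indSub : Submodule 𝕜 (ι → N) := LinearMap.range (D.act N 1)

theorem act_mem (x : A) (n : ι → N) : D.act N x n ∈ D.indSub N :=
  ⟨D.act N x n, by rw [← act_mul, one_mul]⟩

theorem act_one {n : ι → N} (hn : n ∈ D.indSub N) : D.act N 1 n = n := by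
  obtain ⟨m, rfl⟩ := hn
  rw [← act_mul, one_mul]

/-- The grading of `N^ι`, shifted in the component `k` by the degree of `b_k`. -/
def piGr (e : Bideg) : Submodule 𝕜 (ι → N) :=
  Submodule.pi Set.univ fun k => N.gr (e + D.deg k)

theorem mem_piGr {e : Bideg} {n : ι → N} : n ∈ D.piGr N e ↔ ∀ k, n k ∈ N.gr (e + D.deg k) := by
  simp [piGr]

theorem isInternal_piGr : DirectSum.IsInternal (D.piGr N) := by
  classical
  rw [DirectSum.isInternal_submodule_iff_iSupIndep_and_iSup_eq_top]
  constructor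
  · rw [iSupIndep_iff_finsetSum_eq_zero_imp_eq_zero]
    intro s x hx h0 i hi
    funext k
    have h1 := congrArg (homogComp N.internal (i + D.deg k)) (congrFun h0 k)
    rw [Finset.sum_apply, map_sum, Finset.sum_congr rfl fun j hj =>
      homogComp_of_mem N.internal ((D.mem_piGr N).1 (hx j hj) k) (i + D.deg k)] at h1
    simpa [hi] using h1
  · rw [eq_top_iff]
    intro n _
    rw [← Finset.univ_sum_single n]
    refine Submodule.sum_mem _ fun k _ => ?_
    have hn : n k ∈ ⨆ d, N.gr d := by simp [N.internal.submodule_iSup_eq_top]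
    refine Submodule.iSup_induction N.gr
      (motive := fun v => (Pi.single k v : ι → N) ∈ ⨆ e, D.piGr N e) hn ?_ ?_ ?_
    · intro e v hv
      refine Submodule.mem_iSup_of_mem (e - D.deg k) ((D.mem_piGr N).2 fun k' => ?_)
      by_cases hk : k' = k
      · subst hk
        simpa using hv
      · rw [Pi.single_eq_of_ne hk]
        exact Submodule.zero_mem _
    · rw [Pi.single_zero]
      exact Submodule.zero_mem _
    · intro v w hv hw
      rw [Pi.single_add]
      exact Submodule.add_mem _ hv hw

theorem act_mem_piGr {c e : Bideg} {x : A} (hx : x ∈ A.gr c) {n : ι → N} (hn : n ∈ D.piGr N e) :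
    D.act N x n ∈ D.piGr N (c + e) := by
  rw [mem_piGr] at hn ⊢
  intro k
  rw [act_apply]
  refine Submodule.sum_mem _ fun l _ => ?_
  have h1 := N.smul_mem (cornerProj_mem_gr (f := f)
    (A.mul_mem (A.mul_mem (D.b_mem k) hx) (D.a_mem l))) (hn l)
  convert h1 using 2
  abel

/-- The `A`-module structure of the induced module. -/
@[reducible] def indModule : Module A (D.indSub N) where
  smul x n := ⟨D.act N x n.1, D.act_mem N x n.1⟩
  one_smul n := Subtype.ext (D.act_one N n.2)
  mul_smul x y n := Subtype.ext (D.act_mul N x y n.1)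
  smul_zero x := Subtype.ext (map_zero (D.act N x))
  smul_add x n n' := Subtype.ext (map_add (D.act N x) n.1 n'.1)
  add_smul x y n := Subtype.ext (D.act_add N x y n.1)
  zero_smul n := Subtype.ext (by
    have := D.act_smul N 0 0 n.1
    rwa [zero_smul, zero_smul] at this)

theorem finite_base (hA : Module.Finite 𝕜 A) : Module.Finite 𝕜 N := by
  have := N.finite
  have : Module.Finite 𝕜 (A.corner f) :=
    Module.Finite.of_surjective (A.cornerProj f) fun c => ⟨_, cornerProj_inc c⟩
  exact Module.Finite.trans (A.corner f) N

/-- The graded `A`-module `Af ⊗ N` induced from the graded `fAf`-module `N`. -/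
def ind (hA : Module.Finite 𝕜 A) : GrMod A :=
  letI := D.indModule N
  haveI : IsScalarTower 𝕜 A (D.indSub N) := ⟨fun c x n => Subtype.ext (D.act_smul N c x n.1)⟩
  { carrier := D.indSub N
    gr := fun e => (D.piGr N e).comap (D.indSub N).subtype
    internal := isInternal_comap (D.isInternal_piGr N) _ Subtype.val_injective (by
      rw [Submodule.range_subtype]
      rintro _ ⟨n, rfl⟩
      have hn : n ∈ ⨆ e, D.piGr N e := by simp [(D.isInternal_piGr N).submodule_iSup_eq_top]
      refine Submodule.iSup_induction (D.piGr N)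
        (motive := fun n => D.act N 1 n ∈ ⨆ e, D.indSub N ⊓ D.piGr N e) hn ?_ (by simp) ?_
      · intro e n hn
        refine Submodule.mem_iSup_of_mem e ⟨D.act_mem N 1 n, ?_⟩
        have := D.act_mem_piGr N A.one_mem hn
        rwa [zero_add] at this
      · intro n n' hn hn'
        rw [map_add]
        exact Submodule.add_mem _ hn hn')
    smul_mem := fun hx hn => D.act_mem_piGr N hx hn
    finite := by
      have := finite_base N hA
      have : Module.Finite 𝕜 (D.indSub N) := Module.Finite.range _
      exact Module.Finite.of_restrictScalars_finite 𝕜 A (D.indSub N) }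

/-- The isomorphism `N → f (Af ⊗ N)`, `n ↦ f ⊗ n`. -/
theorem nonempty_iso_trunc_ind (hA : Module.Finite 𝕜 A) :
    Nonempty ((GrMod.truncFunctor hA f).obj (D.ind N hA) ≅ N) := by
  let ψ₀ : N → (ι → N) := fun n k => A.cornerProj f (D.b k) • n
  have hψ₀ : ∀ (x : A) (hx : x * f.val = x) (n : N) (k : ι),
      D.act N x (ψ₀ n) k = A.cornerProj f (D.b k * x) • n := by
    intro x hx n k
    rw [act_apply]
    simp only [ψ₀, smul_smul]
    rw [← Finset.sum_smul]
    have := D.sum_proj_mul_proj (D.b k * x) 1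
    simp only [mul_one] at this
    rw [this]
  have hψf : ∀ n, D.act N f.val (ψ₀ n) = ψ₀ n := by
    intro n
    funext k
    rw [hψ₀ _ f.idem]
    congr 1
    apply cornerInc_injective
    rw [cornerInc_proj, cornerInc_proj, mul_assoc, mul_assoc, f.idem.eq, mul_assoc]
  let ψ : N → GrMod.truncSub f (D.ind N hA) := fun n =>
    ⟨(⟨ψ₀ n, hψf n ▸ D.act_mem N _ _⟩ : D.indSub N),
      (⟨ψ₀ n, hψf n ▸ D.act_mem N _ _⟩ : D.indSub N), Subtype.ext (hψf n).symm⟩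
  let χ₀ : (ι → N) → N := fun m => ∑ l, A.cornerProj f (D.a l) • m l
  have hχψ : ∀ n, χ₀ (ψ₀ n) = n := by
    intro n
    simp only [χ₀, ψ₀, smul_smul]
    rw [← Finset.sum_smul]
    have h1 := D.sum_proj_mul_proj 1 1
    simp only [mul_one, one_mul] at h1
    have h2 : A.cornerProj f 1 = 1 := by
      apply cornerInc_injective
      rw [cornerInc_proj, mul_one, f.idem.eq, cornerInc_one]
    rw [h1, h2, one_smul]
  have hψχ : ∀ m, D.act N f.val m = m → ψ₀ (χ₀ m) = m := by
    intro m hm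
    conv_rhs => rw [← hm]
    funext k
    simp only [ψ₀, χ₀, Finset.smul_sum, smul_smul, act_apply]
    refine Finset.sum_congr rfl fun l _ => ?_
    congr 1
    apply cornerInc_injective
    have hf : ∀ z : A, f.val * (f.val * z) = f.val * z := fun z => by rw [← mul_assoc, f.idem.eq]
    rw [cornerInc_mul, cornerInc_proj, cornerInc_proj, cornerInc_proj]
    simp only [mul_assoc, hf]
  have hmem : ∀ m : GrMod.truncSub f (D.ind N hA), D.act N f.val m.1.1 = m.1.1 := fun m =>
    congrArg Subtype.val (GrMod.truncSub_smul f (D.ind N hA) m.2)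
  let Ψ : N →ₗ[A.corner f] GrMod.truncSub f (D.ind N hA) :=
    { toFun := ψ
      map_add' := fun n n' => Subtype.ext (Subtype.ext (funext fun k => smul_add _ n n'))
      map_smul' := fun c n => Subtype.ext (Subtype.ext (funext fun k => by
        change A.cornerProj f (D.b k) • c • n = D.act N (A.cornerInc f c) (ψ₀ n) k
        rw [hψ₀ _ (cornerInc_mul_idem c), smul_smul]
        congr 1
        apply cornerInc_injective
        rw [cornerInc_mul, cornerInc_proj, cornerInc_proj]
        simp only [mul_assoc, mul_cornerInc, cornerInc_mul_idem])) }
  have hΨ : Function.Bijective Ψ := by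
    constructor
    · intro n n' h
      have h1 : ψ₀ n = ψ₀ n' := congrArg (fun m : GrMod.truncSub f (D.ind N hA) => m.1.1) h
      rw [← hχψ n, h1, hχψ]
    · intro m
      exact ⟨χ₀ m.1.1, Subtype.ext (Subtype.ext (hψχ _ (hmem m)))⟩
  let E := LinearEquiv.ofBijective Ψ hΨ
  have hE : ∀ m, E.symm m = χ₀ m.1.1 := by
    intro m
    rw [LinearEquiv.symm_apply_eq]
    exact (Subtype.ext (Subtype.ext (hψχ _ (hmem m)))).symm
  refine ⟨⟨(⟨E.symm.toLinearMap, fun d m hm => ?_⟩ :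
      GrMod.Hom (GrMod.truncObj hA f (D.ind N hA)) N),
    (⟨Ψ, fun d n hn => ?_⟩ : GrMod.Hom N (GrMod.truncObj hA f (D.ind N hA))), ?_, ?_⟩⟩
  · suffices h : χ₀ m.1.1 ∈ N.gr d from (hE m).symm ▸ h
    refine Submodule.sum_mem _ fun l _ => ?_
    have h1 : m.1.1 l ∈ N.gr (d + D.deg l) := (D.mem_piGr N).1 hm l
    have h2 := N.smul_mem (cornerProj_mem_gr (f := f) (D.a_mem l)) h1
    convert h2 using 2
    abel
  · change ψ₀ n ∈ D.piGr N d
    rw [mem_piGr]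
    intro k
    rw [add_comm]
    exact N.smul_mem (cornerProj_mem_gr (f := f) (D.b_mem k)) hn
  · exact GrMod.Hom.ext (LinearMap.ext fun m => E.apply_symm_apply m)
  · exact GrMod.Hom.ext (LinearMap.ext fun n => E.symm_apply_apply n)

include D in
/-- Truncation at a full idempotent is an equivalence. -/
theorem isEquivalence_truncFunctor (hA : Module.Finite 𝕜 A) :
    (GrMod.truncFunctor hA f).IsEquivalence where
  faithful := D.faithful_truncFunctor hA
  full := D.full_truncFunctor hA
  essSurj := ⟨fun N => ⟨D.ind N hA, D.nonempty_iso_trunc_ind N hA⟩⟩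

end FullDecomposition

namespace HeredityData

variable {𝕜 : Type u} [CommRing 𝕜] {A : GrSAlg.{u, v} 𝕜} {I : Type*} [PartialOrder I]

/-- An idempotent fixing all initial elements is full, since `x y = x f y` for `x ∈ X(i)`,
`y ∈ Y(i)`. -/
theorem isEquivalence_truncFunctor (H : HeredityData A I) {f : A.HomIdem}
    (he : ∀ i, H.e i * f.val = H.e i) (hA : Module.Finite 𝕜 A) :
    (GrMod.truncFunctor hA f).IsEquivalence := by
  have h1 : (1 : A) ∈ Submodule.span 𝕜 {z | ∃ d d' : Bideg, ∃ x ∈ A.gr d, ∃ y ∈ A.gr d',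
      z = x * f.val * y} := by
    have h2 : (1 : A) ∈ prodSpan A H.X H.Y Set.univ := by
      rw [H.span_eq_top]
      trivial
    refine Submodule.span_mono ?_ h2
    rintro _ ⟨i, -, x, hx, y, hy, rfl⟩
    obtain ⟨-, d, hd⟩ := H.X_homog i x hx
    obtain ⟨-, d', hd'⟩ := H.Y_homog i y hy
    exact ⟨d, d', x, hd, y, hd', by rw [X_mul_idem he hx]⟩
  obtain ⟨n, ⟨D⟩⟩ := FullDecomposition.exists_of_one_mem_span h1
  exact D.isEquivalence_truncFunctor hA

end HeredityData

/-! ### The basic truncation -/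

theorem mainTheorem1 {𝕜 : Type u} [CommRing 𝕜] [IsLocalRing 𝕜] (A : GrSAlg.{u, v} 𝕜)
    {I : Type*} [PartialOrder I] [Fintype I]
    (𝔞 : Subalgebra 𝕜 A) (h𝔞 : IsHomogSub A.gr (Subalgebra.toSubmodule 𝔞))
    (H : HeredityData A I) (h : HeredityData (A.sub 𝔞 h𝔞) I)
    (hconf : HeredityData.IsConforming (A.subIncl 𝔞 h𝔞) H h) :
    ∃ (H' : HeredityData A I) (h' : HeredityData (A.sub 𝔞 h𝔞) I),
      HeredityData.IsConforming (A.subIncl 𝔞 h𝔞) H' h' ∧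
      -- the same ideals
      (∀ Ω : Set I, IsUpperSet Ω → H'.ideal Ω = H.ideal Ω ∧ h'.ideal Ω = h.ideal Ω) ∧
      -- the new initial elements
      (∀ i, IsPrimitiveIdem (h'.e i) ∧
        h.e i * h'.e i = h'.e i ∧ h'.e i * h.e i = h'.e i ∧
        h'.e i - h.e i ∈ h.ideal (Set.Ioi i)) ∧
      -- the idempotent `f = ∑ e'_i` of `𝔞`, also denoted `fA` as an idempotent of `A`
      ∃ f : (A.sub 𝔞 h𝔞).HomIdem, f.val = ∑ i, h'.e i ∧
        let fA : A.HomIdem := f.ofSub A 𝔞 h𝔞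
        -- (i), (ii)
        H'.IsStronglyAdapted fA ∧ H'.IBar fA = Set.univ ∧
        ∃ (K : HeredityData (A.corner fA) I) (k : HeredityData ((A.sub 𝔞 h𝔞).corner f) I),
          H'.IsTruncation fA K ∧
          HeredityData.IsConforming (A.cornerSubIncl 𝔞 h𝔞 f) K k ∧
          -- (iii)
          k.IsBasic ∧
          ((A.parity 1 : Set A) ⊆ A.jacobson → K.IsBasic) ∧
          -- (iv)
          (GrMod.truncFunctor H.finite fA).IsEquivalence ∧
          (GrMod.truncFunctor h.finite f).IsEquivalence ∧
          ∀ i,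
            Nonempty ((GrMod.truncFunctor H.finite fA).obj (H.simple i) ≅ K.simple i) ∧
            Nonempty ((GrMod.truncFunctor H.finite fA).obj (H.standard i) ≅ K.standard i) ∧
            Nonempty ((GrMod.truncFunctor h.finite f).obj (h.simple i) ≅ k.simple i) ∧
            Nonempty ((GrMod.truncFunctor h.finite f).obj (h.standard i) ≅ k.standard i) := by
  -- primitive summands of the initial elements of `𝔞`
  choose e he0 he1 he2 he3 he4 hek using h.exists_killsHead
  have hr : h.IsRefinement e := ⟨he0, he1, he2, he3, he4⟩
  obtain ⟨H', h', hconf', hid, rfl⟩ := hconf.exists_refinement hr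
  have hup := fun i : I => isUpperSet_Ioi i
  have hk' : ∀ i j, j ≠ i → h'.KillsHead (h'.e j) i := fun i j hji =>
    (hek j i hji.symm).congr (hid _ (hup i)).2 (he4 i)
  -- the truncating idempotent, and its image in `A`
  let f : (A.sub 𝔞 h𝔞).HomIdem :=
    { val := ∑ i, h'.e i
      idem := by
        rw [IsIdempotentElem, Finset.mul_sum]
        exact Finset.sum_congr rfl fun i _ => hr.sum_mul i
      mem := Submodule.sum_mem _ fun i _ => he0 i }
  have hf : f.val = ∑ i, h'.e i := rfl
  have hfA : (f.ofSub A 𝔞 h𝔞).val = ∑ i, H'.e i :=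
    (map_sum (A.subIncl 𝔞 h𝔞) h'.e Finset.univ).trans
      (Finset.sum_congr rfl fun i _ => hconf'.e_eq i)
  obtain ⟨hsa, hbar, hfe⟩ := H'.isStronglyAdapted_sum hfA
  obtain ⟨hsa', -, hfe'⟩ := h'.isStronglyAdapted_sum hf
  obtain ⟨K, hK⟩ := HeredityData.exists_truncation hsa.1 hfe
  obtain ⟨k, hk⟩ := HeredityData.exists_truncation hsa'.1 hfe'
  refine ⟨H', h', hconf', hid, fun i => ⟨?_, he2 i, he3 i, he4 i⟩, f, hf, hsa, hbar, K, k, hK,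
    hconf'.truncation hK hk, hk.isBasic hsa'.1 hf hk', fun hJ => hK.isBasic hsa.1 hfA ?_,
    H'.isEquivalence_truncFunctor (fun i => (hfe i).2) _,
    h'.isEquivalence_truncFunctor (fun i => (hfe' i).2) _, fun i => ?_⟩
  · exact h.isPrimitiveIdem_of_killsHead (he1 i) (he2 i) (he3 i) (he4 i)
      fun j hij => hek i j hij.ne'
  · intro i j hji
    rw [← hconf'.e_eq]
    exact hconf'.killsHead hJ (hk' i j hji)
  · have hidA : ∀ c, c ∈ K.ideal (Set.Ioi i) ↔
        A.cornerInc (f.ofSub A 𝔞 h𝔞) c ∈ H.ideal (Set.Ioi i) := fun c => by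
      rw [hK.mem_ideal_iff hsa.1, (hid _ (hup i)).1]
    have hida : ∀ c, c ∈ k.ideal (Set.Ioi i) ↔
        (A.sub 𝔞 h𝔞).cornerInc f c ∈ h.ideal (Set.Ioi i) := fun c => by
      rw [hk.mem_ideal_iff hsa'.1, (hid _ (hup i)).2]
    have heA : A.cornerInc (f.ofSub A 𝔞 h𝔞) (K.e i) - H.e i ∈ H.ideal (Set.Ioi i) := by
      rw [hK.inc_e, ← hconf'.e_eq, ← hconf.e_eq, ← map_sub]
      exact hconf.map_ideal (he4 i)
    have hea : (A.sub 𝔞 h𝔞).cornerInc f (k.e i) - h.e i ∈ h.ideal (Set.Ioi i) := by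
      rw [hk.inc_e]
      exact he4 i
    exact ⟨HeredityData.nonempty_trunc_simple_iso _ hidA heA,
      HeredityData.nonempty_trunc_standard_iso _ hidA heA,
      HeredityData.nonempty_trunc_simple_iso _ hida hea,
      HeredityData.nonempty_trunc_standard_iso _ hida hea⟩
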